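/- Let $V$ be a finite-dimensional $\mathbb{Q}$-vector space with a rational Hodge structure, i.e. a decomposition $V_{\mathbb{C}}=\bigoplus_{p,q\in\mathbb{Z}}V^{p,q}$ with $\overline{V^{p,q}}=V^{q,p}$ whose weight gradation $V_{\mathbb{C}}=\bigoplus_m\bigl(\bigoplus_{p+q=m}V^{p,q}\bigr)$ is defined over $\mathbb{Q}$, say $V=\bigoplus_m V_m$. Let $\mathbb{S}=\mathrm{Res}_{\mathbb{C}/\mathbb{R}}\mathbb{G}_m$, and let $h\colon\mathbb{S}\to \mathrm{GL}_{V_{\mathbb{R}}}$ be the corresponding homomorphism, for which $h(z)$ acts on $V^{p,q}$ as $z^{-p}\bar z^{-q}$; let $w_h\colon\mathbb{G}_m\to \mathrm{GL}_{V}$ be the weight homomorphism, for which $w_h(a)$ acts on $V_m$ as $a^{m}$. Let $G$ be the Mumford–Tate group of $(V,h)$, i.e. the smallest algebraic subgroup of $\mathrm{GL}_V$ over $\mathbb{Q}$ such that $G_{\mathbb{R}}\supset h(\mathbb{S})$; the image of $w_h$ is a central subgroup of $G$. A polarization of the Hodge structure $V_m$ of weight $m$ is a morphism of Hodge structures $\psi\colon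 V_m\otimes V_m\to\mathbb{Q}(-m)$ such that $(x,y)\mapsto(2\pi i)^m\psi_{\mathbb{R}}(x,h(i)y)$ is symmetric and positive definite on $(V_m)_{\mathbb{R}}$; $(V,h)$ is polarizable if every $V_m$ has a polarization. An involution $\theta$ of a real algebraic group $Q$ is a Cartan involution if the group $\{g\in Q(\mathbb{C})\mid g=\theta(\bar g)\}$ is compact (the identity is allowed as an involution). Then $(G,h)$ satisfies the condition (SV2*), that $\mathrm{inn}(h(i))$ is a Cartan involution of the real algebraic group $(G/w_h(\mathbb{G}_m))_{\mathbb{R}}$, if and only if $(V,h)$ is polarizable. Consequently, if $(V,h)$ is polarizable, then $G$ is a (connected) reductive group. -/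

import Mathlib

open scoped TensorProduct

noncomputable section

namespace HodgeMT

/-! ### Complexifications and their complex conjugation -/

/-- The complexification `V_ℂ = ℂ ⊗ V` of a rational vector space. -/
abbrev Cx (V : Type*) [AddCommGroup V] [Module ℚ V] : Type _ := ℂ ⊗[ℚ] V

/-- The group `GL(V_ℂ)`, that is, the group of complex points of the algebraic group `GL_V`. -/
abbrev GLC (V : Type*) [AddCommGroup V] [Module ℚ V] : Type _ :=
  LinearMap.GeneralLinearGroup ℂ (Cx V)

section Complexification

variable {V : Type*} [AddCommGroup V] [Module ℚ V]

/-- The conjugation `z ⊗ v ↦ conj z ⊗ v` as a `ℚ`-linear map. -/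
def conjQ : Cx V →ₗ[ℚ] Cx V :=
  LinearMap.rTensor V (Complex.conjAe.toLinearMap.restrictScalars ℚ)

@[simp] theorem conjQ_tmul (z : ℂ) (v : V) :
    conjQ (z ⊗ₜ[ℚ] v) = (starRingEnd ℂ z) ⊗ₜ[ℚ] v := rfl

theorem conjQ_conjQ (x : Cx V) : conjQ (conjQ x) = x := by
  induction x using TensorProduct.induction_on with
  | zero => simp
  | tmul z v => simp
  | add x y hx hy => rw [map_add, map_add, hx, hy]

theorem conjQ_smul (a : ℂ) (x : Cx V) : conjQ (a • x) = (starRingEnd ℂ a) • conjQ x := by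
  induction x using TensorProduct.induction_on with
  | zero => simp
  | tmul z v => simp [TensorProduct.smul_tmul']
  | add x y hx hy => rw [smul_add, map_add, map_add, hx, hy, smul_add]

/-- Complex conjugation on `V_ℂ` as a conjugate-linear bijection. Its fixed points are `V_ℝ`. -/
def conj : Cx V ≃ₛₗ[starRingEnd ℂ] Cx V where
  toFun := conjQ
  invFun := conjQ
  map_add' := map_add _
  map_smul' := conjQ_smul
  left_inv := conjQ_conjQ
  right_inv := conjQ_conjQ

@[simp] theorem conj_tmul (z : ℂ) (v : V) :
    conj (z ⊗ₜ[ℚ] v) = (starRingEnd ℂ z) ⊗ₜ[ℚ] v := rfl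

@[simp] theorem conj_conj (x : Cx V) : conj (conj x) = x := conjQ_conjQ x

@[simp] theorem conj_symm (x : Cx V) : conj.symm x = conj x := rfl

/-- The extension `V_ℂ → ℂ` of a rational linear form on `V`. -/
def formC (f : Module.Dual ℚ V) : Cx V →ₗ[ℂ] ℂ :=
  ((Algebra.linearMap ℚ ℂ) ∘ₗ f).liftBaseChange ℂ

@[simp] theorem formC_tmul (f : Module.Dual ℚ V) (z : ℂ) (v : V) :
    formC f (z ⊗ₜ[ℚ] v) = z * (f v : ℂ) := by
  simp [formC]

theorem formC_conj (f : Module.Dual ℚ V) (x : Cx V) :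
    formC f (conj x) = starRingEnd ℂ (formC f x) := by
  induction x using TensorProduct.induction_on with
  | zero => simp
  | tmul z v => simp
  | add x y hx hy => rw [map_add, map_add, hx, hy, map_add, map_add]

/-- The complex bilinear extension to `V_ℂ` of a rational bilinear map `V × V → ℂ`. -/
def bilinC (B : V →ₗ[ℚ] V →ₗ[ℚ] ℂ) : Cx V →ₗ[ℂ] Cx V →ₗ[ℂ] ℂ :=
  (((LinearMap.liftBaseChangeEquiv (R := ℚ) (M := V) (N := ℂ) ℂ).toLinearMap.restrictScalars ℚ)
    ∘ₗ B).liftBaseChange ℂ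

@[simp] theorem bilinC_tmul (B : V →ₗ[ℚ] V →ₗ[ℚ] ℂ) (a b : ℂ) (v w : V) :
    bilinC B (a ⊗ₜ[ℚ] v) (b ⊗ₜ[ℚ] w) = a * (b * B v w) := by
  simp [bilinC]

/-! ### Algebraic subgroups of `GL_V` in characteristic zero

An algebraic subgroup of `GL_V` over a field `k` of characteristic zero is reduced, hence it is
determined by its group of points over an algebraically closed field; so the algebraic subgroups
of `GL_V` over `k ⊆ ℂ` are the subgroups of `GL(V_ℂ)` that are cut out by polynomials with
coefficients in `k` in the matrix coefficients (with respect to the rational structure `V`). -/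

/-- The matrix coefficient `g ↦ f (g v)` on `GL(V_ℂ)`, for `v` in `V` and `f` a linear form
on `V`. -/
def matrixCoeff (f : Module.Dual ℚ V) (v : V) : GLC V → ℂ :=
  fun g => formC f (g.1 (1 ⊗ₜ[ℚ] v))

/-- Polynomials with coefficients in `k` in the matrix coefficients. -/
def polyFunctions (V : Type*) [AddCommGroup V] [Module ℚ V] (k : Type*) [Field k] [Algebra k ℂ] :
    Subalgebra k (GLC V → ℂ) :=
  Algebra.adjoin k {F | ∃ (f : Module.Dual ℚ V) (v : V), F = matrixCoeff f v}

/-- `Z ⊆ GL(V_ℂ)` is the zero locus of a set of polynomials with coefficients in `k`. -/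
def IsZariskiClosed (k : Type*) [Field k] [Algebra k ℂ] (Z : Set (GLC V)) : Prop :=
  ∃ S : Set (GLC V → ℂ), S ⊆ polyFunctions V k ∧ Z = {g | ∀ F ∈ S, F g = 0}

/-- Connectedness of the algebraic group `G_ℂ` in the Zariski topology. -/
def IsConnectedAlg (G : Subgroup (GLC V)) : Prop :=
  ∀ A B : Set (GLC V), IsZariskiClosed ℂ A → IsZariskiClosed ℂ B →
    A ∪ B = (G : Set (GLC V)) → A ∩ B = ∅ → A = ∅ ∨ B = ∅

/-- A subgroup of `GL(V_ℂ)` all of whose elements are unipotent. -/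
def IsUnipotentSubgroup (N : Subgroup (GLC V)) : Prop :=
  ∀ g ∈ N, IsNilpotent ((g : Module.End ℂ (Cx V)) - 1)

/-- An algebraic subgroup `G` of `GL_V` is reductive if it is connected and its unipotent radical
over an algebraically closed field is trivial, i.e. every connected normal unipotent algebraic
subgroup of `G_ℂ` is trivial. -/
def IsReductive (G : Subgroup (GLC V)) : Prop :=
  IsConnectedAlg G ∧
    ∀ N : Subgroup (GLC V), N ≤ G → (∀ g ∈ G, ∀ n ∈ N, g * n * g⁻¹ ∈ N) →
      IsZariskiClosed ℂ (N : Set (GLC V)) → IsConnectedAlg N → IsUnipotentSubgroup N → N = ⊥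

/-- The classical topology on `GL(V_ℂ)`, as the unit group of the finite-dimensional complex
algebra `End(V_ℂ)` with its canonical vector space topology. -/
instance glcTopology (V : Type*) [AddCommGroup V] [Module ℚ V] : TopologicalSpace (GLC V) :=
  letI : TopologicalSpace (Module.End ℂ (Cx V)) := moduleTopology ℂ (Module.End ℂ (Cx V))
  inferInstanceAs (TopologicalSpace (Module.End ℂ (Cx V))ˣ)

/-- Complex conjugation `g ↦ ḡ` on `GL(V_ℂ)` with respect to the real form `GL(V_ℝ)`. -/
def conjGL : GLC V ≃* GLC V :=
  LinearMap.GeneralLinearGroup.congrLinearEquiv conj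

theorem conjGL_apply (g : GLC V) (x : Cx V) : (conjGL g).1 x = conj (g.1 (conj x)) := rfl

@[simp] theorem conjGL_conjGL (g : GLC V) : conjGL (conjGL g) = g := by
  apply Units.ext
  ext x
  simp [conjGL_apply]

theorem matrixCoeff_conjGL (f : Module.Dual ℚ V) (v : V) (g : GLC V) :
    matrixCoeff f v (conjGL g) = starRingEnd ℂ (matrixCoeff f v g) := by
  simp [matrixCoeff, conjGL_apply, formC_conj]

theorem polyFunctions_conjGL {F : GLC V → ℂ} (hF : F ∈ polyFunctions V ℚ) (g : GLC V) :
    F (conjGL g) = starRingEnd ℂ (F g) := by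
  induction hF using Algebra.adjoin_induction with
  | mem F hF =>
    obtain ⟨f, v, rfl⟩ := hF
    exact matrixCoeff_conjGL f v g
  | algebraMap r => simp [Pi.algebraMap_apply]
  | add x y _ _ hx hy => simp [hx, hy]
  | mul x y _ _ hx hy => simp [hx, hy]

theorem IsZariskiClosed.conjGL_mem {Z : Set (GLC V)} (hZ : IsZariskiClosed ℚ Z) {g : GLC V}
    (hg : g ∈ Z) : conjGL g ∈ Z := by
  obtain ⟨S, hS, rfl⟩ := hZ
  intro F hF
  rw [polyFunctions_conjGL (hS hF), hg F hF, map_zero]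

end Complexification

/-! ### Cartan involutions -/

/-- Let `G` be the group of complex points of a real algebraic group, with its classical topology,
and let `σ₀` be its complex conjugation. For `c` in `G`, the inner automorphism `θ = inn(c)` is a
Cartan involution if it is an involution, is defined over `ℝ`, and the group
`{g | g = θ(σ₀ g)}` is compact. -/
def InnIsCartanInvolution {G : Type*} [Group G] [TopologicalSpace G] (σ₀ : G ≃* G) (c : G) :
    Prop :=
  (∀ g, MulAut.conj c (MulAut.conj c g) = g) ∧
  (∀ g, MulAut.conj c (σ₀ g) = σ₀ (MulAut.conj c g)) ∧
  IsCompact {g : G | g = MulAut.conj c (σ₀ g)}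

/-! ### Rational Hodge structures -/

/-- A rational Hodge structure on `V`: a Hodge decomposition `V_ℂ = ⨁ V^{p,q}` with
`conj V^{p,q} = V^{q,p}` whose weight gradation is defined over `ℚ`. -/
structure RationalHodgeStructure (V : Type*) [AddCommGroup V] [Module ℚ V] where
  /-- the subspace `V^{p,q}` of `V_ℂ`, for `(p, q) ∈ ℤ × ℤ` -/
  piece : ℤ × ℤ → Submodule ℂ (Cx V)
  isInternal : DirectSum.IsInternal piece
  conj_mem : ∀ p q x, x ∈ piece (p, q) → conj x ∈ piece (q, p)
  weight_rational : ∀ m : ℤ, ∃ W : Submodule ℚ V,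
    W.baseChange ℂ = ⨆ p : ℤ, piece (p, m - p)

namespace RationalHodgeStructure

variable {V : Type*} [AddCommGroup V] [Module ℚ V] (H : RationalHodgeStructure V)

/-- The part `⨁_{p+q=m} V^{p,q}` of `V_ℂ` of weight `m`. -/
def weightC (m : ℤ) : Submodule ℂ (Cx V) := ⨆ p : ℤ, H.piece (p, m - p)

/-- The part `V_m = V ∩ ⨁_{p+q=m} V^{p,q}` of `V` of weight `m`. -/
def weight (m : ℤ) : Submodule ℚ V :=
  ((H.weightC m).restrictScalars ℚ).comap (TensorProduct.mk ℚ ℂ V 1)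

theorem mem_weight {m : ℤ} {v : V} : v ∈ H.weight m ↔ (1 : ℂ) ⊗ₜ[ℚ] v ∈ H.weightC m := Iff.rfl

theorem baseChange_weight (m : ℤ) : (H.weight m).baseChange ℂ = H.weightC m := by
  apply le_antisymm
  · rw [Submodule.baseChange_eq_span, Submodule.span_le]
    rintro _ ⟨v, hv, rfl⟩
    exact hv
  · obtain ⟨W, hW⟩ := H.weight_rational m
    change _ = H.weightC m at hW
    rw [← hW]
    apply Submodule.baseChange_mono
    intro v hv
    rw [mem_weight, ← hW]
    exact Submodule.tmul_mem_baseChange_of_mem 1 hv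

/-- The isomorphism from the external direct sum of the `V^{p,q}` to `V_ℂ`. -/
def decomp : (DirectSum (ℤ × ℤ) fun pq => H.piece pq) ≃ₗ[ℂ] Cx V :=
  LinearEquiv.ofBijective (DirectSum.coeLinearMap H.piece) H.isInternal

/-- The action of `(z₁, z₂) ∈ 𝕊(ℂ) = ℂˣ × ℂˣ` on `V_ℂ`, which is multiplication by
`z₁ ^ (-p) * z₂ ^ (-q)` on `V^{p,q}`. -/
def hEnd (z : ℂˣ × ℂˣ) : Module.End ℂ (Cx V) :=
  H.decomp.toLinearMap ∘ₗ
    (DFinsupp.mapRange.linearMap fun pq : ℤ × ℤ =>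
      (((z.1 ^ (-pq.1) * z.2 ^ (-pq.2) : ℂˣ) : ℂ) • LinearMap.id :
        H.piece pq →ₗ[ℂ] H.piece pq)) ∘ₗ
    H.decomp.symm.toLinearMap

theorem decomp_symm_of_mem {pq : ℤ × ℤ} {x : Cx V} (hx : x ∈ H.piece pq) :
    H.decomp.symm x = DirectSum.of (fun pq => H.piece pq) pq ⟨x, hx⟩ := by
  rw [LinearEquiv.symm_apply_eq]
  exact (DirectSum.coeAddMonoidHom_of H.piece pq ⟨x, hx⟩).symm

theorem hEnd_apply (z : ℂˣ × ℂˣ) {p q : ℤ} {x : Cx V} (hx : x ∈ H.piece (p, q)) :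
    H.hEnd z x = ((z.1 ^ (-p) * z.2 ^ (-q) : ℂˣ) : ℂ) • x := by
  simp only [hEnd, LinearMap.comp_apply, LinearEquiv.coe_coe, H.decomp_symm_of_mem hx]
  rw [← LinearEquiv.eq_symm_apply, map_smul, H.decomp_symm_of_mem hx]
  erw [DFinsupp.mapRange.linearMap_apply, DFinsupp.mapRange_single]
  erw [← DFinsupp.single_smul]
  rfl

/-- A property that is additive and holds on all the `V^{p,q}` holds on `V_ℂ`. -/
theorem induction_pieces {P : Cx V → Prop} (h0 : P 0) (hadd : ∀ x y, P x → P y → P (x + y))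
    (hp : ∀ p q, ∀ x ∈ H.piece (p, q), P x) (x : Cx V) : P x := by
  have hx : x ∈ ⨆ pq, H.piece pq := by
    rw [H.isInternal.submodule_iSup_eq_top]; trivial
  exact Submodule.iSup_induction _ hx (motive := P) (fun pq y hy => hp pq.1 pq.2 y hy) h0 hadd

/-- The homomorphism `h : 𝕊 → GL_V` on complex points, where `𝕊(ℂ) = ℂˣ × ℂˣ`, in which
`𝕊(ℝ) = ℂˣ` sits as the set of pairs `(z, conj z)`. -/
def h : ℂˣ × ℂˣ →* GLC V :=
  MonoidHom.toHomUnits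
    { toFun := H.hEnd
      map_one' := by
        ext x
        simp only [LinearMap.coe_restrictScalars, TensorProduct.AlgebraTensorModule.curry_apply,
          TensorProduct.curry_apply]
        refine H.induction_pieces (P := fun x => H.hEnd 1 x = (1 : Module.End ℂ (Cx V)) x)
          (by simp) (fun x y hx hy => by rw [map_add, map_add, hx, hy]) ?_ _
        intro p q x hx
        simp [H.hEnd_apply _ hx]
      map_mul' := by
        intro z w
        ext x
        simp only [LinearMap.coe_restrictScalars, TensorProduct.AlgebraTensorModule.curry_apply,
          TensorProduct.curry_apply]
        refine H.induction_pieces (P := fun x => H.hEnd (z * w) x = (H.hEnd z * H.hEnd w) x)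
          (by simp) (fun x y hx hy => by rw [map_add, map_add, hx, hy]) ?_ _
        intro p q x hx
        simp only [Module.End.mul_apply, H.hEnd_apply _ hx, map_smul, smul_smul,
          ← Units.val_mul]
        congr 2
        simp only [Prod.fst_mul, Prod.snd_mul, mul_zpow]
        exact mul_mul_mul_comm _ _ _ _ |>.trans (mul_comm _ _) }

theorem h_apply (z : ℂˣ × ℂˣ) {p q : ℤ} {x : Cx V} (hx : x ∈ H.piece (p, q)) :
    (H.h z).1 x = ((z.1 ^ (-p) * z.2 ^ (-q) : ℂˣ) : ℂ) • x := H.hEnd_apply z hx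

/-- The weight homomorphism `w_h : 𝔾_m → GL_V`, `w_h(a) = h(a⁻¹)`, on complex points. -/
def weightHom : ℂˣ →* GLC V where
  toFun a := H.h (a⁻¹, a⁻¹)
  map_one' := by rw [inv_one]; exact map_one H.h
  map_mul' a b := by
    rw [← map_mul, mul_inv]
    rfl

/-- The imaginary unit as an element of `ℂˣ`. -/
def iUnit : ℂˣ := Units.mk0 Complex.I Complex.I_ne_zero

/-- The Weil operator `C = h(i)`; the point `i ∈ ℂˣ = 𝕊(ℝ)` is `(i, conj i) ∈ 𝕊(ℂ)`. -/
def weilOperator : GLC V := H.h (iUnit, Units.map (starRingEnd ℂ : ℂ →* ℂ) iUnit)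

/-- The Mumford–Tate group: the smallest algebraic subgroup `G` of `GL_V` over `ℚ` such that
`G_ℝ ⊇ h(𝕊)` (given by its group of complex points). -/
def mumfordTate : Subgroup (GLC V) :=
  sInf {G : Subgroup (GLC V) | IsZariskiClosed ℚ (G : Set (GLC V)) ∧ ∀ z, H.h z ∈ G}

theorem h_mem_mumfordTate (z : ℂˣ × ℂˣ) : H.h z ∈ H.mumfordTate := by
  rw [mumfordTate, Subgroup.mem_sInf]
  exact fun G hG => hG.2 z

theorem conjGL_mem_mumfordTate {g : GLC V} (hg : g ∈ H.mumfordTate) :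
    conjGL g ∈ H.mumfordTate := by
  rw [mumfordTate, Subgroup.mem_sInf] at hg ⊢
  exact fun G hG => hG.1.conjGL_mem (hg G hG)

/-- Complex conjugation on the complex points of the Mumford–Tate group. -/
def mtConj : H.mumfordTate ≃* H.mumfordTate where
  toFun g := ⟨conjGL g, H.conjGL_mem_mumfordTate g.2⟩
  invFun g := ⟨conjGL g, H.conjGL_mem_mumfordTate g.2⟩
  left_inv g := Subtype.ext (conjGL_conjGL g.1)
  right_inv g := Subtype.ext (conjGL_conjGL g.1)
  map_mul' a b := Subtype.ext (map_mul conjGL a.1 b.1)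

/-- The subgroup `w_h(𝔾_m)` of the Mumford–Tate group. -/
def weightSubgroup : Subgroup H.mumfordTate := H.weightHom.range.subgroupOf H.mumfordTate

theorem conjGL_h (z : ℂˣ × ℂˣ) :
    conjGL (H.h z) = H.h (Units.map (starRingEnd ℂ : ℂ →* ℂ) z.2,
      Units.map (starRingEnd ℂ : ℂ →* ℂ) z.1) := by
  apply Units.ext
  apply LinearMap.ext
  intro x
  refine H.induction_pieces (P := fun x => (conjGL (H.h z)).1 x = (H.h (_, _)).1 x)
    (by simp) (fun x y hx hy => by rw [map_add, map_add, hx, hy]) ?_ x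
  intro p q x hx
  rw [conjGL_apply, H.h_apply _ hx, H.h_apply _ (H.conj_mem _ _ _ hx), LinearEquiv.map_smulₛₗ,
    conj_conj]
  congr 1
  simp [mul_comm]

theorem map_weightSubgroup :
    H.weightSubgroup.map (H.mtConj : H.mumfordTate →* H.mumfordTate) = H.weightSubgroup := by
  have key : ∀ g ∈ H.weightSubgroup, H.mtConj g ∈ H.weightSubgroup := by
    intro g hg
    rw [weightSubgroup, Subgroup.mem_subgroupOf] at hg ⊢
    obtain ⟨a, ha⟩ := hg
    refine ⟨Units.map (starRingEnd ℂ : ℂ →* ℂ) a, ?_⟩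
    change _ = conjGL g.1
    rw [← ha]
    change _ = conjGL (H.h (a⁻¹, a⁻¹))
    rw [conjGL_h]
    simp only [map_inv]
    rfl
  apply le_antisymm
  · rintro _ ⟨g, hg, rfl⟩
    exact key g hg
  · intro g hg
    exact ⟨H.mtConj g, key g hg, H.mtConj.left_inv g⟩

theorem h_apply_mem_weightC (z : ℂˣ × ℂˣ) {m : ℤ} {x : Cx V} (hx : x ∈ H.weightC m) :
    (H.h z).1 x ∈ H.weightC m := by
  refine Submodule.iSup_induction _ hx (motive := fun x => (H.h z).1 x ∈ H.weightC m) ?_ ?_ ?_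
  · intro p x hx
    rw [H.h_apply z hx]
    exact Submodule.smul_mem _ _ (Submodule.mem_iSup_of_mem p hx)
  · simp
  · intro x y hx hy
    rw [map_add]
    exact add_mem hx hy

theorem weightHom_apply (a : ℂˣ) {m : ℤ} {x : Cx V} (hx : x ∈ H.weightC m) :
    (H.weightHom a).1 x = ((a ^ m : ℂˣ) : ℂ) • x := by
  refine Submodule.iSup_induction _ hx
    (motive := fun x => (H.weightHom a).1 x = ((a ^ m : ℂˣ) : ℂ) • x) ?_ ?_ ?_
  · intro p x hx
    change (H.h (a⁻¹, a⁻¹)).1 x = _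
    rw [H.h_apply _ hx]
    congr 2
    simp only [inv_zpow', neg_neg, ← zpow_add]
    congr 1
    ring
  · simp
  · intro x y hx hy
    rw [map_add, smul_add, hx, hy]

section Normal

variable [Module.Finite ℚ V]

/-- A vector of `V_ℂ` killed by all the linear forms vanishing on `W` is in `W_ℂ`. -/
theorem mem_baseChange_of_forms (W : Submodule ℚ V) {x : Cx V}
    (hx : ∀ f : Module.Dual ℚ V, (∀ w ∈ W, f w = 0) → formC f x = 0) :
    x ∈ W.baseChange ℂ := by
  classical
  obtain ⟨s, hs⟩ := LinearMap.exists_rightInverse_of_surjective W.mkQ W.range_mkQ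
  let b := Module.finBasis ℚ (V ⧸ W)
  let P : V →ₗ[ℚ] V := LinearMap.id - s ∘ₗ W.mkQ
  have hP : ∀ v, P v ∈ W := by
    intro v
    rw [← Submodule.Quotient.mk_eq_zero, ← Submodule.mkQ_apply]
    have := LinearMap.congr_fun hs (W.mkQ v)
    simp only [LinearMap.comp_apply, LinearMap.id_apply] at this
    simp only [P, LinearMap.sub_apply, LinearMap.comp_apply, LinearMap.id_apply, map_sub, this,
      sub_self]
  have hid : ∀ y : Cx V, y = P.baseChange ℂ y +
      ∑ i, formC (b.coord i ∘ₗ W.mkQ) y • ((1 : ℂ) ⊗ₜ[ℚ] s (b i)) := by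
    intro y
    induction y using TensorProduct.induction_on with
    | zero => simp
    | add x y hx hy =>
      simp only [map_add, add_smul, Finset.sum_add_distrib]
      nth_rewrite 1 [hx, hy]
      abel
    | tmul z v =>
      have h1 : v = P v + ∑ i, (b.coord i (W.mkQ v)) • s (b i) := by
        have : s (W.mkQ v) = ∑ i, (b.coord i (W.mkQ v)) • s (b i) := by
          conv_lhs => rw [← b.sum_repr (W.mkQ v), map_sum]
          simp only [map_smul, Module.Basis.coord_apply]
        rw [← this]
        simp [P]
      conv_lhs => rw [h1]
      rw [TensorProduct.tmul_add, TensorProduct.tmul_sum, LinearMap.baseChange_tmul]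
      congr 1
      apply Finset.sum_congr rfl
      intro i _
      rw [formC_tmul, TensorProduct.smul_tmul', TensorProduct.tmul_smul,
        TensorProduct.smul_tmul']
      congr 1
      rw [Rat.smul_def, smul_eq_mul, mul_one, mul_comm]
      rfl
  have h2 : x = P.baseChange ℂ x := by
    conv_lhs => rw [hid x]
    rw [Finset.sum_eq_zero, add_zero]
    intro i _
    rw [hx, zero_smul]
    intro w hw
    simp [(Submodule.Quotient.mk_eq_zero W).2 hw]
  rw [h2]
  clear hx h2 hid
  induction x using TensorProduct.induction_on with
  | zero => simp
  | tmul z v => exact Submodule.tmul_mem_baseChange_of_mem z (hP v)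
  | add x y hx hy => rw [map_add]; exact add_mem hx hy

/-- The stabilizer of `W_ℂ` in `GL(V_ℂ)`. -/
def stab (W : Submodule ℚ V) : Subgroup (GLC V) where
  carrier := {g | ∀ x ∈ W.baseChange ℂ, g.1 x ∈ W.baseChange ℂ}
  mul_mem' {a b} ha hb x hx := ha _ (hb _ hx)
  one_mem' x hx := hx
  inv_mem' {g} hg x hx := by
    have hle : (W.baseChange ℂ).map g.1 ≤ W.baseChange ℂ := by
      rintro _ ⟨y, hy, rfl⟩
      exact hg y hy
    have hinj : Function.Injective g.1 :=
      (LinearMap.GeneralLinearGroup.toLinearEquiv g).injective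
    have heq : (W.baseChange ℂ).map g.1 = W.baseChange ℂ :=
      Submodule.eq_of_le_of_finrank_eq hle
        (Submodule.equivMapOfInjective g.1 hinj _).finrank_eq.symm
    rw [← heq] at hx
    obtain ⟨y, hy, rfl⟩ := hx
    have : (g⁻¹).1 (g.1 y) = y := by
      rw [← Module.End.mul_apply, ← Units.val_mul, inv_mul_cancel]
      rfl
    rw [this]
    exact hy

theorem stab_isZariskiClosed (W : Submodule ℚ V) :
    IsZariskiClosed ℚ (stab W : Set (GLC V)) := by
  refine ⟨{F | ∃ (f : Module.Dual ℚ V) (v : V), (∀ w ∈ W, f w = 0) ∧ v ∈ W ∧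
    F = matrixCoeff f v}, ?_, ?_⟩
  · rintro _ ⟨f, v, -, -, rfl⟩
    exact Algebra.subset_adjoin ⟨f, v, rfl⟩
  · ext g
    constructor
    · rintro hg _ ⟨f, v, hf, hv, rfl⟩
      have hgv := hg _ (Submodule.tmul_mem_baseChange_of_mem (1 : ℂ) hv)
      have hk : W.baseChange ℂ ≤ LinearMap.ker (formC f) := by
        rw [Submodule.baseChange_eq_span, Submodule.span_le]
        rintro _ ⟨w, hw, rfl⟩
        simp [hf w hw]
      exact hk hgv
    · intro hg x hx
      have hk : W.baseChange ℂ ≤ (W.baseChange ℂ).comap g.1 := by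
        conv_lhs => rw [Submodule.baseChange_eq_span]
        rw [Submodule.span_le]
        rintro _ ⟨w, hw, rfl⟩
        exact mem_baseChange_of_forms W fun f hf => hg _ ⟨f, w, hf, hw, rfl⟩
      exact hk hx

theorem mumfordTate_apply_mem_weightC {g : GLC V} (hg : g ∈ H.mumfordTate) {m : ℤ} {x : Cx V}
    (hx : x ∈ H.weightC m) : g.1 x ∈ H.weightC m := by
  rw [mumfordTate, Subgroup.mem_sInf] at hg
  have := hg (stab (H.weight m)) ⟨stab_isZariskiClosed _, fun z x hx => by
    rw [baseChange_weight] at hx ⊢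
    exact H.h_apply_mem_weightC z hx⟩ x (by rwa [baseChange_weight])
  rwa [baseChange_weight] at this

theorem weightHom_comm {g : GLC V} (hg : g ∈ H.mumfordTate) (a : ℂˣ) :
    H.weightHom a * g = g * H.weightHom a := by
  apply Units.ext
  apply LinearMap.ext
  intro x
  refine H.induction_pieces (P := fun x => (H.weightHom a * g).1 x = (g * H.weightHom a).1 x)
    (by simp) (fun x y hx hy => by rw [map_add, map_add, hx, hy]) ?_ x
  intro p q x hx
  have hx' : x ∈ H.weightC (p + q) :=
    Submodule.mem_iSup_of_mem p (by rwa [add_sub_cancel_left])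
  rw [Units.val_mul, Units.val_mul, Module.End.mul_apply, Module.End.mul_apply,
    H.weightHom_apply a hx', H.weightHom_apply a (H.mumfordTate_apply_mem_weightC hg hx'),
    map_smul]

instance weightSubgroup_normal : H.weightSubgroup.Normal where
  conj_mem n hn g := by
    rw [weightSubgroup, Subgroup.mem_subgroupOf] at hn ⊢
    obtain ⟨a, ha⟩ := hn
    refine ⟨a, ?_⟩
    have := H.weightHom_comm g.2 a
    simp only [Subgroup.coe_mul, Subgroup.coe_inv, ← ha, ← this, mul_inv_cancel_right]

/-- The group of complex points of `G / w_h(𝔾_m)`, where `G` is the Mumford–Tate group; since `ℂ`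
is algebraically closed it is `G(ℂ) / w_h(ℂˣ)`, and its classical topology is the quotient
topology. -/
abbrev MTModWeight : Type _ := H.mumfordTate ⧸ H.weightSubgroup

/-- Complex conjugation on the complex points of `G / w_h(𝔾_m)`. -/
def quotConj : H.MTModWeight ≃* H.MTModWeight :=
  QuotientGroup.congr H.weightSubgroup H.weightSubgroup H.mtConj H.map_weightSubgroup

/-- The condition (SV2*) for the Mumford–Tate group `(G, h)`: `inn(h(i))` is a Cartan involution
of `G / w_h(𝔾_m)`. -/
def SV2Star : Prop :=
  InnIsCartanInvolution H.quotConj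
    (QuotientGroup.mk (⟨H.weilOperator, H.h_mem_mumfordTate _⟩ : H.mumfordTate) : H.MTModWeight)

end Normal

/-! ### The pure constituents of a Hodge structure -/

/-- The inclusion of `(V_m)_ℂ` into `V_ℂ`. -/
def weightIncl (m : ℤ) : Cx (H.weight m) →ₗ[ℂ] Cx V := (H.weight m).subtype.baseChange ℂ

theorem weightIncl_injective (m : ℤ) : Function.Injective (H.weightIncl m) :=
  Module.Flat.lTensor_preserves_injective_linearMap (M := ℂ) (H.weight m).subtype
    (H.weight m).injective_subtype

theorem range_weightIncl (m : ℤ) : LinearMap.range (H.weightIncl m) = H.weightC m := by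
  rw [← baseChange_weight]
  apply le_antisymm
  · rintro _ ⟨x, rfl⟩
    induction x using TensorProduct.induction_on with
    | zero => simp
    | tmul z v => exact Submodule.tmul_mem_baseChange_of_mem z v.2
    | add x y hx hy => rw [map_add]; exact add_mem hx hy
  · rw [Submodule.baseChange_eq_span, Submodule.span_le]
    rintro _ ⟨v, hv, rfl⟩
    exact ⟨1 ⊗ₜ[ℚ] ⟨v, hv⟩, rfl⟩

theorem weightIncl_conj (m : ℤ) (x : Cx (H.weight m)) :
    H.weightIncl m (conj x) = conj (H.weightIncl m x) := by
  induction x using TensorProduct.induction_on with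
  | zero => simp
  | tmul z v => rfl
  | add x y hx hy => simp only [map_add, hx, hy]

theorem iSup_comap_weightIncl (m : ℤ) :
    ⨆ p : ℤ, (H.piece (p, m - p)).comap (H.weightIncl m) = ⊤ := by
  rw [eq_top_iff]
  rintro x -
  have h1 : H.weightC m ≤ Submodule.map (H.weightIncl m)
      (⨆ p : ℤ, (H.piece (p, m - p)).comap (H.weightIncl m)) := by
    refine iSup_le fun p y hy => ?_
    have hy' : y ∈ LinearMap.range (H.weightIncl m) := by
      rw [range_weightIncl]
      exact Submodule.mem_iSup_of_mem p hy
    obtain ⟨x', rfl⟩ := hy'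
    exact ⟨x', Submodule.mem_iSup_of_mem p hy, rfl⟩
  have h2 : H.weightIncl m x ∈ H.weightC m := by
    rw [← range_weightIncl]
    exact ⟨x, rfl⟩
  obtain ⟨x', hx', he⟩ := h1 h2
  rwa [← H.weightIncl_injective m he]

theorem comap_weightIncl_eq_bot {m p q : ℤ} (hpq : p + q ≠ m) :
    (H.piece (p, q)).comap (H.weightIncl m) = ⊥ := by
  rw [eq_bot_iff]
  intro x hx
  have hd := H.isInternal.submodule_iSupIndep (p, q)
  have hle : H.weightC m ≤ ⨆ (j : ℤ × ℤ) (_ : j ≠ (p, q)), H.piece j := by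
    refine iSup_le fun p' => ?_
    refine le_iSup₂_of_le (p', m - p') ?_ le_rfl
    rintro h
    rw [Prod.mk.injEq] at h
    omega
  have h2 : H.weightIncl m x ∈ H.weightC m := by
    rw [← range_weightIncl]
    exact ⟨x, rfl⟩
  have h0 : H.weightIncl m x = 0 := (Submodule.disjoint_def.1 hd) _ hx (hle h2)
  exact H.weightIncl_injective m (h0.trans (map_zero _).symm)

/-- The Hodge structure of weight `m` on the part `V_m` of `V` of weight `m`; its component of
type `(p, q)` is `V^{p,q} ∩ (V_m)_ℂ`. -/
def weightPart (m : ℤ) : RationalHodgeStructure (H.weight m) where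
  piece pq := (H.piece pq).comap (H.weightIncl m)
  isInternal := by
    apply DirectSum.isInternal_submodule_of_iSupIndep_of_iSup_eq_top
    · intro pq
      rw [Submodule.disjoint_def]
      intro x hx hx'
      have hd := H.isInternal.submodule_iSupIndep pq
      have hle : (⨆ (j) (_ : j ≠ pq), (H.piece j).comap (H.weightIncl m)) ≤
          (⨆ (j) (_ : j ≠ pq), H.piece j).comap (H.weightIncl m) :=
        iSup₂_le fun j hj => Submodule.comap_mono (le_iSup₂_of_le j hj le_rfl)
      have h0 : H.weightIncl m x = 0 := (Submodule.disjoint_def.1 hd) _ hx (hle hx')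
      exact H.weightIncl_injective m (h0.trans (map_zero _).symm)
    · rw [eq_top_iff, ← H.iSup_comap_weightIncl m]
      exact iSup_le fun p =>
        le_iSup (fun pq => (H.piece pq).comap (H.weightIncl m)) (p, m - p)
  conj_mem p q x hx := by
    rw [Submodule.mem_comap, weightIncl_conj]
    exact H.conj_mem p q _ hx
  weight_rational m' := by
    by_cases h : m' = m
    · subst h
      exact ⟨⊤, by rw [H.iSup_comap_weightIncl, Submodule.baseChange_top]⟩
    · refine ⟨⊥, ?_⟩
      rw [Submodule.baseChange_bot, eq_comm, iSup_eq_bot]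
      intro p
      exact H.comap_weightIncl_eq_bot (by omega)

/-! ### Polarizations -/

/-- The underlying rational vector space `(2πi)^m ℚ ⊆ ℂ` of the Tate Hodge structure `ℚ(m)`; the
group `𝕊` acts on it through `h(z₁, z₂) = (z₁ z₂)^m`. -/
def tate (m : ℤ) : Submodule ℚ ℂ :=
  Submodule.span ℚ {(2 * (Real.pi : ℂ) * Complex.I) ^ m}

/-- The bilinear extension `ψ_ℂ : V_ℂ × V_ℂ → ℚ(m)_ℂ = ℂ` of a pairing `V × V → ℚ(m)`. -/
def pairingC {m : ℤ} (ψ : V →ₗ[ℚ] V →ₗ[ℚ] tate m) : Cx V →ₗ[ℂ] Cx V →ₗ[ℂ] ℂ :=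
  bilinC (ψ.compr₂ (tate m).subtype)

open scoped ComplexOrder in
/-- A polarization of a rational Hodge structure of weight `m`: a morphism of Hodge structures
`ψ : V ⊗ V → ℚ(-m)` such that `(x, y) ↦ (2πi)^m ψ(x, C y)` is a real-valued, symmetric and
positive definite form on `V_ℝ = {x ∈ V_ℂ | conj x = x}`. For complex numbers, `0 < z` means that
`z` is real and positive. -/
structure IsPolarization (m : ℤ) (ψ : V →ₗ[ℚ] V →ₗ[ℚ] tate (-m)) : Prop where
  pure : H.weight m = ⊤
  morphism : ∀ (z : ℂˣ × ℂˣ) (x y : Cx V), pairingC ψ ((H.h z).1 x) ((H.h z).1 y) =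
    (((z.1 * z.2) ^ (-m) : ℂˣ) : ℂ) * pairingC ψ x y
  symm : ∀ x y : Cx V, conj x = x → conj y = y →
    (2 * (Real.pi : ℂ) * Complex.I) ^ m * pairingC ψ x (H.weilOperator.1 y) =
      (2 * (Real.pi : ℂ) * Complex.I) ^ m * pairingC ψ y (H.weilOperator.1 x)
  pos : ∀ x : Cx V, conj x = x → x ≠ 0 →
    0 < (2 * (Real.pi : ℂ) * Complex.I) ^ m * pairingC ψ x (H.weilOperator.1 x)

/-- A rational Hodge structure is polarizable if its part of weight `m` has a polarization, for
every `m`. -/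
def IsPolarizable : Prop :=
  ∀ m : ℤ, ∃ ψ : H.weight m →ₗ[ℚ] H.weight m →ₗ[ℚ] tate (-m), (H.weightPart m).IsPolarization m ψ

end RationalHodgeStructure
end HodgeMT
end

open scoped TensorProduct

noncomputable section

namespace HodgeMT

/-! ### Automorphisms of `ℂ` and their fixed field. -/

section FixedField

/-! Write `C = h(i)` and let `τ(g) = C ḡ C⁻¹` be the twisted conjugation (`twist`). For a form `b`
on `V_m`, passing `g` through `y ↦ C ȳ` turns it into `τ(g)`. So the elements fixed by `τ` are those
that should be unitary for `b(x, C ȳ)`, and compactness of the group they form corresponds to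
definiteness of that hermitian form.

From (SV2*) to a polarization: elements of `G` fixed by `τ` and of determinant one on each `V_m`
form a compact group (`isCompact_compactForm`): compactness modulo weights controls them up to a
scalar on each `V_m`, and the determinant fixes that scalar. Haar averaging
(`exists_posDef_invariant`) gives an invariant positive hermitian form. For every automorphism `γ`
of `ℂ`, let `X_γ` be multiplication by `q - p` on `γ V^{p,q}`. The compact group contains the
exponentials of `aX_γ + τ(aX_γ)` (`exp_mem_compactForm`), which forces `X_γ` to be skew for a
suitable bilinear form `B` (`exists_invariant_form`). Hence `B` pairs `γ V^{p,q}` only with `γ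
V^{q,p}`, and `B(x, Cx) > 0` on real vectors. The pairing conditions are linear and stable under all
`γ`, so Galois descent (`mem_span_inter_of_stable`) writes `B` as a complex combination of rational
forms that satisfy them; a nearby rational combination stays positive (`exists_rational_form`), and
symmetrizing it gives polarizations.

From a polarization to (SV2*): similitudes of a rational form are an algebraic group over `ℚ`
containing `h(𝕊)`, so `G` scales the form on `V_m` by a rational character. Rational characters are
determined by their values on `h(𝕊)` (`character_eq`), so the multipliers of `g` have absolute
values `exp(mℓ)` with a common `ℓ`. An element fixed by `τ` modulo weights therefore becomes unitary
after multiplication by some `w_h(t)` with `t > 0` (`exists_unitary`). The fixed set in the quotient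
is then an image of a compact set.

Reductivity: `G` is connected because it is generated by the conjugates of a connected torus. For a
polarizable structure the hermitian form supplies `G`-stable orthogonal complements
(`apply_mem_orthCompl`); with Kolchin's theorem, a normal unipotent subgroup fixes every vector. -/

open Cardinal in
/-- An isomorphism of embedded countable subrings extends to uncountable algebraically closed
fields of the same cardinality. -/
theorem exists_ringEquiv_algebraMap {R K L : Type} [CommRing R] [Field K] [Field L] [Algebra R K]
    [Algebra R L] [FaithfulSMul R K] [FaithfulSMul R L] [IsAlgClosed K] [IsAlgClosed L]
    (hR : #R ≤ ℵ₀) (hK : ℵ₀ < #K) (hKL : #K = #L) :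
    ∃ γ : K ≃+* L, ∀ r, γ (algebraMap R K r) = algebraMap R L r := by
  have : Nontrivial R := (algebraMap R K).domain_nontrivial
  obtain ⟨s, hs⟩ := exists_isTranscendenceBasis R K
  obtain ⟨t, ht⟩ := exists_isTranscendenceBasis R L
  -- Since `R` is countable and the fields are uncountable, a transcendence basis is as large as its
  -- field.
  have hst : #s = #t := by
    rw [← IsAlgClosed.cardinal_eq_cardinal_transcendence_basis_of_aleph0_lt' _ hs hR hK,
      ← IsAlgClosed.cardinal_eq_cardinal_transcendence_basis_of_aleph0_lt' _ ht hR (hKL ▸ hK), hKL]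
  obtain ⟨e⟩ := Cardinal.eq.1 hst
  let _ := IsAlgClosed.isAlgClosure_of_transcendence_basis _ hs
  let _ := IsAlgClosed.isAlgClosure_of_transcendence_basis _ ht
  let f : Algebra.adjoin R (Set.range ((↑) : s → K)) ≃ₐ[R]
      Algebra.adjoin R (Set.range ((↑) : t → L)) :=
    (hs.1.aevalEquiv.symm.trans (MvPolynomial.renameEquiv R e)).trans ht.1.aevalEquiv
  refine ⟨IsAlgClosure.equivOfEquiv K L f.toRingEquiv, fun r => ?_⟩
  have := IsAlgClosure.equivOfEquiv_algebraMap K L f.toRingEquiv (algebraMap R _ r)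
  rw [← IsScalarTower.algebraMap_apply] at this
  rw [this]
  have h2 : f.toRingEquiv (algebraMap R _ r) = algebraMap R _ r := f.commutes r
  rw [h2]
  rfl

-- Each embedding makes `ℂ` an algebra over `R`, so this is the previous extension result for two
-- structures on one field. It is used to move a number `x`: with `R = ℚ[X]` if `x` is
-- transcendental, with `R = ℚ[X]/(minpoly)` if it is algebraic.
open Cardinal in
theorem exists_automorphism_of_algebraMap {R : Type} [CommRing R] (hR : #R ≤ ℵ₀) (f g : R →+* ℂ)
    (hf : Function.Injective f) (hg : Function.Injective g) :
    ∃ γ : ℂ ≃+* ℂ, ∀ r, γ (f r) = g r := by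
  have hC : ℵ₀ < #ℂ := by rw [Cardinal.mk_complex]; exact Cardinal.aleph0_lt_continuum
  have faithful : ∀ f : R →+* ℂ, Function.Injective f → @FaithfulSMul R ℂ f.toAlgebra.toSMul := by
    intro f hf
    let _ := f.toAlgebra
    exact (faithfulSMul_iff_algebraMap_injective R ℂ).2 hf
  exact @exists_ringEquiv_algebraMap R ℂ ℂ _ _ _ f.toAlgebra g.toAlgebra (faithful f hf)
    (faithful g hg) _ _ hR hC rfl

/-- The fixed field of the automorphism group of `ℂ` is `ℚ`. -/
theorem exists_rat_of_forall_automorphism (x : ℂ) (hx : ∀ γ : ℂ ≃+* ℂ, γ x = x) :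
    ∃ q : ℚ, (q : ℂ) = x := by
  by_cases hx' : IsAlgebraic ℚ x
  · by_contra hq
    have hint : IsIntegral ℚ x := hx'.isIntegral
    have hdeg : 1 < (minpoly ℚ x).natDegree := by
      change 2 ≤ _
      rw [minpoly.two_le_natDegree_iff hint]
      rintro ⟨q, hq'⟩
      exact hq ⟨q, hq'⟩
    -- Separability gives as many roots as the degree, which is at least two, so `x` has a conjugate
    -- `y ≠ x` to be sent to.
    have hsep : ((minpoly ℚ x).rootSet ℂ).Nontrivial := by
      have hc : Fintype.card ((minpoly ℚ x).rootSet ℂ) = (minpoly ℚ x).natDegree :=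
        Polynomial.card_rootSet_eq_natDegree (minpoly.irreducible hint).separable
          (IsAlgClosed.splits _)
      rw [← hc, Fintype.one_lt_card_iff_nontrivial] at hdeg
      exact Set.nontrivial_coe_sort.1 hdeg
    obtain ⟨y, hy, hyx⟩ := hsep.exists_ne x
    have hy' : Polynomial.eval₂ (algebraMap ℚ ℂ) y (minpoly ℚ x) = 0 := by
      have := (Polynomial.mem_rootSet.1 hy).2
      rwa [Polynomial.aeval_def] at this
    have hxr : Polynomial.eval₂ (algebraMap ℚ ℂ) x (minpoly ℚ x) = 0 := by
      have := minpoly.aeval ℚ x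
      rwa [Polynomial.aeval_def] at this
    have := Fact.mk (minpoly.irreducible hint)
    have hcount : Cardinal.mk (AdjoinRoot (minpoly ℚ x)) ≤ Cardinal.aleph0 := by
      have : Countable (Polynomial ℚ) := by
        rw [← Cardinal.mk_le_aleph0_iff]
        exact Polynomial.cardinalMk_le_max.trans (by simp)
      have : Countable (AdjoinRoot (minpoly ℚ x)) :=
        (AdjoinRoot.mk_surjective (g := minpoly ℚ x)).countable
      exact Cardinal.mk_le_aleph0
    obtain ⟨γ, hγ⟩ := exists_automorphism_of_algebraMap hcount
      (AdjoinRoot.lift (algebraMap ℚ ℂ) x hxr) (AdjoinRoot.lift (algebraMap ℚ ℂ) y hy')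
      (RingHom.injective _) (RingHom.injective _)
    have h1 := hγ (AdjoinRoot.root _)
    rw [AdjoinRoot.lift_root, AdjoinRoot.lift_root, hx] at h1
    exact hyx h1.symm
  · exfalso
    have ht : Transcendental ℚ x := hx'
    -- A transcendental `x` can be moved to `x + 1`, which it would have to equal.
    have ht' : Transcendental ℚ (x + 1) := by
      intro h
      apply ht
      have := h.sub (isAlgebraic_one (R := ℚ) (A := ℂ))
      rwa [add_sub_cancel_right] at this
    have hcount : Cardinal.mk (Polynomial ℚ) ≤ Cardinal.aleph0 :=
      Polynomial.cardinalMk_le_max.trans (by simp)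
    obtain ⟨γ, hγ⟩ := exists_automorphism_of_algebraMap hcount
      (Polynomial.aeval (R := ℚ) x).toRingHom (Polynomial.aeval (R := ℚ) (x + 1)).toRingHom
      (transcendental_iff_injective.1 ht) (transcendental_iff_injective.1 ht')
    have h1 := hγ Polynomial.X
    simp [hx] at h1

end FixedField

/-! ### Galois descent for subspaces. -/

section Descent

/-- Galois descent for subspaces: a `ℂ`-subspace stable under a semilinear action of the
automorphisms of `ℂ` that fixes `M₀` contains every element of the span of `M₀` only through
elements of `M₀`. -/
theorem mem_span_inter_of_stable {M : Type*} [AddCommGroup M] [Module ℂ M] [Module ℚ M]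
    (M₀ : Submodule ℚ M) (W : Submodule ℂ M) (ρ : (ℂ ≃+* ℂ) → M →+ M)
    (hρ : ∀ γ c, ∀ m ∈ M₀, ρ γ (c • m) = γ c • m) (hW : ∀ γ, ∀ x ∈ W, ρ γ x ∈ W)
    {x : M} (hx : x ∈ W) (hx₀ : x ∈ Submodule.span ℂ (M₀ : Set M)) :
    x ∈ Submodule.span ℂ ((M₀ : Set M) ∩ W) := by
  classical
  -- Induction on the number of terms; the elements of `s` need not be linearly independent.
  have key : ∀ (s : Finset M) (c : M → ℂ), (∀ m ∈ s, m ∈ M₀) → ∑ m ∈ s, c m • m ∈ W →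
      ∑ m ∈ s, c m • m ∈ Submodule.span ℂ ((M₀ : Set M) ∩ W) := by
    intro s
    induction s using Finset.strongInduction with
    | H s ih =>
    intro c hs hc
    rcases s.eq_empty_or_nonempty with rfl | ⟨m₀, hm₀⟩
    · simp
    have herase : ∀ (d : M → ℂ) (m : M), m ∈ s → d m = 0 → ∑ m ∈ s, d m • m ∈ W →
        ∑ m ∈ s, d m • m ∈ Submodule.span ℂ ((M₀ : Set M) ∩ W) := by
      intro d m hm hd hdW
      have he : ∑ m ∈ s, d m • m = ∑ m ∈ s.erase m, d m • m := by
        rw [← Finset.add_sum_erase s _ hm, hd, zero_smul, zero_add]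
      rw [he] at hdW ⊢
      exact ih _ (Finset.erase_ssubset hm) d (fun k hk => hs k (Finset.mem_of_mem_erase hk)) hdW
    by_cases hz : c m₀ = 0
    · exact herase c m₀ hm₀ hz hc
    suffices h : ∀ c : M → ℂ, c m₀ = 1 → ∑ m ∈ s, c m • m ∈ W →
        ∑ m ∈ s, c m • m ∈ Submodule.span ℂ ((M₀ : Set M) ∩ W) by
      have h1 : ∑ m ∈ s, ((c m₀)⁻¹ * c m) • m = (c m₀)⁻¹ • ∑ m ∈ s, c m • m := by
        rw [Finset.smul_sum]
        simp only [smul_smul]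
      have h2 := h (fun m => (c m₀)⁻¹ * c m) (inv_mul_cancel₀ hz)
        (by rw [h1]; exact W.smul_mem _ hc)
      rw [h1] at h2
      have := Submodule.smul_mem _ (c m₀) h2
      rwa [smul_smul, mul_inv_cancel₀ hz, one_smul] at this
    clear c hc hz
    intro c hc1 hc
    by_cases hrat : ∀ m ∈ s, ∃ q : ℚ, (q : ℂ) = c m
    · choose! q hq using hrat
      apply Submodule.subset_span
      refine ⟨?_, hc⟩
      refine Submodule.sum_mem _ fun m hm => ?_
      rw [← hq m hm, Rat.cast_smul_eq_qsmul]
      exact M₀.smul_mem _ (hs m hm)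
    · push Not at hrat
      obtain ⟨j, hj, hjq⟩ := hrat
      have : ∃ γ : ℂ ≃+* ℂ, γ (c j) ≠ c j := by
        by_contra hcon
        push Not at hcon
        obtain ⟨q, hq⟩ := exists_rat_of_forall_automorphism _ hcon
        exact hjq q hq
      obtain ⟨γ, hγ⟩ := this
      have hρx : ρ γ (∑ m ∈ s, c m • m) = ∑ m ∈ s, γ (c m) • m := by
        rw [map_sum]
        exact Finset.sum_congr rfl fun m hm => hρ γ _ m (hs m hm)
      -- With the coefficient of `m₀` equal to one, the difference `ρ γ x - x` lies in `W` and loses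
      -- its term at `m₀`.
      have hd : ∑ m ∈ s, (γ (c m) - c m) • m = ρ γ (∑ m ∈ s, c m • m) - ∑ m ∈ s, c m • m := by
        rw [hρx, ← Finset.sum_sub_distrib]
        simp only [sub_smul]
      have hdW : ∑ m ∈ s, (γ (c m) - c m) • m ∈ W := by
        rw [hd]
        exact W.sub_mem (hW γ _ hc) hc
      have hd0 := herase (fun m => γ (c m) - c m) m₀ hm₀ (by simp [hc1]) hdW
      -- With this multiple, `x - a (ρ γ x - x)` loses its term at `j`. So `x` is a combination of
      -- two shorter elements of `W`.
      set a := c j / (γ (c j) - c j) with ha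
      have hsub : γ (c j) - c j ≠ 0 := sub_ne_zero.2 hγ
      have heq : ∑ m ∈ s, (c m - a * (γ (c m) - c m)) • m =
          ∑ m ∈ s, c m • m - a • ∑ m ∈ s, (γ (c m) - c m) • m := by
        rw [Finset.smul_sum, ← Finset.sum_sub_distrib]
        simp only [sub_smul (_ : ℂ) (_ * _), mul_smul]
      have h3 := herase (fun m => c m - a * (γ (c m) - c m)) j hj
        (by simp only [ha]; field_simp; ring)
        (by rw [heq]; exact W.sub_mem hc (W.smul_mem _ hdW))
      rw [heq] at h3
      have := Submodule.add_mem _ h3 (Submodule.smul_mem _ a hd0)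
      rwa [sub_add_cancel] at this
  obtain ⟨c, hc, rfl⟩ := Submodule.mem_span_set.1 hx₀
  exact key c.support c (fun m hm => hc hm) hx

end Descent

end HodgeMT

namespace HodgeMT

/-! ### The action of the automorphisms of `ℂ` on `V_ℂ`, on `GL(V_ℂ)` and on closed sets. -/

section Galois

variable {V : Type*} [AddCommGroup V] [Module ℚ V]

/-- The action `z ⊗ v ↦ γ z ⊗ v` of an automorphism `γ` of `ℂ` on `V_ℂ`. -/
def gam (γ : ℂ ≃+* ℂ) : Cx V →ₗ[ℚ] Cx V :=
  LinearMap.rTensor V (γ.toRingHom.toAddMonoidHom.toRatLinearMap)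

@[simp] theorem gam_tmul (γ : ℂ ≃+* ℂ) (z : ℂ) (v : V) :
    gam γ (z ⊗ₜ[ℚ] v) = γ z ⊗ₜ[ℚ] v := rfl

theorem gam_smul (γ : ℂ ≃+* ℂ) (a : ℂ) (x : Cx V) : gam γ (a • x) = γ a • gam γ x := by
  induction x using TensorProduct.induction_on with
  | zero => simp
  | tmul z v => simp [TensorProduct.smul_tmul']
  | add x y hx hy => rw [smul_add, map_add, map_add, hx, hy, smul_add]

@[simp] theorem gam_gam_symm (γ : ℂ ≃+* ℂ) (x : Cx V) : gam γ (gam γ.symm x) = x := by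
  induction x using TensorProduct.induction_on with
  | zero => simp
  | tmul z v => simp
  | add x y hx hy => rw [map_add, map_add, hx, hy]

@[simp] theorem gam_symm_gam (γ : ℂ ≃+* ℂ) (x : Cx V) : gam γ.symm (gam γ x) = x :=
  gam_gam_symm γ.symm x

@[simp] theorem gam_refl (x : Cx V) : gam (RingEquiv.refl ℂ) x = x := by
  induction x using TensorProduct.induction_on with
  | zero => simp
  | tmul z v => simp
  | add x y hx hy => rw [map_add, hx, hy]

/-- Complex conjugation as a ring automorphism. -/
abbrev conjRing : ℂ ≃+* ℂ := Complex.conjAe.toRingEquiv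

@[simp] theorem conjRing_symm : conjRing.symm = conjRing := rfl

theorem conj_eq_gam (x : Cx V) : conj x = gam conjRing x := by
  induction x using TensorProduct.induction_on with
  | zero => simp
  | tmul z v => rfl
  | add x y hx hy => rw [map_add, map_add, hx, hy]

theorem formC_gam (γ : ℂ ≃+* ℂ) (f : Module.Dual ℚ V) (x : Cx V) :
    formC f (gam γ x) = γ (formC f x) := by
  induction x using TensorProduct.induction_on with
  | zero => simp
  | tmul z v => simp
  | add x y hx hy => rw [map_add, map_add, hx, hy, map_add, map_add]

/-- The action of an automorphism of `ℂ` on `End(V_ℂ)`. -/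
def gamEnd (γ : ℂ ≃+* ℂ) : Module.End ℂ (Cx V) →+* Module.End ℂ (Cx V) where
  toFun g :=
    { toFun := fun x => gam γ (g (gam γ.symm x))
      map_add' := fun x y => by simp only [map_add]
      map_smul' := fun a x => by simp [gam_smul] }
  map_one' := by apply LinearMap.ext; intro x; simp
  map_mul' a b := by apply LinearMap.ext; intro x; simp
  map_zero' := by apply LinearMap.ext; intro x; simp
  map_add' a b := by apply LinearMap.ext; intro x; simp

theorem gamEnd_apply (γ : ℂ ≃+* ℂ) (g : Module.End ℂ (Cx V)) (x : Cx V) :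
    gamEnd γ g x = gam γ (g (gam γ.symm x)) := rfl

theorem gamEnd_smul (γ : ℂ ≃+* ℂ) (a : ℂ) (g : Module.End ℂ (Cx V)) :
    gamEnd γ (a • g) = γ a • gamEnd γ g := by
  apply LinearMap.ext
  intro x
  simp [gamEnd_apply, gam_smul]

/-- The action of an automorphism of `ℂ` on `GL(V_ℂ)`. -/
def gamGL (γ : ℂ ≃+* ℂ) : GLC V →* GLC V := Units.map (gamEnd γ).toMonoidHom

theorem gamGL_val (γ : ℂ ≃+* ℂ) (g : GLC V) : (gamGL γ g).1 = gamEnd γ g.1 := rfl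

theorem gamGL_apply (γ : ℂ ≃+* ℂ) (g : GLC V) (x : Cx V) :
    (gamGL γ g).1 x = gam γ (g.1 (gam γ.symm x)) := rfl

@[simp] theorem gamGL_gamGL_symm (γ : ℂ ≃+* ℂ) (g : GLC V) : gamGL γ (gamGL γ.symm g) = g := by
  apply Units.ext
  apply LinearMap.ext
  intro x
  simp [gamGL_apply]

theorem conjGL_eq_gamGL (g : GLC V) : conjGL g = gamGL conjRing g := by
  apply Units.ext
  apply LinearMap.ext
  intro x
  rw [conjGL_apply, gamGL_apply, conj_eq_gam, conj_eq_gam, conjRing_symm]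

theorem matrixCoeff_gamGL (γ : ℂ ≃+* ℂ) (f : Module.Dual ℚ V) (v : V) (g : GLC V) :
    matrixCoeff f v (gamGL γ g) = γ (matrixCoeff f v g) := by
  simp [matrixCoeff, gamGL_apply, formC_gam]

/-- Matrix coefficients are taken at rational vectors and rational forms, which `γ` fixes; rational
coefficients are fixed too. Hence closed sets over `ℚ` are stable under every `γ`. -/
theorem polyFunctions_gamGL (γ : ℂ ≃+* ℂ) {F : GLC V → ℂ} (hF : F ∈ polyFunctions V ℚ)
    (g : GLC V) : F (gamGL γ g) = γ (F g) := by
  induction hF using Algebra.adjoin_induction with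
  | mem F hF =>
    obtain ⟨f, v, rfl⟩ := hF
    exact matrixCoeff_gamGL γ f v g
  | algebraMap r => simp [Pi.algebraMap_apply]
  | add x y _ _ hx hy => simp [hx, hy]
  | mul x y _ _ hx hy => simp [hx, hy]

/-! ### Zariski closed sets -/

theorem polyFunctions_rat_le {F : GLC V → ℂ} (hF : F ∈ polyFunctions V ℚ) :
    F ∈ polyFunctions V ℂ := by
  induction hF using Algebra.adjoin_induction with
  | mem F hF => exact Algebra.subset_adjoin hF
  | algebraMap r =>
    have : algebraMap ℚ (GLC V → ℂ) r = algebraMap ℂ (GLC V → ℂ) (r : ℂ) := by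
      ext; simp
    rw [this]
    exact Subalgebra.algebraMap_mem _ _
  | add x y _ _ hx hy => exact add_mem hx hy
  | mul x y _ _ hx hy => exact mul_mem hx hy

/-- This puts complex polynomials in the span of a `ℚ`-structure, as the descent lemma requires. -/
theorem polyFunctions_complex_mem_span {F : GLC V → ℂ} (hF : F ∈ polyFunctions V ℂ) :
    F ∈ Submodule.span ℂ (polyFunctions V ℚ : Set (GLC V → ℂ)) := by
  induction hF using Algebra.adjoin_induction with
  | mem F hF => exact Submodule.subset_span (Algebra.subset_adjoin hF)
  | algebraMap r =>
    rw [Algebra.algebraMap_eq_smul_one]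
    exact Submodule.smul_mem _ _ (Submodule.subset_span (one_mem (polyFunctions V ℚ)))
  | add x y _ _ hx hy => exact add_mem hx hy
  | mul x y _ _ hx hy =>
    have := Submodule.mul_mem_mul hx hy
    rw [Submodule.span_mul_span] at this
    refine Submodule.span_mono ?_ this
    rintro _ ⟨a, ha, b, hb, rfl⟩
    exact mul_mem (s := polyFunctions V ℚ) ha hb

theorem IsZariskiClosed.complex {Z : Set (GLC V)} (hZ : IsZariskiClosed ℚ Z) :
    IsZariskiClosed ℂ Z := by
  obtain ⟨S, hS, rfl⟩ := hZ
  exact ⟨S, fun F hF => polyFunctions_rat_le (hS hF), rfl⟩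

theorem IsZariskiClosed.gamGL_mem {Z : Set (GLC V)} (hZ : IsZariskiClosed ℚ Z) (γ : ℂ ≃+* ℂ)
    {g : GLC V} (hg : g ∈ Z) : gamGL γ g ∈ Z := by
  obtain ⟨S, hS, rfl⟩ := hZ
  intro F hF
  rw [polyFunctions_gamGL γ (hS hF), hg F hF, map_zero]

theorem IsZariskiClosed.iInter {k : Type*} [Field k] [Algebra k ℂ] {ι : Sort*}
    {Z : ι → Set (GLC V)} (hZ : ∀ i, IsZariskiClosed k (Z i)) : IsZariskiClosed k (⋂ i, Z i) := by
  choose S hS hZS using hZ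
  refine ⟨⋃ i, S i, Set.iUnion_subset hS, ?_⟩
  ext g
  simp only [hZS, Set.mem_iInter, Set.mem_ofPred_eq, Set.mem_iUnion]
  exact ⟨fun h F ⟨i, hi⟩ => h i F hi, fun h i F hF => h F ⟨i, hF⟩⟩

theorem IsZariskiClosed.inter {k : Type*} [Field k] [Algebra k ℂ]
    {Z Z' : Set (GLC V)} (hZ : IsZariskiClosed k Z) (hZ' : IsZariskiClosed k Z') :
    IsZariskiClosed k (Z ∩ Z') := by
  rw [Set.inter_eq_iInter]
  exact IsZariskiClosed.iInter fun b => by cases b <;> assumption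

theorem isZariskiClosed_eq {k : Type*} [Field k] [Algebra k ℂ] {F F' : GLC V → ℂ}
    (hF : F ∈ polyFunctions V k) (hF' : F' ∈ polyFunctions V k) :
    IsZariskiClosed k {g | F g = F' g} := by
  refine ⟨{F - F'}, Set.singleton_subset_iff.2 (sub_mem hF hF'), ?_⟩
  ext g
  simp [sub_eq_zero]

theorem IsZariskiClosed.sInf {k : Type*} [Field k] [Algebra k ℂ] {T : Set (Subgroup (GLC V))}
    (hT : ∀ G ∈ T, IsZariskiClosed k (G : Set (GLC V))) :
    IsZariskiClosed k ((sInf T : Subgroup (GLC V)) : Set (GLC V)) := by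
  rw [Subgroup.coe_sInf]
  exact IsZariskiClosed.iInter fun G => IsZariskiClosed.iInter fun hG => hT G hG

/-- A Zariski closed set stable under the automorphisms of `ℂ` is defined over `ℚ`. -/
theorem IsZariskiClosed.rat_of_stable {Z : Set (GLC V)} (hZ : IsZariskiClosed ℂ Z)
    (hs : ∀ γ : ℂ ≃+* ℂ, ∀ g ∈ Z, gamGL γ g ∈ Z) : IsZariskiClosed ℚ Z := by
  obtain ⟨S, hS, hZS⟩ := hZ
  -- The functions vanishing on `Z` form a subspace stable under `F ↦ γ ∘ F ∘ γ⁻¹`; by descent the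
  -- rational polynomials in it span all the polynomials in it, so they already cut out `Z`.
  let W : Submodule ℂ (GLC V → ℂ) :=
    { carrier := {F | ∀ g ∈ Z, F g = 0}
      add_mem' := fun {a b} ha hb g hg => by simp [ha g hg, hb g hg]
      zero_mem' := fun g hg => rfl
      smul_mem' := fun c a ha g hg => by simp [ha g hg] }
  let ρ : (ℂ ≃+* ℂ) → (GLC V → ℂ) →+ (GLC V → ℂ) := fun γ =>
    { toFun := fun F g => γ (F (gamGL γ.symm g))
      map_zero' := by ext; simp
      map_add' := fun a b => by ext; simp }
  refine ⟨(polyFunctions V ℚ : Set (GLC V → ℂ)) ∩ W, Set.inter_subset_left, ?_⟩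
  apply Set.Subset.antisymm
  · rintro g hg F ⟨-, hF⟩
    exact hF g hg
  · intro g hg
    rw [hZS]
    intro F hF
    have hFW : F ∈ W := by
      intro g hg
      rw [hZS] at hg
      exact hg F hF
    have hmem := mem_span_inter_of_stable (Subalgebra.toSubmodule (polyFunctions V ℚ)) W ρ
      (fun γ c F hF => by
        ext g
        change γ (c * F (gamGL γ.symm g)) = γ c * F g
        rw [map_mul, ← polyFunctions_gamGL γ hF, gamGL_gamGL_symm])
      (fun γ F hF g hg => by
        change γ (F (gamGL γ.symm g)) = 0
        rw [hF _ (hs _ _ hg), map_zero])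
      hFW (polyFunctions_complex_mem_span (hS hF))
    have hle : Submodule.span ℂ ((Subalgebra.toSubmodule (polyFunctions V ℚ) :
        Set (GLC V → ℂ)) ∩ W) ≤ LinearMap.ker (LinearMap.proj (R := ℂ) (φ := fun _ => ℂ) g) := by
      rw [Submodule.span_le]
      intro F hF
      exact hg F hF
    exact hle hmem

/-! ### The Mumford–Tate group -/

namespace RationalHodgeStructure

variable (H : RationalHodgeStructure V)

theorem mumfordTate_isZariskiClosed : IsZariskiClosed ℚ (H.mumfordTate : Set (GLC V)) :=
  IsZariskiClosed.sInf fun _ hG => hG.1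

theorem gamGL_mem_mumfordTate (γ : ℂ ≃+* ℂ) {g : GLC V} (hg : g ∈ H.mumfordTate) :
    gamGL γ g ∈ H.mumfordTate :=
  H.mumfordTate_isZariskiClosed.gamGL_mem γ hg

theorem mumfordTate_le {G : Subgroup (GLC V)} (hG : IsZariskiClosed ℚ (G : Set (GLC V)))
    (hh : ∀ z, H.h z ∈ G) : H.mumfordTate ≤ G :=
  sInf_le ⟨hG, hh⟩

/-- The Mumford–Tate group is generated, as an algebraic group over `ℂ`, by the conjugates of
`h(𝕊)` under the automorphisms of `ℂ`. -/
theorem mumfordTate_le_of_conjugates {G : Subgroup (GLC V)}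
    (hG : IsZariskiClosed ℂ (G : Set (GLC V)))
    (hh : ∀ (γ : ℂ ≃+* ℂ) z, gamGL γ (H.h z) ∈ G) : H.mumfordTate ≤ G := by
  -- Pulling back along any `γ` maps this family into itself, so its intersection is stable under
  -- all automorphisms and is thus defined over `ℚ`.
  let T : Set (Subgroup (GLC V)) := {G | IsZariskiClosed ℂ (G : Set (GLC V)) ∧
    ∀ (γ : ℂ ≃+* ℂ) z, gamGL γ (H.h z) ∈ G}
  have hT : IsZariskiClosed ℂ ((sInf T : Subgroup (GLC V)) : Set (GLC V)) :=
    IsZariskiClosed.sInf fun _ hG => hG.1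
  have hcomap : ∀ (γ : ℂ ≃+* ℂ), ∀ G ∈ T, G.comap (gamGL γ) ∈ T := by
    rintro γ G ⟨hG, hh⟩
    refine ⟨?_, fun γ' z => ?_⟩
    · obtain ⟨S, hS, hZS⟩ := hG
      -- Composing with `γ` alone does not give a polynomial; applying `γ⁻¹` to the value restores
      -- one, with `γ⁻¹` applied to the coefficients.
      refine ⟨{F | ∃ F' ∈ S, F = fun g => γ.symm (F' (gamGL γ g))}, ?_, ?_⟩
      · rintro _ ⟨F', hF', rfl⟩
        have := polyFunctions_complex_mem_span (hS hF')
        change _ ∈ polyFunctions V ℂ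
        clear hF'
        induction this using Submodule.span_induction with
        | mem F hF =>
          have : (fun g => γ.symm (F (gamGL γ g))) = F := by
            ext g
            rw [polyFunctions_gamGL γ hF, RingEquiv.symm_apply_apply]
          rw [this]
          exact polyFunctions_rat_le hF
        | zero => simp only [Pi.zero_apply, map_zero]; exact zero_mem _
        | add x y _ _ hx hy =>
          simp only [Pi.add_apply, map_add]
          exact add_mem hx hy
        | smul a x _ hx =>
          simp only [Pi.smul_apply, smul_eq_mul, map_mul]
          exact Subalgebra.smul_mem _ hx (γ.symm a)
      · ext g
        change gamGL γ g ∈ (G : Set (GLC V)) ↔ _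
        rw [hZS]
        constructor
        · rintro hg _ ⟨F', hF', rfl⟩
          simp [hg F' hF']
        · intro hg F hF
          have := hg _ ⟨F, hF, rfl⟩
          simpa using this
    · rw [Subgroup.mem_comap]
      have : gamGL γ (gamGL γ' (H.h z)) = gamGL (γ'.trans γ) (H.h z) := by
        apply Units.ext
        apply LinearMap.ext
        intro x
        have hc : ∀ (α β : ℂ ≃+* ℂ) (y : Cx V), gam (α.trans β) y = gam β (gam α y) := by
          intro α β y
          induction y using TensorProduct.induction_on with
          | zero => simp
          | tmul z v => simp
          | add x y hx hy => simp only [map_add, hx, hy]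
        simp only [gamGL_apply, RingEquiv.symm_trans, hc]
      rw [this]
      exact hh _ z
  have h1 : IsZariskiClosed ℚ ((sInf T : Subgroup (GLC V)) : Set (GLC V)) := by
    refine hT.rat_of_stable fun γ g hg => ?_
    rw [SetLike.mem_coe, Subgroup.mem_sInf] at hg ⊢
    exact fun G hG => hg _ (hcomap γ G hG)
  refine (H.mumfordTate_le h1 fun z => ?_).trans (sInf_le ⟨hG, hh⟩)
  rw [Subgroup.mem_sInf]
  intro G hG
  have := hG.2 (RingEquiv.refl ℂ) z
  have h2 : gamGL (RingEquiv.refl ℂ) (H.h z) = H.h z := by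
    apply Units.ext
    apply LinearMap.ext
    intro x
    change gam (RingEquiv.refl ℂ) ((H.h z).1 (gam (RingEquiv.refl ℂ) x)) = _
    rw [gam_refl, gam_refl]
  rwa [h2] at this

end RationalHodgeStructure

end Galois

end HodgeMT

namespace HodgeMT

/-! ### Diagonal operators, weight projections and determinants. -/

namespace RationalHodgeStructure

variable {V : Type*} [AddCommGroup V] [Module ℚ V] (H : RationalHodgeStructure V)

/-! ### Operators that are scalar on the Hodge components -/

/-- Linear maps that agree on all the `V^{p,q}` are equal. -/
theorem linearMap_ext {M : Type*} [AddCommGroup M] [Module ℂ M] {f g : Cx V →ₗ[ℂ] M}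
    (hfg : ∀ pq, ∀ x ∈ H.piece pq, f x = g x) : f = g := by
  apply LinearMap.ext
  intro x
  exact H.induction_pieces (P := fun x => f x = g x) (by simp)
    (fun x y hx hy => by rw [map_add, map_add, hx, hy]) (fun p q x hx => hfg _ x hx) x

/-- The operator that is multiplication by `c (p, q)` on `V^{p,q}`. -/
def diag (c : ℤ × ℤ → ℂ) : Module.End ℂ (Cx V) :=
  H.decomp.toLinearMap ∘ₗ
    (DFinsupp.mapRange.linearMap fun pq : ℤ × ℤ =>
      (c pq • LinearMap.id : H.piece pq →ₗ[ℂ] H.piece pq)) ∘ₗ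
    H.decomp.symm.toLinearMap

theorem diag_apply (c : ℤ × ℤ → ℂ) {pq : ℤ × ℤ} {x : Cx V} (hx : x ∈ H.piece pq) :
    H.diag c x = c pq • x := by
  simp only [diag, LinearMap.comp_apply, LinearEquiv.coe_coe, H.decomp_symm_of_mem hx]
  rw [← LinearEquiv.eq_symm_apply, map_smul, H.decomp_symm_of_mem hx]
  erw [DFinsupp.mapRange.linearMap_apply, DFinsupp.mapRange_single]
  erw [← DFinsupp.single_smul]
  rfl

theorem diag_one : H.diag 1 = 1 :=
  H.linearMap_ext fun pq x hx => by simp [H.diag_apply _ hx]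

theorem diag_mul (c d : ℤ × ℤ → ℂ) : H.diag (c * d) = H.diag c * H.diag d :=
  H.linearMap_ext fun pq x hx => by
    simp [H.diag_apply _ hx, smul_smul, mul_comm]

theorem diag_add (c d : ℤ × ℤ → ℂ) : H.diag (c + d) = H.diag c + H.diag d :=
  H.linearMap_ext fun pq x hx => by
    simp [H.diag_apply _ hx, add_smul]

theorem diag_sub (c d : ℤ × ℤ → ℂ) : H.diag (c - d) = H.diag c - H.diag d :=
  H.linearMap_ext fun pq x hx => by
    simp [H.diag_apply _ hx, sub_smul]

theorem diag_smul (a : ℂ) (c : ℤ × ℤ → ℂ) : H.diag (a • c) = a • H.diag c :=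
  H.linearMap_ext fun pq x hx => by
    simp [H.diag_apply _ hx, smul_smul]

theorem diag_comm (c d : ℤ × ℤ → ℂ) : H.diag c * H.diag d = H.diag d * H.diag c := by
  rw [← diag_mul, mul_comm, diag_mul]

theorem h_eq_diag (z : ℂˣ × ℂˣ) :
    (H.h z).1 = H.diag fun pq => ((z.1 ^ (-pq.1) * z.2 ^ (-pq.2) : ℂˣ) : ℂ) :=
  H.linearMap_ext fun pq x hx => by rw [H.diag_apply _ hx, H.h_apply z hx]

theorem weightHom_eq_diag (a : ℂˣ) :
    (H.weightHom a).1 = H.diag fun pq => ((a ^ (pq.1 + pq.2) : ℂˣ) : ℂ) := by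
  change (H.h (a⁻¹, a⁻¹)).1 = _
  rw [h_eq_diag]
  congr 1
  ext pq
  simp only [inv_zpow', neg_neg, zpow_add]

theorem weilOperator_eq_diag :
    H.weilOperator.1 = H.diag fun pq => Complex.I ^ (pq.2 - pq.1) := by
  rw [weilOperator, h_eq_diag]
  congr 1
  ext pq
  simp only [iUnit, Units.val_mul, Units.val_zpow_eq_zpow_val, Units.val_mk0, Units.coe_map,
    MonoidHom.coe_coe, Complex.conj_I]
  rw [← Complex.inv_I, inv_zpow', neg_neg, ← zpow_add₀ Complex.I_ne_zero]
  congr 1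
  ring

/-- Conjugation exchanges `V^{p,q}` and `V^{q,p}`, which accounts for the swap, and conjugates the
scalars. -/
theorem gamEnd_conj_diag (c : ℤ × ℤ → ℂ) :
    gamEnd conjRing (H.diag c) = H.diag fun pq => starRingEnd ℂ (c pq.swap) := by
  refine H.linearMap_ext fun pq x hx => ?_
  rw [gamEnd_apply, conjRing_symm, ← conj_eq_gam, ← conj_eq_gam,
    H.diag_apply _ (H.conj_mem pq.1 pq.2 x hx), H.diag_apply _ hx, LinearEquiv.map_smulₛₗ, conj_conj]
  rfl

/-! ### The weight projections -/

/-- The projection onto the part of weight `m`. -/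
def weightProj (m : ℤ) : Module.End ℂ (Cx V) :=
  H.diag fun pq => if pq.1 + pq.2 = m then 1 else 0

theorem weightProj_of_mem_piece (m : ℤ) {pq : ℤ × ℤ} {x : Cx V} (hx : x ∈ H.piece pq) :
    H.weightProj m x = if pq.1 + pq.2 = m then x else 0 := by
  rw [weightProj, H.diag_apply _ hx]
  split_ifs <;> simp

theorem piece_le_weightC (pq : ℤ × ℤ) : H.piece pq ≤ H.weightC (pq.1 + pq.2) := by
  refine le_iSup_of_le (f := fun p => H.piece (p, pq.1 + pq.2 - p)) pq.1 ?_
  rw [add_sub_cancel_left]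

theorem weightProj_of_mem (m : ℤ) {n : ℤ} {x : Cx V} (hx : x ∈ H.weightC n) :
    H.weightProj m x = if n = m then x else 0 := by
  refine Submodule.iSup_induction _ hx
    (motive := fun x => H.weightProj m x = if n = m then x else 0) ?_ ?_ ?_
  · intro p x hx
    rw [H.weightProj_of_mem_piece m hx]
    simp
  · simp
  · intro x y hx hy
    rw [map_add, hx, hy]
    split_ifs <;> simp

theorem weightProj_mem (m : ℤ) (x : Cx V) : H.weightProj m x ∈ H.weightC m := by
  refine H.induction_pieces (P := fun x => H.weightProj m x ∈ H.weightC m) (by simp)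
    (fun x y hx hy => by rw [map_add]; exact add_mem hx hy) ?_ x
  intro p q x hx
  rw [H.weightProj_of_mem_piece m hx]
  split_ifs with h
  · rw [← h]
    exact H.piece_le_weightC (p, q) hx
  · exact zero_mem _

theorem weightProj_mul_self (m : ℤ) : H.weightProj m * H.weightProj m = H.weightProj m := by
  rw [weightProj, ← diag_mul]
  congr 1
  ext pq
  simp

theorem commute_diag_weightProj (c : ℤ × ℤ → ℂ) (m : ℤ) :
    Commute (H.diag c) (H.weightProj m) := H.diag_comm _ _

/-- The elements of `V_m` form a `ℚ`-structure stable under the automorphisms of `ℂ`. -/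
theorem gam_mem_weightC (γ : ℂ ≃+* ℂ) {m : ℤ} {x : Cx V} (hx : x ∈ H.weightC m) :
    gam γ x ∈ H.weightC m := by
  rw [← baseChange_weight, Submodule.baseChange_eq_span] at hx ⊢
  induction hx using Submodule.span_induction with
  | mem x hx =>
    obtain ⟨v, hv, rfl⟩ := hx
    apply Submodule.subset_span
    exact ⟨v, hv, by simp⟩
  | zero => simp
  | add x y _ _ hx hy => rw [map_add]; exact add_mem hx hy
  | smul a x _ hx => rw [gam_smul]; exact Submodule.smul_mem _ _ hx

/-- This is where rationality of the weight gradation enters: `γ` may move the individual `V^{p,q}`,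
but it preserves each weight space. -/
theorem gam_weightProj (γ : ℂ ≃+* ℂ) (m : ℤ) (x : Cx V) :
    gam γ (H.weightProj m x) = H.weightProj m (gam γ x) := by
  refine H.induction_pieces
    (P := fun x => gam γ (H.weightProj m x) = H.weightProj m (gam γ x)) (by simp)
    (fun x y hx hy => by simp only [map_add, hx, hy]) ?_ x
  intro p q x hx
  have hx' := H.piece_le_weightC _ hx
  rw [H.weightProj_of_mem m hx', H.weightProj_of_mem m (H.gam_mem_weightC γ hx')]
  split_ifs <;> simp

theorem gamEnd_weightProj (γ : ℂ ≃+* ℂ) (m : ℤ) :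
    gamEnd γ (H.weightProj m) = H.weightProj m := by
  apply LinearMap.ext
  intro x
  rw [gamEnd_apply, gam_weightProj, gam_gam_symm]

/-- The determinant of `g` on the part of weight `m` (for `g` preserving the weights). -/
def weightDet (m : ℤ) (g : Module.End ℂ (Cx V)) : ℂ :=
  LinearMap.det (g * H.weightProj m + (1 - H.weightProj m))

/-- For the projection `P`, the product `(fP + 1 - P)(gP + 1 - P)` collapses to `fgP + 1 - P` as
soon as `PgP = gP`; only the right factor has to commute with `P`. -/
theorem weightDet_mul (m : ℤ) {f g : Module.End ℂ (Cx V)} (hg : Commute g (H.weightProj m)) :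
    H.weightDet m (f * g) = H.weightDet m f * H.weightDet m g := by
  rw [weightDet, weightDet, weightDet, ← map_mul]
  congr 1
  have h1 := H.weightProj_mul_self m
  have h2 : g * H.weightProj m = H.weightProj m * g := hg
  set P := H.weightProj m
  have h3 : P * (g * P) = g * P := by rw [← mul_assoc, ← h2, mul_assoc, h1]
  simp only [mul_add, add_mul, mul_sub, sub_mul, mul_one, one_mul, mul_assoc, h3, h1]
  abel

theorem weightDet_one (m : ℤ) : H.weightDet m 1 = 1 := by
  simp [weightDet]

section Finite

variable [Module.Finite ℚ V]

theorem finite_support : {pq : ℤ × ℤ | H.piece pq ≠ ⊥}.Finite :=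
  WellFoundedGT.finite_ne_bot_of_iSupIndep H.isInternal.submodule_iSupIndep

/-- The finite set of the `(p, q)` with `V^{p,q} ≠ 0`. -/
def support : Finset (ℤ × ℤ) := H.finite_support.toFinset

theorem mem_support {pq : ℤ × ℤ} : pq ∈ H.support ↔ H.piece pq ≠ ⊥ := by
  simp [support]

theorem mem_support_of_mem {pq : ℤ × ℤ} {x : Cx V} (hx : x ∈ H.piece pq) (hx0 : x ≠ 0) :
    pq ∈ H.support := by
  rw [mem_support]
  rintro h
  rw [h, Submodule.mem_bot] at hx
  exact hx0 hx

/-- Isolating the scalars from the Hodge projections lets an automorphism of `ℂ` act on the two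
separately. -/
theorem diag_eq_sum (c : ℤ × ℤ → ℂ) :
    H.diag c = ∑ pq ∈ H.support, c pq • H.diag (Pi.single pq 1) := by
  classical
  refine H.linearMap_ext fun pq x hx => ?_
  rw [H.diag_apply _ hx, LinearMap.sum_apply]
  simp only [LinearMap.smul_apply, H.diag_apply _ hx]
  by_cases hx0 : x = 0
  · simp [hx0]
  rw [Finset.sum_eq_single pq]
  · simp
  · intro b _ hb
    simp [hb.symm]
  · intro h
    exact absurd (H.mem_support_of_mem hx hx0) h

/-- The finite set of the weights of `V`. -/
def weights : Finset ℤ := H.support.image fun pq => pq.1 + pq.2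

theorem sum_weightProj : ∑ m ∈ H.weights, H.weightProj m = 1 := by
  refine H.linearMap_ext fun pq x hx => ?_
  rw [LinearMap.sum_apply, Module.End.one_apply]
  simp only [H.weightProj_of_mem_piece _ hx]
  by_cases hx0 : x = 0
  · simp [hx0]
  rw [Finset.sum_ite_eq, if_pos]
  exact Finset.mem_image_of_mem _ (H.mem_support_of_mem hx hx0)

theorem sum_weightProj_apply (x : Cx V) : ∑ m ∈ H.weights, H.weightProj m x = x := by
  rw [← LinearMap.sum_apply, sum_weightProj, Module.End.one_apply]

theorem weightProj_ne_zero {m : ℤ} (hm : m ∈ H.weights) : H.weightProj m ≠ 0 := by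
  obtain ⟨pq, hpq, rfl⟩ := Finset.mem_image.1 hm
  obtain ⟨x, hx, hx0⟩ := Submodule.exists_mem_ne_zero_of_ne_bot (H.mem_support.1 hpq)
  intro h
  have := H.weightProj_of_mem_piece (pq.1 + pq.2) hx
  rw [h, if_pos rfl, LinearMap.zero_apply] at this
  exact hx0 this.symm

/-- The basis of `V_ℂ` given by a basis of `V`. -/
def basisC (V : Type*) [AddCommGroup V] [Module ℚ V] [Module.Finite ℚ V] :
    Module.Basis (Fin (Module.finrank ℚ V)) ℂ (Cx V) :=
  Algebra.TensorProduct.basis ℂ (Module.finBasis ℚ V)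

theorem basisC_apply (i : Fin (Module.finrank ℚ V)) :
    basisC V i = 1 ⊗ₜ[ℚ] Module.finBasis ℚ V i := by
  simp [basisC]

theorem basisC_repr (x : Cx V) (i : Fin (Module.finrank ℚ V)) :
    (basisC V).repr x i = formC ((Module.finBasis ℚ V).coord i) x := by
  induction x using TensorProduct.induction_on with
  | zero => simp
  | tmul z v => simp [basisC]
  | add x y hx hy => simp only [map_add, Finsupp.add_apply, hx, hy]

theorem basisC_repr_gam (γ : ℂ ≃+* ℂ) (x : Cx V) (i : Fin (Module.finrank ℚ V)) :
    (basisC V).repr (gam γ x) i = γ ((basisC V).repr x i) := by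
  rw [basisC_repr, basisC_repr, formC_gam]

/-- The matrix of an endomorphism of `V_ℂ` with respect to a basis of `V`. -/
def mat : Module.End ℂ (Cx V) ≃ₐ[ℂ]
    Matrix (Fin (Module.finrank ℚ V)) (Fin (Module.finrank ℚ V)) ℂ :=
  LinearMap.toMatrixAlgEquiv (basisC V)

theorem mat_apply (g : Module.End ℂ (Cx V)) (i j : Fin (Module.finrank ℚ V)) :
    mat g i j = (basisC V).repr (g (basisC V j)) i :=
  LinearMap.toMatrixAlgEquiv_apply _ _ _ _

theorem mat_gamEnd (γ : ℂ ≃+* ℂ) (g : Module.End ℂ (Cx V)) :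
    mat (gamEnd γ g) = (mat g).map γ := by
  ext i j
  rw [mat_apply, Matrix.map_apply, mat_apply, gamEnd_apply, basisC_repr_gam, basisC_apply, gam_tmul,
    map_one]

theorem det_mat (g : Module.End ℂ (Cx V)) : (mat g).det = LinearMap.det g :=
  LinearMap.det_toMatrix (basisC V) g

theorem det_gamEnd (γ : ℂ ≃+* ℂ) (g : Module.End ℂ (Cx V)) :
    LinearMap.det (gamEnd γ g) = γ (LinearMap.det g) := by
  rw [← det_mat, ← det_mat, mat_gamEnd]
  exact (RingHom.map_det γ.toRingHom (mat g)).symm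

/-- The determinant of an operator that is scalar on the `V^{p,q}`. -/
theorem exists_det_diag : ∃ (s : Finset ((pq : ℤ × ℤ) × Fin (Module.finrank ℂ (H.piece pq)))),
    ∀ c, LinearMap.det (H.diag c) = ∏ i ∈ s, c i.1 := by
  classical
  let b := H.isInternal.collectedBasis fun pq => Module.finBasis ℂ (H.piece pq)
  have : Fintype ((pq : ℤ × ℤ) × Fin (Module.finrank ℂ (H.piece pq))) :=
    Module.Basis.fintypeIndexOfRankLtAleph0 b (Module.rank_lt_aleph0 ℂ (Cx V))
  refine ⟨Finset.univ, fun c => ?_⟩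
  rw [← LinearMap.det_toMatrix b]
  have : LinearMap.toMatrix b b (H.diag c) = Matrix.diagonal fun i => c i.1 := by
    ext i j
    have hj : b j ∈ H.piece j.1 := H.isInternal.collectedBasis_mem _ j
    rw [LinearMap.toMatrix_apply, H.diag_apply c hj, map_smul, b.repr_self, Finsupp.smul_apply,
      Matrix.diagonal_apply, Finsupp.single_apply]
    by_cases h : i = j
    · simp [h]
    · simp [h, Ne.symm h]
  rw [this, Matrix.det_diagonal]

/-- This expresses `dim V^{p,q} = dim V^{q,p}`: the swapped operator is the conjugate of the
diagonal operator with scalars `c̄`, and two conjugations of the determinant cancel. -/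
theorem det_diag_swap (c : ℤ × ℤ → ℂ) :
    LinearMap.det (H.diag fun pq => c pq.swap) = LinearMap.det (H.diag c) := by
  obtain ⟨s, hs⟩ := H.exists_det_diag
  have h1 := H.gamEnd_conj_diag fun pq => starRingEnd ℂ (c pq)
  simp only [Complex.conj_conj] at h1
  rw [← h1, det_gamEnd, hs, hs, map_prod]
  exact Finset.prod_congr rfl fun i _ => Complex.conj_conj _

theorem weightDet_gamEnd (γ : ℂ ≃+* ℂ) (m : ℤ) (g : Module.End ℂ (Cx V)) :
    H.weightDet m (gamEnd γ g) = γ (H.weightDet m g) := by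
  rw [weightDet, weightDet, ← det_gamEnd]
  congr 1
  rw [map_add, map_mul, map_sub, map_one, gamEnd_weightProj]

/-- The eigenvalues on `V_m` are `t ^ (q - p)`, and exchanging `p` and `q` inverts them without
changing the determinant. So the determinant squares to one; writing `t` as a square removes the
sign. -/
theorem weightDet_h (m : ℤ) (t : ℂˣ) : H.weightDet m (H.h (t, t⁻¹)).1 = 1 := by
  let c : ℂˣ → ℤ × ℤ → ℂ := fun t pq =>
    if pq.1 + pq.2 = m then ((t ^ (pq.2 - pq.1) : ℂˣ) : ℂ) else 1
  have h1 : ∀ t, H.weightDet m (H.h (t, t⁻¹)).1 = LinearMap.det (H.diag (c t)) := by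
    intro t
    rw [weightDet, h_eq_diag, weightProj, ← diag_one, ← diag_mul, ← diag_sub, ← diag_add]
    congr 2
    ext pq
    simp only [Pi.add_apply, Pi.sub_apply, Pi.mul_apply, Pi.one_apply, c, inv_zpow', neg_neg,
      ← zpow_add]
    split_ifs
    · rw [neg_add_eq_sub]; ring
    · ring
  have h2 : ∀ t, LinearMap.det (H.diag (c t)) * LinearMap.det (H.diag (c t)) = 1 := by
    intro t
    nth_rewrite 1 [← H.det_diag_swap (c t)]
    rw [← map_mul, ← diag_mul]
    have : (fun pq : ℤ × ℤ => c t pq.swap) * c t = 1 := by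
      ext pq
      simp only [Pi.mul_apply, Pi.one_apply, c, Prod.fst_swap, Prod.snd_swap]
      rw [add_comm pq.2 pq.1]
      split_ifs
      · rw [← Units.val_mul, ← zpow_add]
        simp
      · ring
    rw [this, diag_one, map_one]
  have h3 : ∃ s : ℂˣ, s * s = t := by
    obtain ⟨s, hs⟩ := IsAlgClosed.exists_pow_nat_eq (t : ℂ) (n := 2) (by norm_num)
    have hs0 : s ≠ 0 := by
      rintro rfl
      exact t.ne_zero (by rw [← hs]; norm_num)
    exact ⟨Units.mk0 s hs0, Units.ext (by simpa [sq] using hs)⟩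
  obtain ⟨s, rfl⟩ := h3
  rw [h1, ← h2 s, ← map_mul, ← diag_mul]
  congr 2
  ext pq
  simp only [Pi.mul_apply, c, mul_zpow]
  split_ifs <;> simp

end Finite

end RationalHodgeStructure

end HodgeMT

namespace HodgeMT

/-! ### One-parameter groups as limits of powers. -/

section Trotter

open Filter Topology

/-- The difference telescopes into `n` products with one factor `a - b`; taking `M ≥ 1` allows the
crude power `M ^ n`. -/
theorem norm_pow_sub_pow_le {A : Type*} [NormedRing A] [NormOneClass A] {a b : A} {M : ℝ}
    (hM : 1 ≤ M) (ha : ‖a‖ ≤ M) (hb : ‖b‖ ≤ M) (n : ℕ) :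
    ‖a ^ n - b ^ n‖ ≤ n * M ^ n * ‖a - b‖ := by
  induction n with
  | zero => simp
  | succ n ih =>
    have h1 : a ^ (n + 1) - b ^ (n + 1) = a ^ n * (a - b) + (a ^ n - b ^ n) * b := by
      rw [pow_succ, pow_succ, mul_sub, sub_mul]; abel
    have h2 : ‖a ^ n‖ ≤ M ^ n := (norm_pow_le a n).trans (pow_le_pow_left₀ (norm_nonneg _) ha n)
    have hM0 : 0 ≤ M := zero_le_one.trans hM
    have h3 : M ^ n ≤ M ^ (n + 1) := pow_le_pow_right₀ hM n.le_succ
    have h4 : M ^ n * ‖a - b‖ ≤ M ^ (n + 1) * ‖a - b‖ :=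
      mul_le_mul_of_nonneg_right h3 (norm_nonneg _)
    rw [h1]
    refine (norm_add_le _ _).trans ?_
    have h5 : ‖a ^ n * (a - b)‖ ≤ M ^ n * ‖a - b‖ :=
      (norm_mul_le _ _).trans (mul_le_mul_of_nonneg_right h2 (norm_nonneg _))
    have h6 : ‖(a ^ n - b ^ n) * b‖ ≤ n * M ^ n * ‖a - b‖ * M :=
      (norm_mul_le _ _).trans (mul_le_mul ih hb (norm_nonneg _) (by positivity))
    calc ‖a ^ n * (a - b)‖ + ‖(a ^ n - b ^ n) * b‖
        ≤ M ^ (n + 1) * ‖a - b‖ + n * M ^ n * ‖a - b‖ * M := add_le_add (h5.trans h4) h6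
      _ = ((n + 1 : ℕ) : ℝ) * M ^ (n + 1) * ‖a - b‖ := by push_cast; ring

/-- A curve with velocity `X` at `1` approximates the one-parameter group of `X`. -/
theorem tendsto_pow_exp_of_hasDerivAt {A : Type*} [NormedRing A] [NormOneClass A]
    [NormedAlgebra ℝ A] [CompleteSpace A] {u : ℝ → A} {X : A} (hu0 : u 0 = 1)
    (hu : HasDerivAt u X 0) (t : ℝ) :
    Tendsto (fun n : ℕ => u (t / n) ^ n) atTop (𝓝 (NormedSpace.exp (t • X))) := by
  let _ : NormedAlgebra ℚ A := NormedAlgebra.restrictScalars ℚ ℝ A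
  let v : ℝ → A := fun s => NormedSpace.exp (s • X)
  have hv0 : v 0 = 1 := by simp [v]
  have hv : HasDerivAt v X 0 := by
    have := hasDerivAt_exp_smul_const (𝕂 := ℝ) X 0
    simpa using this
  have htn : Tendsto (fun n : ℕ => t / (n : ℝ)) atTop (𝓝 0) := tendsto_const_div_atTop_nhds_zero_nat t
  -- The bound `1 + c / n` is what keeps the `n`-th powers below `exp c`, uniformly in `n`.
  have bound : ∀ w : ℝ → A, w 0 = 1 → HasDerivAt w X 0 →
      ∀ᶠ n : ℕ in atTop, ‖w (t / n)‖ ≤ 1 + (‖X‖ + 1) * |t| / n := by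
    intro w hw0 hw
    have h1 := hw.isBigO_sub
    have h2 := (hasDerivAt_iff_isLittleO.1 hw).def (c := 1) one_pos
    filter_upwards [htn.eventually h2] with n hn
    rw [hw0, sub_zero, one_mul, Real.norm_eq_abs] at hn
    have e : w (t / n) = 1 + (t / n) • X + (w (t / n) - 1 - (t / n) • X) := by abel
    rw [e]
    refine (norm_add₃_le).trans ?_
    rw [norm_one, norm_smul, Real.norm_eq_abs]
    have : |t / (n : ℝ)| = |t| / n := by rw [abs_div, Nat.abs_cast]
    rw [this] at hn ⊢
    calc 1 + |t| / n * ‖X‖ + ‖w (t / n) - 1 - (t / n) • X‖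
        ≤ 1 + |t| / n * ‖X‖ + |t| / n := by gcongr
      _ = _ := by ring
  set c := (‖X‖ + 1) * |t| with hc
  have hc0 : 0 ≤ c := by positivity
  -- The curves `u` and `v` agree to first order at `0`, so their difference at `t / n` is `o(1 /
  -- n)`, which absorbs the factor `n` from the telescoping.
  have hdiff : Tendsto (fun n : ℕ => n * ‖u (t / n) - v (t / n)‖) atTop (𝓝 0) := by
    have hd : HasDerivAt (fun s => u s - v s) 0 0 := by
      have := hu.sub hv
      rwa [sub_self] at this
    rw [Metric.tendsto_nhds]
    intro ε hε
    have h2 := (hasDerivAt_iff_isLittleO.1 hd).def (c := ε / (2 * (|t| + 1))) (by positivity)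
    filter_upwards [htn.eventually h2, eventually_gt_atTop 0] with n hn hn0
    simp only [hu0, hv0, sub_self, sub_zero, smul_zero, Real.norm_eq_abs] at hn
    rw [dist_zero_right, Real.norm_eq_abs, abs_of_nonneg (by positivity)]
    have hn0' : (0 : ℝ) < n := by exact_mod_cast hn0
    have : |t / (n : ℝ)| = |t| / n := by rw [abs_div, Nat.abs_cast]
    rw [this] at hn
    calc n * ‖u (t / n) - v (t / n)‖ ≤ n * (ε / (2 * (|t| + 1)) * (|t| / n)) := by gcongr
      _ = ε * (|t| / (2 * (|t| + 1))) := by field_simp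
      _ ≤ ε * (1 / 2) := by
        refine mul_le_mul_of_nonneg_left ?_ hε.le
        rw [div_le_div_iff₀ (by positivity) (by norm_num)]
        linarith
      _ < ε := by linarith
  have hexp : Tendsto (fun n : ℕ => u (t / n) ^ n - v (t / n) ^ n) atTop (𝓝 0) := by
    have h0 : Tendsto (fun n : ℕ => Real.exp c * (n * ‖u (t / n) - v (t / n)‖)) atTop (𝓝 0) := by
      simpa using hdiff.const_mul (Real.exp c)
    refine squeeze_zero_norm' ?_ h0
    filter_upwards [bound u hu0 hu, bound v hv0 hv, eventually_gt_atTop 0] with n h1 h2 hn0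
    have hn0' : (0 : ℝ) < n := by exact_mod_cast hn0
    have hM : (1 : ℝ) ≤ 1 + c / n := by
      have : 0 ≤ c / n := by positivity
      linarith
    refine (norm_pow_sub_pow_le hM h1 h2 n).trans ?_
    have h3 : (1 + c / n) ^ n ≤ Real.exp c := by
      have h4 : 1 + c / n ≤ Real.exp (c / n) := by
        rw [add_comm]; exact Real.add_one_le_exp _
      calc (1 + c / n) ^ n ≤ Real.exp (c / n) ^ n :=
            pow_le_pow_left₀ (zero_le_one.trans hM) h4 n
        _ = Real.exp c := by rw [← Real.exp_nat_mul]; congr 1; field_simp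
    calc n * (1 + c / n) ^ n * ‖u (t / n) - v (t / n)‖
        ≤ n * Real.exp c * ‖u (t / n) - v (t / n)‖ := by gcongr
      _ = _ := by ring
  have hvn : ∀ᶠ n : ℕ in atTop, v (t / n) ^ n = NormedSpace.exp (t • X) := by
    filter_upwards [eventually_gt_atTop 0] with n hn0
    have hn0' : (n : ℝ) ≠ 0 := by exact_mod_cast hn0.ne'
    change NormedSpace.exp ((t / (n : ℝ)) • X) ^ n = _
    rw [← NormedSpace.exp_nsmul, ← Nat.cast_smul_eq_nsmul ℝ, smul_smul, mul_div_cancel₀ _ hn0']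
  have := hexp.add (tendsto_const_nhds.congr' (hvn.mono fun n h => h.symm))
  simpa using this

end Trotter

/-! ### Invariant hermitian forms of compact groups. -/

section CompactGroup

open scoped Matrix.Norms.Operator Matrix ComplexOrder
open MeasureTheory

variable {n : Type} [Fintype n] [DecidableEq n]

/-- A compact group of complex matrices preserves a positive definite hermitian form. -/
theorem exists_posDef_invariant (Γ : Subgroup (Matrix n n ℂ)ˣ)
    (hΓ : IsCompact (Γ : Set (Matrix n n ℂ)ˣ)) :
    ∃ P : Matrix n n ℂ, (∀ x, x ≠ 0 → 0 < star x ⬝ᵥ (P *ᵥ x)) ∧ ∀ g ∈ Γ, g.1ᴴ * P * g.1 = P := by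
  let _ : MeasurableSpace Γ := borel Γ
  have : BorelSpace Γ := ⟨rfl⟩
  have : CompactSpace Γ := isCompact_iff_compactSpace.1 hΓ
  let μ : Measure Γ := Measure.haar
  -- The inverse turns `M ↦ kᴴ M k` into the left translation `g ↦ k⁻¹ g`, under which Haar measure
  -- is invariant.
  let f : Γ → Matrix n n ℂ := fun g => (g⁻¹ : Γ).1.1ᴴ * (g⁻¹ : Γ).1.1
  have hcont : Continuous fun g : Γ => (g⁻¹ : Γ).1.1 :=
    Units.continuous_val.comp (continuous_subtype_val.comp continuous_inv)
  have hf : Continuous f := hcont.matrix_conjTranspose.mul hcont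
  have hint : ∀ {E : Type _} [NormedAddCommGroup E] {f : Γ → E}, Continuous f → Integrable f μ :=
    fun hf => hf.integrable_of_hasCompactSupport (HasCompactSupport.of_compactSpace _)
  have hlin : ∀ {E : Type} [NormedAddCommGroup E] [NormedSpace ℂ E] [FiniteDimensional ℂ E]
      (L : Matrix n n ℂ →ₗ[ℂ] E), L (∫ g, f g ∂μ) = ∫ g, L (f g) ∂μ := by
    intro E _ _ _ L
    have : CompleteSpace E := FiniteDimensional.complete ℂ E
    exact ((LinearMap.toContinuousLinearMap L).integral_comp_comm (hint hf)).symm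
  refine ⟨∫ g, f g ∂μ, ?_, ?_⟩
  · intro x hx
    let L : Matrix n n ℂ →ₗ[ℂ] ℂ :=
      { toFun := fun M => star x ⬝ᵥ (M *ᵥ x)
        map_add' := fun M N => by rw [Matrix.add_mulVec, dotProduct_add]
        map_smul' := fun c M => by rw [Matrix.smul_mulVec, dotProduct_smul]; rfl }
    let r : Γ → ℝ := fun g => ∑ i, ‖((g⁻¹ : Γ).1.1 *ᵥ x) i‖ ^ 2
    have hr : ∀ g, L (f g) = (r g : ℂ) := by
      intro g
      change star x ⬝ᵥ ((g⁻¹ : Γ).1.1ᴴ * (g⁻¹ : Γ).1.1) *ᵥ x = _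
      rw [← Matrix.mulVec_mulVec, Matrix.dotProduct_mulVec, ← Matrix.star_mulVec, dotProduct]
      simp only [Pi.star_apply, RCLike.star_def, Complex.conj_mul']
      push_cast [r]
      rfl
    have hrc : Continuous r := by
      have hm : Continuous fun g : Γ => (g⁻¹ : Γ).1.1 *ᵥ x := hcont.matrix_mulVec continuous_const
      exact continuous_finsetSum _ fun i _ => ((continuous_apply i).comp hm).norm.pow 2
    have hpos : 0 < ∫ g, r g ∂μ := by
      refine hrc.integral_pos_of_hasCompactSupport_nonneg_nonzero
        (HasCompactSupport.of_compactSpace _) (fun g => by positivity) (x := 1) ?_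
      intro h0
      apply hx
      simp only [r, inv_one, Subgroup.coe_one, Units.val_one, Matrix.one_mulVec] at h0
      rw [Finset.sum_eq_zero_iff_of_nonneg (fun i _ => by positivity)] at h0
      ext i
      simpa using h0 i (Finset.mem_univ i)
    have h1 : star x ⬝ᵥ ((∫ g, f g ∂μ) *ᵥ x) = ((∫ g, r g ∂μ : ℝ) : ℂ) := by
      change L (∫ g, f g ∂μ) = _
      rw [hlin L]
      simp only [hr]
      exact integral_ofReal (𝕜 := ℂ)
    rw [h1]
    exact_mod_cast hpos
  · intro k hk
    let L : Matrix n n ℂ →ₗ[ℂ] Matrix n n ℂ :=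
      { toFun := fun M => k.1ᴴ * M * k.1
        map_add' := fun M N => by rw [mul_add, add_mul]
        map_smul' := fun c M => by simp }
    have h1 : k.1ᴴ * (∫ g, f g ∂μ) * k.1 = ∫ g, L (f g) ∂μ := hlin L
    have h2 : ∀ g, L (f g) = f ((⟨k, hk⟩ : Γ)⁻¹ * g) := by
      intro g
      simp only [L, f, LinearMap.coe_mk, AddHom.coe_mk, mul_inv_rev, inv_inv, Subgroup.coe_mul,
        Units.val_mul, Matrix.conjTranspose_mul, mul_assoc]
    rw [h1]
    simp only [h2]
    exact integral_mul_left_eq_self f _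

/-- The infinitesimal generator of a one-parameter group of isometries is skew-hermitian. -/
theorem skew_of_exp_invariant {P A : Matrix n n ℂ}
    (h : ∀ t : ℝ, (NormedSpace.exp (t • A))ᴴ * P * NormedSpace.exp (t • A) = P) :
    Aᴴ * P + P * A = 0 := by
  have h1 : ∀ t : ℝ, NormedSpace.exp (t • Aᴴ) * P * NormedSpace.exp (t • A) = P := by
    intro t
    refine Eq.trans ?_ (h t)
    rw [← Matrix.exp_conjTranspose, Matrix.conjTranspose_smul, star_trivial]
  have h2 : HasDerivAt (fun t : ℝ => NormedSpace.exp (t • Aᴴ) * P * NormedSpace.exp (t • A))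
      (Aᴴ * P + P * A) 0 := by
    have ha := hasDerivAt_exp_smul_const (𝕂 := ℝ) A 0
    have hb := hasDerivAt_exp_smul_const (𝕂 := ℝ) Aᴴ 0
    have := (hb.mul_const P).mul ha
    simp only [zero_smul, NormedSpace.exp_zero, one_mul, mul_one] at this
    exact this
  have h3 : HasDerivAt (fun _ : ℝ => P) (Aᴴ * P + P * A) 0 :=
    h2.congr_of_eventuallyEq (Filter.Eventually.of_forall fun t => (h1 t).symm)
  exact h3.unique (hasDerivAt_const _ _)

end CompactGroup

end HodgeMT

namespace HodgeMT

/-! ### The classical topology of `GL(V_ℂ)` in matrix coordinates. -/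

section Topology

open RationalHodgeStructure Topology
open scoped Matrix

variable {V : Type*} [AddCommGroup V] [Module ℚ V] [Module.Finite ℚ V]

/-- The matrices over `R` indexed by a basis of `V`. -/
abbrev Mat (V : Type*) [AddCommGroup V] [Module ℚ V] : Type :=
  Matrix (Fin (Module.finrank ℚ V)) (Fin (Module.finrank ℚ V)) ℂ

/-- Elements of `GL(V_ℂ)` as invertible matrices. -/
def matUnits : GLC V ≃* (Mat V)ˣ := Units.mapEquiv (mat (V := V)).toMulEquiv

theorem matUnits_val (g : GLC V) : (matUnits g).1 = mat g.1 := rfl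

theorem matUnits_inv (g : GLC V) : ((matUnits g)⁻¹).1 = mat (g⁻¹).1 := rfl

/-- Both algebras carry the module topology, for which linear maps are continuous; so the matrix
isomorphism is a homeomorphism and induces one of unit groups. -/
theorem isInducing_matUnits : IsInducing (matUnits : GLC V → (Mat V)ˣ) := by
  let τ : TopologicalSpace (Module.End ℂ (Cx V)) := moduleTopology ℂ (Module.End ℂ (Cx V))
  have hτ : IsModuleTopology ℂ (Module.End ℂ (Cx V)) := ⟨rfl⟩
  have hτ' : IsModuleTopology ℂ (Mat V) := isModuleTopologyOfFiniteDimensional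
  have : ContinuousAdd (Module.End ℂ (Cx V)) := ModuleTopology.continuousAdd ℂ _
  have : ContinuousSMul ℂ (Module.End ℂ (Cx V)) := ModuleTopology.continuousSMul ℂ _
  have h1 : Continuous (mat (V := V)) :=
    IsModuleTopology.continuous_of_linearMap (mat (V := V)).toLinearMap
  have h2 : Continuous (mat (V := V)).symm :=
    IsModuleTopology.continuous_of_linearMap (mat (V := V)).symm.toLinearMap
  have h3 : Continuous (Units.map (mat (V := V)).toMulEquiv.toMonoidHom) := Continuous.units_map _ h1
  have h4 : Continuous (Units.map (mat (V := V)).symm.toMulEquiv.toMonoidHom) :=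
    Continuous.units_map _ h2
  let e : GLC V ≃ₜ (Mat V)ˣ := ⟨matUnits.toEquiv, h3, h4⟩
  exact e.isInducing

/-- `GL(V_ℂ)` is homeomorphic to the group of invertible matrices. -/
def matHomeo : GLC V ≃ₜ (Mat V)ˣ :=
  (matUnits (V := V)).toEquiv.toHomeomorphOfIsInducing isInducing_matUnits

theorem continuous_mat : Continuous fun g : GLC V => mat g.1 :=
  Units.continuous_val.comp (matHomeo (V := V)).continuous

theorem continuous_mat_inv : Continuous fun g : GLC V => mat (g⁻¹).1 :=
  (Units.continuous_iff.1 (matHomeo (V := V)).continuous).2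

theorem continuous_glc_iff {X : Type*} [TopologicalSpace X] {f : X → GLC V} :
    Continuous f ↔ Continuous (fun x => mat (f x).1) ∧ Continuous fun x => mat ((f x)⁻¹).1 := by
  rw [← (matHomeo (V := V)).comp_continuous_iff, Units.continuous_iff]
  rfl

instance : T2Space (GLC V) := (matHomeo (V := V)).symm.t2Space

instance : IsTopologicalGroup (GLC V) where
  continuous_mul := by
    rw [continuous_glc_iff]
    constructor
    · simp only [Units.val_mul, map_mul]
      exact (continuous_mat.comp continuous_fst).mul (continuous_mat.comp continuous_snd)
    · simp only [mul_inv_rev, Units.val_mul, map_mul]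
      exact (continuous_mat_inv.comp continuous_snd).mul (continuous_mat_inv.comp continuous_fst)
  continuous_inv := by
    rw [continuous_glc_iff]
    simp only [inv_inv]
    exact ⟨continuous_mat_inv, continuous_mat⟩

theorem continuous_linear {M : Type*} [AddCommGroup M] [Module ℂ M] [TopologicalSpace M]
    [IsTopologicalAddGroup M] [ContinuousSMul ℂ M] (L : Module.End ℂ (Cx V) →ₗ[ℂ] M) :
    Continuous fun g : GLC V => L g.1 := by
  have h : Continuous (L ∘ₗ (mat (V := V)).symm.toLinearMap) :=
    LinearMap.continuous_of_finiteDimensional _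
  have := h.comp continuous_mat
  simpa [Function.comp_def] using this

theorem continuous_matrixCoeff (f : Module.Dual ℚ V) (v : V) :
    Continuous (matrixCoeff f v) :=
  continuous_linear ((formC f).comp (LinearMap.applyₗ ((1 : ℂ) ⊗ₜ[ℚ] v)))

theorem continuous_of_mem_polyFunctions {F : GLC V → ℂ} (hF : F ∈ polyFunctions V ℂ) :
    Continuous F := by
  induction hF using Algebra.adjoin_induction with
  | mem F hF =>
    obtain ⟨f, v, rfl⟩ := hF
    exact continuous_matrixCoeff f v
  | algebraMap r => exact continuous_const
  | add x y _ _ hx hy => exact hx.add hy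
  | mul x y _ _ hx hy => exact hx.mul hy

theorem IsZariskiClosed.isClosed {Z : Set (GLC V)} (hZ : IsZariskiClosed ℂ Z) : IsClosed Z := by
  obtain ⟨S, hS, rfl⟩ := hZ
  have : {g : GLC V | ∀ F ∈ S, F g = 0} = ⋂ F ∈ S, {g | F g = 0} := by ext; simp
  rw [this]
  exact isClosed_biInter fun F hF =>
    isClosed_eq (continuous_of_mem_polyFunctions (hS hF)) continuous_const

/-- A closed subset of `GL(V_ℂ)` on which the entries of `g` and `g⁻¹` are bounded is compact. -/
theorem isCompact_of_bounded {Z : Set (GLC V)} (hZ : IsClosed Z) (R : ℝ)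
    (h1 : ∀ g ∈ Z, ∀ i j, ‖mat g.1 i j‖ ≤ R) (h2 : ∀ g ∈ Z, ∀ i j, ‖mat (g⁻¹).1 i j‖ ≤ R) :
    IsCompact Z := by
  -- Recording `g⁻¹` as well makes the image closed, since it is cut out by `ab = ba = 1`;
  -- compactness then comes from a product of closed balls.
  let φ : GLC V → Mat V × Mat V := fun g => (mat g.1, mat (g⁻¹).1)
  have hφc : Continuous φ := continuous_mat.prodMk continuous_mat_inv
  have hφi : IsInducing φ := by
    refine ⟨le_antisymm hφc.le_induced ?_⟩
    let _ : TopologicalSpace (GLC V) := TopologicalSpace.induced φ inferInstance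
    have h : Continuous φ := continuous_induced_dom
    have := (@continuous_glc_iff V _ _ _ (GLC V) _ id).2 ⟨h.fst, h.snd⟩
    exact continuous_id_iff_le.1 this
  have hrange : Set.range φ = {p | p.1 * p.2 = 1 ∧ p.2 * p.1 = 1} := by
    ext ⟨a, b⟩
    constructor
    · rintro ⟨g, hg⟩
      obtain ⟨rfl, rfl⟩ := Prod.mk.inj hg
      constructor
      · change mat g.1 * mat (g⁻¹).1 = 1
        rw [← map_mul, ← Units.val_mul, mul_inv_cancel, Units.val_one, map_one]
      · change mat (g⁻¹).1 * mat g.1 = 1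
        rw [← map_mul, ← Units.val_mul, inv_mul_cancel, Units.val_one, map_one]
    · rintro ⟨hab, hba⟩
      refine ⟨matUnits.symm ⟨a, b, hab, hba⟩, ?_⟩
      have h3 := (matUnits (V := V)).apply_symm_apply ⟨a, b, hab, hba⟩
      refine Prod.ext ?_ ?_
      · change mat _ = a
        rw [← matUnits_val, h3]
      · change mat _ = b
        rw [← matUnits_inv, h3]
        rfl
  have hφ : IsClosedEmbedding φ := by
    refine ⟨⟨hφi, ?_⟩, ?_⟩
    · intro g g' h
      apply Units.ext
      exact mat.injective (Prod.mk.inj h).1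
    · rw [hrange]
      exact (isClosed_eq (continuous_fst.mul continuous_snd) continuous_const).inter
        (isClosed_eq (continuous_snd.mul continuous_fst) continuous_const)
  let B : Set (Mat V) := Set.univ.pi fun _ => Set.univ.pi fun _ => Metric.closedBall 0 R
  have hB : IsCompact B :=
    isCompact_univ_pi fun _ => isCompact_univ_pi fun _ => isCompact_closedBall _ _
  refine (hφ.isCompact_preimage (hB.prod hB)).of_isClosed_subset hZ ?_
  intro g hg
  refine ⟨fun i _ j _ => ?_, fun i _ j _ => ?_⟩
  · rw [mem_closedBall_zero_iff]; exact h1 g hg i j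
  · rw [mem_closedBall_zero_iff]; exact h2 g hg i j

/-- Coordinates on `V_ℂ` with respect to a basis of `V`. -/
def coord (x : Cx V) : Fin (Module.finrank ℚ V) → ℂ := (basisC V).repr x

theorem mat_mulVec_coord (g : Module.End ℂ (Cx V)) (x : Cx V) :
    mat g *ᵥ coord x = coord (g x) := by
  have := LinearMap.toMatrix_mulVec_repr (basisC V) (basisC V) g x
  exact this

theorem coord_injective : Function.Injective (coord (V := V)) := by
  intro x y h
  apply (basisC V).repr.injective
  exact DFunLike.coe_injective h

theorem mat_entry (g : Module.End ℂ (Cx V)) (i j : Fin (Module.finrank ℚ V)) :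
    mat g i j = coord (g (basisC V j)) i := mat_apply g i j

end Topology

end HodgeMT

namespace HodgeMT

/-! ### Exponential parametrization of the conjugates of `h`, and connectedness. -/

namespace RationalHodgeStructure

open Topology

variable {V : Type*} [AddCommGroup V] [Module ℚ V] (H : RationalHodgeStructure V)

/-- The exponential as a map to `ℂˣ`. -/
def expUnit (s : ℂ) : ℂˣ := Units.mk0 (Complex.exp s) (Complex.exp_ne_zero s)

theorem expUnit_zpow (s : ℂ) (k : ℤ) : ((expUnit s ^ k : ℂˣ) : ℂ) = Complex.exp (k * s) := by
  rw [Units.val_zpow_eq_zpow_val, Complex.exp_int_mul]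
  rfl

theorem expUnit_neg (s : ℂ) : expUnit (-s) = (expUnit s)⁻¹ := by
  apply Units.ext
  rw [Units.val_inv_eq_inv_val]
  exact Complex.exp_neg s

theorem expUnit_surjective : Function.Surjective expUnit := by
  intro z
  exact ⟨Complex.log z, Units.ext (Complex.exp_log z.ne_zero)⟩

/-- The conjugate of `h` by `γ`, evaluated at `(exp s₁, exp s₂)`. -/
def conjExp (γ : ℂ ≃+* ℂ) (s : ℂ × ℂ) : GLC V :=
  gamGL γ (H.h (Units.map γ.symm.toMonoidHom (expUnit s.1), Units.map γ.symm.toMonoidHom (expUnit s.2)))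

theorem conjExp_neg (γ : ℂ ≃+* ℂ) (s : ℂ × ℂ) : H.conjExp γ (-s) = (H.conjExp γ s)⁻¹ := by
  rw [conjExp, conjExp, ← map_inv, ← map_inv]
  congr 2
  rw [Prod.inv_mk, ← map_inv, ← map_inv, ← expUnit_neg, ← expUnit_neg]
  rfl

theorem conjExp_zero (γ : ℂ ≃+* ℂ) : H.conjExp γ 0 = 1 := by
  have h1 : expUnit 0 = 1 := Units.ext Complex.exp_zero
  simp only [conjExp, Prod.fst_zero, Prod.snd_zero, h1, map_one]
  rw [show ((1 : ℂˣ), (1 : ℂˣ)) = 1 from rfl, map_one, map_one]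

theorem conjExp_mem (γ : ℂ ≃+* ℂ) (s : ℂ × ℂ) : H.conjExp γ s ∈ H.mumfordTate :=
  H.gamGL_mem_mumfordTate γ (H.h_mem_mumfordTate _)

/-- The parameter is a logarithm of `γ z`, so the `γ⁻¹` built into the parametrization gives back
`z`. -/
theorem gamGL_h_eq_conjExp (γ : ℂ ≃+* ℂ) (z : ℂˣ × ℂˣ) : ∃ s, gamGL γ (H.h z) = H.conjExp γ s := by
  obtain ⟨s₁, h₁⟩ := expUnit_surjective (Units.map γ.toMonoidHom z.1)
  obtain ⟨s₂, h₂⟩ := expUnit_surjective (Units.map γ.toMonoidHom z.2)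
  refine ⟨(s₁, s₂), ?_⟩
  simp only [conjExp, h₁, h₂]
  congr 2
  ext <;> simp

theorem matrixCoeff_mul_right (f : Module.Dual ℚ V) (v : V) (a : GLC V) :
    (fun g => matrixCoeff f v (g * a)) ∈ polyFunctions V ℂ := by
  have h : ∀ x : Cx V, (fun g : GLC V => formC f (g.1 x)) ∈ polyFunctions V ℂ := by
    intro x
    induction x using TensorProduct.induction_on with
    | zero => simp only [map_zero]; exact zero_mem _
    | tmul z v =>
      have : (fun g : GLC V => formC f (g.1 (z ⊗ₜ[ℚ] v))) = z • matrixCoeff f v := by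
        ext g
        have : z ⊗ₜ[ℚ] v = z • ((1 : ℂ) ⊗ₜ[ℚ] v) := by simp [TensorProduct.smul_tmul']
        rw [this, map_smul, map_smul]
        rfl
      have hmem : matrixCoeff f v ∈ polyFunctions V ℂ := Algebra.subset_adjoin ⟨f, v, rfl⟩
      rw [this]
      exact Subalgebra.smul_mem _ hmem z
    | add x y hx hy =>
      simp only [map_add]
      exact add_mem hx hy
  exact h (a.1 (1 ⊗ₜ[ℚ] v))

/-- Right translations preserve the polynomial functions. -/
theorem polyFunctions_mul_right {F : GLC V → ℂ} (hF : F ∈ polyFunctions V ℂ) (a : GLC V) :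
    (fun g => F (g * a)) ∈ polyFunctions V ℂ := by
  induction hF using Algebra.adjoin_induction with
  | mem F hF =>
    obtain ⟨f, v, rfl⟩ := hF
    exact matrixCoeff_mul_right f v a
  | algebraMap r => exact Subalgebra.algebraMap_mem _ r
  | add x y _ _ hx hy => exact add_mem hx hy
  | mul x y _ _ hx hy => exact mul_mem hx hy

variable [Module.Finite ℚ V]

/-- The `γ⁻¹` in the argument cancels the action of `γ` on the eigenvalues. So although `γ` may be
wildly discontinuous, its effect is confined to fixed projections and the dependence on `s` is
analytic. -/
theorem conjExp_val (γ : ℂ ≃+* ℂ) (s : ℂ × ℂ) :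
    (H.conjExp γ s).1 = ∑ pq ∈ H.support,
      Complex.exp (-(pq.1 * s.1 + pq.2 * s.2)) • gamEnd γ (H.diag (Pi.single pq 1)) := by
  rw [conjExp, gamGL_val, h_eq_diag, diag_eq_sum, map_sum]
  refine Finset.sum_congr rfl fun pq _ => ?_
  rw [gamEnd_smul]
  congr 1
  rw [← map_zpow, ← map_zpow, ← map_mul]
  change γ (γ.symm _) = _
  rw [RingEquiv.apply_symm_apply, Units.val_mul, expUnit_zpow, expUnit_zpow, ← Complex.exp_add]
  congr 1
  push_cast
  ring

theorem continuous_conjExp (γ : ℂ ≃+* ℂ) : Continuous (H.conjExp γ) := by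
  have h : Continuous fun s => mat (H.conjExp γ s).1 := by
    simp only [conjExp_val, map_sum, map_smul]
    fun_prop
  rw [continuous_glc_iff]
  refine ⟨h, ?_⟩
  simp only [← conjExp_neg]
  exact h.comp continuous_neg

/-- Since `ℂ × ℂ` is connected, translation by a conjugate of `h(𝕊)` cannot move a point from one
closed piece to the other. The elements preserving both pieces form a closed subgroup, which is then
all of `G`; the translates of `1` thus stay in the piece that contains `1`. -/
theorem isConnectedAlg_mumfordTate : IsConnectedAlg H.mumfordTate := by
  have key : ∀ A B : Set (GLC V), IsZariskiClosed ℂ A → IsZariskiClosed ℂ B →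
      A ∪ B = (H.mumfordTate : Set (GLC V)) → A ∩ B = ∅ → 1 ∈ A → B = ∅ := by
    intro A B hA hB hAB hAB' h1
    have hstable : ∀ A B : Set (GLC V), IsZariskiClosed ℂ A → IsZariskiClosed ℂ B →
        A ∪ B = (H.mumfordTate : Set (GLC V)) → A ∩ B = ∅ →
        ∀ γ s, ∀ g ∈ A, H.conjExp γ s * g ∈ A := by
      intro A B hA hB hAB hAB' γ s g hg
      have hf : Continuous fun s => H.conjExp γ s * g :=
        (H.continuous_conjExp γ).mul continuous_const
      have hgG : g ∈ H.mumfordTate := by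
        have : g ∈ A ∪ B := Or.inl hg
        rwa [hAB] at this
      have hcl : IsClopen ((fun s => H.conjExp γ s * g) ⁻¹' A) := by
        refine ⟨hA.isClosed.preimage hf, ?_⟩
        rw [← isClosed_compl_iff]
        have : ((fun s => H.conjExp γ s * g) ⁻¹' A)ᶜ = (fun s => H.conjExp γ s * g) ⁻¹' B := by
          ext s
          have hmem : H.conjExp γ s * g ∈ A ∪ B := by
            rw [hAB]
            exact mul_mem (H.conjExp_mem γ s) hgG
          have hdis : ¬ (H.conjExp γ s * g ∈ A ∧ H.conjExp γ s * g ∈ B) := fun h => by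
            have : H.conjExp γ s * g ∈ A ∩ B := h
            rw [hAB'] at this
            exact this
          simp only [Set.mem_compl_iff, Set.mem_preimage]
          rw [Set.mem_union] at hmem
          tauto
        rw [this]
        exact hB.isClosed.preimage hf
      rcases isClopen_iff.1 hcl with h | h
      · have h0 : (0 : ℂ × ℂ) ∈ (fun s => H.conjExp γ s * g) ⁻¹' A := by
          simpa [conjExp_zero] using hg
        rw [h] at h0
        exact absurd h0 (Set.notMem_empty _)
      · have : s ∈ (fun s => H.conjExp γ s * g) ⁻¹' A := by rw [h]; trivial
        exact this
    have hA1 := hstable A B hA hB hAB hAB'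
    have hB1 := hstable B A hB hA (by rw [Set.union_comm, hAB]) (by rw [Set.inter_comm, hAB'])
    have hG : ∀ g, g ∈ H.mumfordTate ↔ g ∈ A ∨ g ∈ B := fun g => by
      rw [← SetLike.mem_coe, ← hAB]; rfl
    have hdis : ∀ g, g ∈ A → g ∈ B → False := fun g ha hb => by
      have : g ∈ A ∩ B := ⟨ha, hb⟩
      rw [hAB'] at this
      exact this
    let K : Subgroup (GLC V) :=
      { carrier := {g | g ∈ H.mumfordTate ∧ (∀ a ∈ A, g * a ∈ A) ∧ ∀ b ∈ B, g * b ∈ B}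
        one_mem' := ⟨one_mem _, fun a ha => by rwa [one_mul], fun a ha => by rwa [one_mul]⟩
        mul_mem' := fun {x y} hx hy => ⟨mul_mem hx.1 hy.1,
          fun a ha => by rw [mul_assoc]; exact hx.2.1 _ (hy.2.1 a ha),
          fun a ha => by rw [mul_assoc]; exact hx.2.2 _ (hy.2.2 a ha)⟩
        -- If `g⁻¹` moved a point into the other piece, `g` would have to bring it back, against
        -- stability of that piece.
        inv_mem' := fun {g} hg => by
          refine ⟨inv_mem hg.1, fun a ha => ?_, fun b hb => ?_⟩
          · rcases (hG _).1 (mul_mem (inv_mem hg.1) ((hG a).2 (Or.inl ha))) with h | h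
            · exact h
            · have := hg.2.2 _ h
              rw [mul_inv_cancel_left] at this
              exact absurd this fun h' => hdis a ha h'
          · rcases (hG _).1 (mul_mem (inv_mem hg.1) ((hG b).2 (Or.inr hb))) with h | h
            · have := hg.2.1 _ h
              rw [mul_inv_cancel_left] at this
              exact absurd hb fun h' => hdis b this h'
            · exact h }
    -- The equations are those of `Z` composed with right translation by each of its points.
    have htrans : ∀ Z : Set (GLC V), IsZariskiClosed ℂ Z →
        IsZariskiClosed ℂ {g : GLC V | ∀ a ∈ Z, g * a ∈ Z} := by
      rintro Z ⟨S, hS, hZ⟩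
      refine ⟨{F | ∃ a ∈ Z, ∃ F' ∈ S, F = fun g => F' (g * a)}, ?_, ?_⟩
      · rintro _ ⟨a, -, F, hF, rfl⟩
        exact polyFunctions_mul_right (hS hF) a
      · ext g
        constructor
        · rintro hg _ ⟨a, ha, F, hF, rfl⟩
          have := hg a ha
          rw [hZ] at this
          exact this F hF
        · intro hg a ha
          rw [hZ]
          intro F hF
          exact hg _ ⟨a, ha, F, hF, rfl⟩
    have hK : IsZariskiClosed ℂ (K : Set (GLC V)) :=
      H.mumfordTate_isZariskiClosed.complex.inter ((htrans A hA).inter (htrans B hB))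
    have hle : H.mumfordTate ≤ K := by
      refine H.mumfordTate_le_of_conjugates hK fun γ z => ?_
      obtain ⟨s, hs⟩ := H.gamGL_h_eq_conjExp γ z
      rw [hs]
      exact ⟨H.conjExp_mem γ s, hA1 γ s, hB1 γ s⟩
    rw [Set.eq_empty_iff_forall_notMem]
    intro b hb
    have := (hle ((hG b).2 (Or.inr hb))).2.1 1 h1
    rw [mul_one] at this
    exact hdis b this hb
  intro A B hA hB hAB hAB'
  have h1 : (1 : GLC V) ∈ A ∪ B := by rw [hAB]; exact one_mem H.mumfordTate
  rcases h1 with h1 | h1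
  · exact Or.inr (key A B hA hB hAB hAB' h1)
  · exact Or.inl (key B A hB hA (by rw [Set.union_comm, hAB]) (by rw [Set.inter_comm, hAB']) h1)

end RationalHodgeStructure

end HodgeMT

namespace HodgeMT

namespace RationalHodgeStructure

open Topology
open scoped Matrix Matrix.Norms.Elementwise

variable {V : Type*} [AddCommGroup V] [Module ℚ V] (H : RationalHodgeStructure V)

/-! ### The twisted complex conjugation -/

theorem conjGL_weilOperator : conjGL H.weilOperator = H.weilOperator := by
  rw [weilOperator, conjGL_h]
  congr 2
  apply Units.ext
  simp

/-- The conjugation `g ↦ C ḡ C⁻¹` of `GL(V_ℂ)` twisted by the Weil operator. -/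
def twist : GLC V →* GLC V :=
  (MulAut.conj H.weilOperator).toMonoidHom.comp (conjGL (V := V)).toMonoidHom

theorem twist_apply (g : GLC V) :
    H.twist g = H.weilOperator * conjGL g * H.weilOperator⁻¹ := rfl

/-- On `V^{p,q}` both sides are `(-1) ^ (q - p) = (-1) ^ (p + q)`. Thus `C²` is central in `G` and
trivial modulo weights. -/
theorem weilOperator_mul_self : H.weilOperator * H.weilOperator = H.weightHom (-1) := by
  apply Units.ext
  rw [Units.val_mul, weilOperator_eq_diag, weightHom_eq_diag, ← diag_mul]
  congr 1
  ext pq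
  rw [Pi.mul_apply, ← mul_zpow, Complex.I_mul_I, Units.val_zpow_eq_zpow_val, Units.val_neg,
    Units.val_one]
  have h1 : pq.1 + pq.2 = (pq.2 - pq.1) + 2 * pq.1 := by ring
  rw [h1, zpow_add₀ (by norm_num), zpow_mul]
  norm_num

theorem conjGL_weightHom (a : ℂˣ) :
    conjGL (H.weightHom a) = H.weightHom (Units.map (starRingEnd ℂ : ℂ →* ℂ) a) := by
  change conjGL (H.h (a⁻¹, a⁻¹)) = H.h (_, _)
  rw [conjGL_h]
  simp only [map_inv]

theorem weilOperator_mul_weightHom (a : ℂˣ) :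
    H.weilOperator * H.weightHom a = H.weightHom a * H.weilOperator := by
  change H.h _ * H.h _ = H.h _ * H.h _
  rw [← map_mul, mul_comm, map_mul]

theorem twist_weightHom (a : ℂˣ) :
    H.twist (H.weightHom a) = H.weightHom (Units.map (starRingEnd ℂ : ℂ →* ℂ) a) := by
  rw [twist_apply, conjGL_weightHom, weilOperator_mul_weightHom, mul_inv_cancel_right]

theorem twist_mem {g : GLC V} (hg : g ∈ H.mumfordTate) : H.twist g ∈ H.mumfordTate :=
  mul_mem (mul_mem (H.h_mem_mumfordTate _) (H.conjGL_mem_mumfordTate hg))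
    (inv_mem (H.h_mem_mumfordTate _))

theorem weightHom_mul_weightProj (a : ℂˣ) (m : ℤ) :
    (H.weightHom a).1 * H.weightProj m = ((a ^ m : ℂˣ) : ℂ) • H.weightProj m := by
  rw [weightHom_eq_diag, weightProj, ← diag_mul, ← diag_smul]
  congr 1
  ext pq
  simp only [Pi.mul_apply, Pi.smul_apply, smul_eq_mul]
  split_ifs with h
  · rw [h]
  · simp

section Finite

variable [Module.Finite ℚ V]

/-- As `C` is real, the square of the twist is conjugation by `C²`, which is the central element
`w_h(-1)`. -/
theorem twist_twist {g : GLC V} (hg : g ∈ H.mumfordTate) : H.twist (H.twist g) = g := by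
  have h1 := H.weightHom_comm hg (-1)
  rw [← weilOperator_mul_self] at h1
  simp only [twist_apply, map_mul, map_inv, conjGL_weilOperator, conjGL_conjGL]
  rw [mul_inv_eq_iff_eq_mul, ← mul_assoc, ← mul_assoc, mul_inv_eq_iff_eq_mul,
    mul_inv_cancel_right, h1, mul_assoc]

theorem commute_weightProj {g : GLC V} (hg : g ∈ H.mumfordTate) (m : ℤ) :
    Commute g.1 (H.weightProj m) := by
  refine H.linearMap_ext fun pq x hx => ?_
  have hx' := H.piece_le_weightC _ hx
  rw [Module.End.mul_apply, Module.End.mul_apply, H.weightProj_of_mem m hx',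
    H.weightProj_of_mem m (H.mumfordTate_apply_mem_weightC hg hx')]
  split_ifs <;> simp

/-- The elements of the Mumford–Tate group of determinant one on all the `V_m`. -/
def specialMT : Subgroup (GLC V) where
  carrier := {g | g ∈ H.mumfordTate ∧ ∀ m, H.weightDet m g.1 = 1}
  one_mem' := ⟨one_mem _, fun m => H.weightDet_one m⟩
  mul_mem' {a b} ha hb := ⟨mul_mem ha.1 hb.1, fun m => by
    rw [Units.val_mul, H.weightDet_mul m (H.commute_weightProj hb.1 m), ha.2, hb.2, one_mul]⟩
  inv_mem' {a} ha := ⟨inv_mem ha.1, fun m => by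
    have := H.weightDet_mul m (f := (a⁻¹).1) (H.commute_weightProj ha.1 m)
    rw [← Units.val_mul, inv_mul_cancel, Units.val_one, weightDet_one, ha.2, mul_one] at this
    exact this.symm⟩

/-- The special elements of the real form of the Mumford–Tate group defined by the twisted
conjugation. -/
def compactForm : Subgroup (GLC V) where
  carrier := {g | g ∈ H.specialMT ∧ H.twist g = g}
  one_mem' := ⟨one_mem _, map_one _⟩
  mul_mem' {a b} ha hb := ⟨mul_mem ha.1 hb.1, by rw [map_mul, ha.2, hb.2]⟩
  inv_mem' {a} ha := ⟨inv_mem ha.1, by rw [map_inv, ha.2]⟩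

theorem continuous_weightDet (m : ℤ) : Continuous fun g : GLC V => H.weightDet m g.1 := by
  have h : ∀ g : GLC V, H.weightDet m g.1 =
      (mat g.1 * mat (H.weightProj m) + mat (1 - H.weightProj m)).det := by
    intro g
    rw [weightDet, ← det_mat, map_add, map_mul]
  simp only [h]
  exact ((continuous_mat.mul continuous_const).add continuous_const).matrix_det

theorem isClosed_specialMT : IsClosed (H.specialMT : Set (GLC V)) := by
  have : (H.specialMT : Set (GLC V)) = (H.mumfordTate : Set (GLC V)) ∩
      ⋂ m, {g : GLC V | H.weightDet m g.1 = 1} := by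
    ext g
    simp only [Set.mem_inter_iff, Set.mem_iInter]
    rfl
  rw [this]
  exact H.mumfordTate_isZariskiClosed.complex.isClosed.inter
    (isClosed_iInter fun m => isClosed_eq (H.continuous_weightDet m) continuous_const)

theorem continuous_conjGL : Continuous (conjGL : GLC V → GLC V) := by
  have h : Continuous fun g : GLC V => mat (conjGL g).1 := by
    simp only [conjGL_eq_gamGL, gamGL_val, mat_gamEnd]
    exact continuous_mat.matrix_map Complex.continuous_conj
  rw [continuous_glc_iff]
  refine ⟨h, ?_⟩
  simp only [← map_inv]
  exact h.comp continuous_inv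

theorem continuous_twist : Continuous H.twist :=
  (continuous_const.mul continuous_conjGL).mul continuous_const

theorem isClosed_compactForm : IsClosed (H.compactForm : Set (GLC V)) :=
  H.isClosed_specialMT.inter (isClosed_eq H.continuous_twist continuous_id)

/-- Multiplying `g` by `w_h(z)` scales the two norms by inverse factors. The product therefore
descends to a continuous function on the quotient, bounded on the compact set supplied by (SV2*). -/
theorem exists_bound_of_sv2Star (hH : H.SV2Star) (m : ℤ) : ∃ c : ℝ, ∀ g ∈ H.compactForm,
    ‖mat (g.1 * H.weightProj m)‖ * ‖mat ((g⁻¹).1 * H.weightProj m)‖ ≤ c := by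
  let F : H.mumfordTate → ℝ := fun g =>
    ‖mat (g.1.1 * H.weightProj m)‖ * ‖mat ((g.1⁻¹).1 * H.weightProj m)‖
  have hFc : Continuous F := by
    simp only [F, map_mul]
    have h1 : Continuous fun g : H.mumfordTate => mat g.1.1 :=
      continuous_mat.comp continuous_subtype_val
    have h2 : Continuous fun g : H.mumfordTate => mat (g.1⁻¹).1 :=
      continuous_mat_inv.comp continuous_subtype_val
    exact (h1.mul continuous_const).norm.mul (h2.mul continuous_const).norm
  have hinv : ∀ a b : H.mumfordTate, (QuotientGroup.leftRel H.weightSubgroup) a b → F a = F b := by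
    intro a b hab
    rw [QuotientGroup.leftRel_apply, weightSubgroup, Subgroup.mem_subgroupOf] at hab
    obtain ⟨z, hz⟩ := hab
    have hb : b.1 = H.weightHom z * a.1 := by
      rw [H.weightHom_comm a.2, hz]
      simp
    have hb' : b.1⁻¹ = H.weightHom z⁻¹ * a.1⁻¹ := by
      rw [H.weightHom_comm (inv_mem a.2), hb, mul_inv_rev, map_inv]
    have e : ∀ (z : ℂˣ) (g : GLC V), g ∈ H.mumfordTate →
        (H.weightHom z * g).1 * H.weightProj m = ((z ^ m : ℂˣ) : ℂ) • (g.1 * H.weightProj m) := by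
      intro z g hg
      rw [H.weightHom_comm hg, Units.val_mul, mul_assoc, weightHom_mul_weightProj, mul_smul_comm]
    simp only [F, hb, e z a.1 a.2]
    rw [← hb, hb', e _ _ (inv_mem a.2), map_smul, map_smul, norm_smul, norm_smul, inv_zpow,
      Units.val_inv_eq_inv_val, norm_inv]
    have : ‖((z ^ m : ℂˣ) : ℂ)‖ ≠ 0 := norm_ne_zero_iff.2 (Units.ne_zero _)
    field_simp
  let F' : H.MTModWeight → ℝ := Quotient.lift F hinv
  have hF'c : Continuous F' := hFc.quotient_lift hinv
  obtain ⟨c, hc⟩ := (hH.2.2.image hF'c).bddAbove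
  refine ⟨c, fun g hg => ?_⟩
  refine hc ⟨QuotientGroup.mk (⟨g, hg.1.1⟩ : H.mumfordTate), ?_, rfl⟩
  have h1 : (⟨g, hg.1.1⟩ : H.mumfordTate) = MulAut.conj
      (⟨H.weilOperator, H.h_mem_mumfordTate _⟩ : H.mumfordTate) (H.mtConj ⟨g, hg.1.1⟩) := by
    apply Subtype.ext
    exact hg.2.symm
  exact congrArg (QuotientGroup.mk (s := H.weightSubgroup)) h1

/-- The determinant condition keeps the part of `g` on each `V_m` away from zero, so the bound on
the product of norms becomes a bound on `g⁻¹`; passing to inverses in the group bounds `g`. -/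
theorem isCompact_compactForm (hH : H.SV2Star) : IsCompact (H.compactForm : Set (GLC V)) := by
  have hlow : ∀ m ∈ H.weights, ∃ ε > 0, ∀ g ∈ H.compactForm,
      ε ≤ ‖mat (g.1 * H.weightProj m)‖ := by
    intro m hm
    -- This continuous function is `0` at the zero matrix, because `m` is a weight, and `1` at the
    -- part of `g` of weight `m`.
    let D : Mat V → ℂ := fun M => (M + mat (1 - H.weightProj m)).det
    have hD : Continuous D := (continuous_id.add continuous_const).matrix_det
    have hD0 : D 0 = 0 := by
      simp only [D, zero_add, det_mat]
      by_contra hne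
      have hu : IsUnit (1 - H.weightProj m) := by
        rw [LinearMap.isUnit_iff_isUnit_det]
        exact isUnit_iff_ne_zero.2 hne
      have h0 : (1 - H.weightProj m) * H.weightProj m = 0 := by
        rw [sub_mul, one_mul, weightProj_mul_self, sub_self]
      exact H.weightProj_ne_zero hm (hu.mul_right_eq_zero.1 h0)
    obtain ⟨ε, hε, h⟩ := Metric.continuousAt_iff.1 (hD.continuousAt (x := (0 : Mat V))) 1 one_pos
    refine ⟨ε, hε, fun g hg => ?_⟩
    by_contra hlt
    push Not at hlt
    have h1 := h (x := mat (g.1 * H.weightProj m)) (by rwa [dist_zero_right])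
    have h2 : D (mat (g.1 * H.weightProj m)) = 1 := by
      have := hg.1.2 m
      rw [weightDet, ← det_mat, map_add] at this
      exact this
    rw [h2, hD0] at h1
    simp at h1
  choose! ε hε hlow using hlow
  choose c hc using H.exists_bound_of_sv2Star hH
  have hbound : ∀ g ∈ H.compactForm, ‖mat (g⁻¹).1‖ ≤ ∑ m ∈ H.weights, c m / ε m := by
    intro g hg
    have h1 : mat (g⁻¹).1 = ∑ m ∈ H.weights, mat ((g⁻¹).1 * H.weightProj m) := by
      rw [← map_sum, ← Finset.mul_sum, sum_weightProj, mul_one]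
    rw [h1]
    refine (norm_sum_le _ _).trans (Finset.sum_le_sum fun m hm => ?_)
    rw [le_div_iff₀ (hε m hm)]
    refine le_trans ?_ (hc m g hg)
    rw [mul_comm]
    exact mul_le_mul_of_nonneg_right (hlow m hm g hg) (norm_nonneg _)
  refine isCompact_of_bounded H.isClosed_compactForm (∑ m ∈ H.weights, c m / ε m)
    (fun g hg i j => ?_) (fun g hg i j => ?_)
  · have := hbound g⁻¹ (inv_mem hg)
    rw [inv_inv] at this
    exact (Matrix.norm_entry_le_entrywise_sup_norm _).trans this
  · exact (Matrix.norm_entry_le_entrywise_sup_norm _).trans (hbound g hg)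

end Finite

end RationalHodgeStructure

end HodgeMT

namespace HodgeMT

namespace RationalHodgeStructure

open Topology Filter
open scoped Matrix Matrix.Norms.Operator ComplexOrder

variable {V : Type*} [AddCommGroup V] [Module ℚ V] [Module.Finite ℚ V]
  (H : RationalHodgeStructure V)

/-! ### The infinitesimal generators of `h` -/

/-- The operator that is multiplication by `q - p` on `V^{p,q}`. -/
def hodgeOp : Module.End ℂ (Cx V) := H.diag fun pq => (pq.2 : ℂ) - pq.1

/-- The twisted conjugation on matrices. -/
def twistMat : Mat V →+* Mat V where
  toFun M := mat H.weilOperator.1 * M.map (starRingEnd ℂ) * mat (H.weilOperator⁻¹).1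
  map_one' := by
    rw [Matrix.map_one _ (map_zero _) (map_one _), mul_one, ← map_mul, ← Units.val_mul,
      mul_inv_cancel, Units.val_one, map_one]
  map_zero' := by simp
  map_mul' M N := by
    have h : mat (H.weilOperator⁻¹).1 * mat H.weilOperator.1 = 1 := by
      rw [← map_mul, ← Units.val_mul, inv_mul_cancel, Units.val_one, map_one]
    rw [Matrix.map_mul]
    simp only [mul_assoc]
    rw [← mul_assoc (mat (H.weilOperator⁻¹).1), h, one_mul]
  map_add' M N := by
    rw [Matrix.map_add _ (map_add _), mul_add, add_mul]

theorem twistMat_apply (M : Mat V) :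
    H.twistMat M = mat H.weilOperator.1 * M.map (starRingEnd ℂ) * mat (H.weilOperator⁻¹).1 := rfl

theorem mat_twist (g : GLC V) : mat (H.twist g).1 = H.twistMat (mat g.1) := by
  rw [twist_apply, Units.val_mul, Units.val_mul, map_mul, map_mul, conjGL_eq_gamGL, gamGL_val,
    mat_gamEnd]
  rfl

theorem twistMat_smul (a : ℂ) (M : Mat V) :
    H.twistMat (a • M) = starRingEnd ℂ a • H.twistMat M := by
  have : (a • M).map (starRingEnd ℂ) = starRingEnd ℂ a • M.map (starRingEnd ℂ) := by
    ext i j; simp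
  rw [twistMat_apply, this, mul_smul_comm, smul_mul_assoc]
  rfl

theorem twistMat_real_smul (a : ℝ) (M : Mat V) : H.twistMat (a • M) = a • H.twistMat M := by
  have h := H.twistMat_smul (a : ℂ) M
  rw [Complex.conj_ofReal, Complex.coe_smul, Complex.coe_smul] at h
  exact h

theorem continuous_twistMat : Continuous H.twistMat :=
  (continuous_const.mul (continuous_id.matrix_map Complex.continuous_conj)).mul continuous_const

/-- The twisted conjugation on matrices as a real continuous linear map. -/
def twistMatCLM : Mat V →L[ℝ] Mat V :=
  { toFun := H.twistMat
    map_add' := map_add _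
    map_smul' := H.twistMat_real_smul
    cont := H.continuous_twistMat }

/-- The operator `C²` is a combination of weight projections; these are fixed by `γ` and commute
with the unconjugated operator. -/
theorem commute_gamEnd_hodgeOp_weilOperator_sq (γ : ℂ ≃+* ℂ) :
    Commute (gamEnd γ H.hodgeOp) (H.weilOperator * H.weilOperator).1 := by
  rw [weilOperator_mul_self]
  have h1 : (H.weightHom (-1)).1 = ∑ m ∈ H.weights, (((-1) ^ m : ℂˣ) : ℂ) • H.weightProj m := by
    rw [← mul_one (H.weightHom (-1)).1, ← sum_weightProj, Finset.mul_sum]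
    exact Finset.sum_congr rfl fun m _ => H.weightHom_mul_weightProj _ _
  rw [h1]
  refine Commute.sum_right _ _ _ fun m _ => Commute.smul_right ?_ _
  rw [← H.gamEnd_weightProj γ m]
  exact (H.commute_diag_weightProj _ m).map (gamEnd γ)

/-- As on the group, the square of the twist is conjugation by `C²`, with which this operator
commutes. -/
theorem twistMat_twistMat_hodgeOp (γ : ℂ ≃+* ℂ) :
    H.twistMat (H.twistMat (mat (gamEnd γ H.hodgeOp))) = mat (gamEnd γ H.hodgeOp) := by
  have hC : (mat H.weilOperator.1).map (starRingEnd ℂ) = mat H.weilOperator.1 := by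
    have := congrArg (fun g : GLC V => mat g.1) H.conjGL_weilOperator
    simp only [conjGL_eq_gamGL, gamGL_val, mat_gamEnd] at this
    exact this
  have hC' : (mat (H.weilOperator⁻¹).1).map (starRingEnd ℂ) = mat (H.weilOperator⁻¹).1 := by
    have := congrArg (fun g : GLC V => mat (g⁻¹).1) H.conjGL_weilOperator
    simp only [← map_inv, conjGL_eq_gamGL, gamGL_val, mat_gamEnd] at this
    exact this
  have h := congrArg mat (H.commute_gamEnd_hodgeOp_weilOperator_sq γ).eq
  simp only [Units.val_mul, map_mul] at h
  have h1 : mat H.weilOperator.1 * mat (H.weilOperator⁻¹).1 = 1 := by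
    rw [← map_mul, ← Units.val_mul, mul_inv_cancel, Units.val_one, map_one]
  rw [twistMat_apply, twistMat_apply, Matrix.map_mul, Matrix.map_mul, hC, hC', Matrix.map_map]
  have h2 : (mat (gamEnd γ H.hodgeOp)).map (starRingEnd ℂ ∘ starRingEnd ℂ) =
      mat (gamEnd γ H.hodgeOp) := by
    ext i j; simp
  rw [h2]
  set X := mat (gamEnd γ H.hodgeOp)
  set c := mat H.weilOperator.1
  set d := mat (H.weilOperator⁻¹).1
  calc c * (c * X * d) * d = (c * c * X) * (d * d) := by simp only [mul_assoc]
    _ = X * (c * c) * (d * d) := by rw [h]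
    _ = X * (c * (c * d) * d) := by simp only [mul_assoc]
    _ = X := by rw [h1, mul_one, h1, mul_one]

theorem hasDerivAt_conjExp (γ : ℂ ≃+* ℂ) (a : ℂ) :
    HasDerivAt (fun s : ℝ => mat (H.conjExp γ (s * a, -(s * a))).1)
      (a • mat (gamEnd γ H.hodgeOp)) 0 := by
  have h1 : a • mat (gamEnd γ H.hodgeOp) = ∑ pq ∈ H.support,
      (a * (pq.2 - pq.1)) • mat (gamEnd γ (H.diag (Pi.single pq 1))) := by
    rw [hodgeOp, diag_eq_sum, map_sum, map_sum, Finset.smul_sum]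
    refine Finset.sum_congr rfl fun pq _ => ?_
    rw [gamEnd_smul, map_smul, smul_smul, map_sub, map_intCast, map_intCast]
  simp only [conjExp_val, map_sum, map_smul]
  rw [h1]
  refine HasDerivAt.fun_sum fun pq _ => ?_
  refine HasDerivAt.smul_const ?_ _
  have h2 : HasDerivAt (fun s : ℂ => Complex.exp (-(pq.1 * (s * a) + pq.2 * (-(s * a)))))
      (a * (pq.2 - pq.1)) ((0 : ℝ) : ℂ) := by
    have h3 : HasDerivAt (fun s : ℂ => s * (a * (pq.2 - pq.1)))
        (a * (pq.2 - pq.1)) ((0 : ℝ) : ℂ) := by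
      simpa using (hasDerivAt_id ((0 : ℝ) : ℂ)).mul_const (a * ((pq.2 : ℂ) - pq.1))
    have h4 := h3.cexp
    rw [Complex.ofReal_zero, zero_mul, Complex.exp_zero, one_mul] at h4
    rw [Complex.ofReal_zero]
    refine h4.congr_of_eventuallyEq (Eventually.of_forall fun s => ?_)
    change Complex.exp _ = Complex.exp _
    congr 1
    ring
  exact h2.comp_ofReal

/-- The antidiagonal direction is the one on which the determinants on the `V_m` are trivial;
conjugation by `γ` preserves the value one. -/
theorem conjExp_mem_specialMT (γ : ℂ ≃+* ℂ) (a : ℂ) : H.conjExp γ (a, -a) ∈ H.specialMT := by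
  refine ⟨H.conjExp_mem γ _, fun m => ?_⟩
  rw [conjExp, gamGL_val, weightDet_gamEnd, expUnit_neg, map_inv, weightDet_h, map_one]

theorem twist_mem_specialMT {g : GLC V} (hg : g ∈ H.specialMT) : H.twist g ∈ H.specialMT := by
  refine ⟨H.twist_mem hg.1, fun m => ?_⟩
  have hC := H.commute_weightProj (H.h_mem_mumfordTate _) m (g := H.weilOperator)
  have hC' := H.commute_weightProj (inv_mem (H.h_mem_mumfordTate _)) m (g := H.weilOperator⁻¹)
  have h1 : H.weightDet m H.weilOperator.1 * H.weightDet m (H.weilOperator⁻¹).1 = 1 := by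
    rw [← H.weightDet_mul m hC', ← Units.val_mul, mul_inv_cancel, Units.val_one, weightDet_one]
  rw [twist_apply, Units.val_mul, H.weightDet_mul m hC', Units.val_mul,
    H.weightDet_mul m (H.commute_weightProj (H.conjGL_mem_mumfordTate hg.1) m), conjGL_eq_gamGL,
    gamGL_val, weightDet_gamEnd, hg.2, map_one, mul_one, h1]

/-- The one-parameter groups of the compact form. -/
theorem exp_mem_compactForm (γ : ℂ ≃+* ℂ) (a : ℂ) (t : ℝ) : ∃ g ∈ H.compactForm,
    mat g.1 = NormedSpace.exp (t • (a • mat (gamEnd γ H.hodgeOp) +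
      H.twistMat (a • mat (gamEnd γ H.hodgeOp)))) := by
  -- For `V = 0` the matrix algebra does not satisfy `‖1‖ = 1`, which the limit lemma needs.
  rcases isEmpty_or_nonempty (Fin (Module.finrank ℚ V)) with hE | hE
  · exact ⟨1, one_mem _, Subsingleton.elim _ _⟩
  let _ : NormedAlgebra ℚ (Mat V) := NormedAlgebra.restrictScalars ℚ ℝ (Mat V)
  set Y := a • mat (gamEnd γ H.hodgeOp) with hY
  let c : ℝ → GLC V := fun s => H.conjExp γ (s * a, -(s * a))
  -- This curve stays in the closed special group and has velocity `Y + τ(Y)`. The powers of its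
  -- points need not be fixed by `τ`, but their limit `exp (t (Y + τ(Y)))` is.
  let u : ℝ → GLC V := fun s => c s * H.twist (c s)
  have hu : HasDerivAt (fun s => mat (u s).1) (Y + H.twistMat Y) 0 := by
    have h1 := H.hasDerivAt_conjExp γ a
    have h2 := H.twistMatCLM.hasFDerivAt.comp_hasDerivAt 0 h1
    have h3 := h1.mul h2
    have h0 : mat (H.conjExp γ (((0 : ℝ) : ℂ) * a, -(((0 : ℝ) : ℂ) * a))).1 = 1 := by
      rw [Complex.ofReal_zero, zero_mul, neg_zero]
      exact (congrArg (fun g : GLC V => mat g.1) (H.conjExp_zero γ)).trans (map_one _)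
    have h4 : H.twistMatCLM 1 = 1 := map_one H.twistMat
    simp only [Function.comp_def, h0, h4, mul_one, one_mul] at h3
    have h5 : (fun s => mat (u s).1) = (fun s : ℝ => mat (H.conjExp γ (s * a, -(s * a))).1) *
        fun s : ℝ => H.twistMatCLM (mat (H.conjExp γ (s * a, -(s * a))).1) := by
      ext1 s
      change mat (c s * H.twist (c s)).1 = _
      rw [Units.val_mul, map_mul, mat_twist]
      rfl
    rw [h5]
    exact h3
  have hu0 : mat (u 0).1 = 1 := by
    have : c 0 = 1 := by
      change H.conjExp γ (((0 : ℝ) : ℂ) * a, -(((0 : ℝ) : ℂ) * a)) = 1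
      rw [Complex.ofReal_zero, zero_mul, neg_zero]
      exact H.conjExp_zero γ
    change mat (c 0 * H.twist (c 0)).1 = 1
    rw [this, map_one, one_mul, Units.val_one, map_one]
  have hlim := tendsto_pow_exp_of_hasDerivAt hu0 hu t
  have hunit : IsUnit (NormedSpace.exp (t • (Y + H.twistMat Y))) := NormedSpace.isUnit_exp _
  obtain ⟨e, he⟩ := hunit
  have hmem : ∀ n : ℕ, u (t / n) ^ n ∈ H.specialMT := fun n =>
    pow_mem (mul_mem (H.conjExp_mem_specialMT γ _)
      (H.twist_mem_specialMT (H.conjExp_mem_specialMT γ _))) n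
  have htend : Tendsto (fun n : ℕ => u (t / n) ^ n) atTop (𝓝 (matUnits.symm e)) := by
    rw [isInducing_matUnits.tendsto_nhds_iff, MulEquiv.apply_symm_apply]
    refine (Units.isOpenEmbedding_val (R := Mat V)).isInducing.tendsto_nhds_iff.2 ?_
    rw [he]
    refine hlim.congr fun n => ?_
    simp only [Function.comp_def, matUnits_val, Units.val_pow_eq_pow_val, map_pow]
  have hval : mat (matUnits.symm e : GLC V).1 = NormedSpace.exp (t • (Y + H.twistMat Y)) := by
    rw [← matUnits_val, MulEquiv.apply_symm_apply, he]
  refine ⟨matUnits.symm e, ⟨H.isClosed_specialMT.mem_of_tendsto htend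
    (Eventually.of_forall hmem), ?_⟩, hval⟩
  apply Units.ext
  apply mat.injective
  rw [mat_twist, hval]
  refine (NormedSpace.map_exp (𝔸 := Mat V) (𝔹 := Mat V) H.twistMat H.continuous_twistMat _).trans ?_
  rw [twistMat_real_smul, map_add]
  congr 2
  have : H.twistMat (H.twistMat Y) = Y := by
    rw [hY, twistMat_smul, twistMat_smul, Complex.conj_conj, twistMat_twistMat_hodgeOp]
  rw [this, add_comm]

/-- If the twisted real form is compact modulo the weights, then there is a positive definite form
for which the twisted conjugation is minus the adjoint on the infinitesimal generators. -/
theorem exists_invariant_matrix (hH : H.SV2Star) : ∃ P : Mat V,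
    (∀ x, x ≠ 0 → 0 < star x ⬝ᵥ (P *ᵥ x)) ∧ ∀ γ : ℂ ≃+* ℂ,
      (H.twistMat (mat (gamEnd γ H.hodgeOp)))ᴴ * P + P * mat (gamEnd γ H.hodgeOp) = 0 := by
  obtain ⟨P, hP, hinv⟩ := exists_posDef_invariant (H.compactForm.map matUnits.toMonoidHom) (by
    have := (H.isCompact_compactForm hH).image matHomeo.continuous
    exact this)
  refine ⟨P, hP, fun γ => ?_⟩
  set X := mat (gamEnd γ H.hodgeOp)
  have hskew : ∀ a : ℂ, (a • X + H.twistMat (a • X))ᴴ * P + P * (a • X + H.twistMat (a • X)) = 0 := by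
    intro a
    apply skew_of_exp_invariant
    intro t
    obtain ⟨g, hg, hgt⟩ := H.exp_mem_compactForm γ a t
    rw [← hgt]
    exact hinv (matUnits g) ⟨g, hg, rfl⟩
  -- Since `τ` is conjugate-linear, `a = 1` and `a = i` give `X + τ(X)` and `i(X - τ(X))`; combining
  -- the two relations isolates the one wanted.
  have h1 := hskew 1
  have h2 := hskew Complex.I
  rw [twistMat_smul, map_one, one_smul, one_smul] at h1
  rw [twistMat_smul, Complex.conj_I] at h2
  have h3 := congrArg (fun M => Complex.I • M) h2
  simp only [Matrix.conjTranspose_add, Matrix.conjTranspose_smul, add_mul, mul_add, smul_add,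
    smul_mul_assoc, mul_smul_comm, smul_smul, RCLike.star_def, Complex.conj_I, mul_neg, neg_mul, smul_neg,
    neg_smul, Matrix.conjTranspose_neg, Complex.I_mul_I, neg_neg, one_smul, smul_zero] at h1 h3
  have h4 : (2 : ℂ) • ((H.twistMat X)ᴴ * P + P * X) = 0 := by
    have := sub_eq_zero.2 (h1.trans h3.symm)
    rw [← this, two_smul]
    abel
  exact (smul_eq_zero.1 h4).resolve_left two_ne_zero

end RationalHodgeStructure

end HodgeMT

namespace HodgeMT

/-! ### Rational bilinear forms and rational approximation. -/

section RationalForms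

variable {V : Type*} [AddCommGroup V] [Module ℚ V]

/-- The complex bilinear extension of a rational bilinear form. -/
def bilinQ (b : V →ₗ[ℚ] V →ₗ[ℚ] ℚ) : Cx V →ₗ[ℂ] Cx V →ₗ[ℂ] ℂ :=
  bilinC (b.compr₂ (Algebra.linearMap ℚ ℂ))

@[simp] theorem bilinQ_tmul (b : V →ₗ[ℚ] V →ₗ[ℚ] ℚ) (z w : ℂ) (x y : V) :
    bilinQ b (z ⊗ₜ[ℚ] x) (w ⊗ₜ[ℚ] y) = z * (w * (b x y : ℂ)) := by
  simp [bilinQ]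

/-- Induction over pairs of elements of `V_ℂ`. -/
theorem tensor_induction₂ {V' : Type*} [AddCommGroup V'] [Module ℚ V'] {P : Cx V → Cx V' → Prop}
    (ht : ∀ z x w y, P (z ⊗ₜ[ℚ] x) (w ⊗ₜ[ℚ] y)) (h0 : ∀ y, P 0 y) (h0' : ∀ x, P x 0)
    (hadd : ∀ x x' y, P x y → P x' y → P (x + x') y)
    (hadd' : ∀ x y y', P x y → P x y' → P x (y + y')) (x : Cx V) (y : Cx V') : P x y := by
  induction x using TensorProduct.induction_on with
  | zero => exact h0 y
  | add x x' hx hx' => exact hadd _ _ _ hx hx'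
  | tmul z v =>
    induction y using TensorProduct.induction_on with
    | zero => exact h0' _
    | add y y' hy hy' => exact hadd' _ _ _ hy hy'
    | tmul w v' => exact ht _ _ _ _

theorem bilinQ_gam (γ : ℂ ≃+* ℂ) (b : V →ₗ[ℚ] V →ₗ[ℚ] ℚ) (x y : Cx V) :
    bilinQ b (gam γ x) (gam γ y) = γ (bilinQ b x y) := by
  refine tensor_induction₂ (P := fun x y => bilinQ b (gam γ x) (gam γ y) = γ (bilinQ b x y))
    ?_ ?_ ?_ ?_ ?_ x y
  · intro z x w y; simp
  · intro y; simp
  · intro x; simp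
  · intro x x' y h h'; simp only [map_add, LinearMap.add_apply, h, h']
  · intro x y y' h h'; simp only [map_add, h, h']

theorem bilinQ_conj (b : V →ₗ[ℚ] V →ₗ[ℚ] ℚ) (x y : Cx V) :
    bilinQ b (conj x) (conj y) = starRingEnd ℂ (bilinQ b x y) := by
  rw [conj_eq_gam, conj_eq_gam, bilinQ_gam]
  rfl

/-- The complex bilinear extension as a linear map to the space of functions. -/
def bilinQFun : (V →ₗ[ℚ] V →ₗ[ℚ] ℚ) →ₗ[ℚ] (Cx V → Cx V → ℂ) where
  toFun b x y := bilinQ b x y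
  map_add' b b' := by
    ext x y
    refine tensor_induction₂ (P := fun x y => bilinQ (b + b') x y = bilinQ b x y + bilinQ b' x y)
      ?_ ?_ ?_ ?_ ?_ x y
    · intro z x w y; simp; ring
    · intro y; simp
    · intro x; simp
    · intro x x' y h h'; simp only [map_add, LinearMap.add_apply, h, h']; ring
    · intro x y y' h h'; simp only [map_add, h, h']; ring
  map_smul' q b := by
    ext x y
    change bilinQ (q • b) x y = q • bilinQ b x y
    rw [Rat.smul_def]
    refine tensor_induction₂ (P := fun x y => bilinQ (q • b) x y = q * bilinQ b x y)
      ?_ ?_ ?_ ?_ ?_ x y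
    · intro z x w y; simp; ring
    · intro y; simp
    · intro x; simp
    · intro x x' y h h'; simp only [map_add, LinearMap.add_apply, h, h']; ring
    · intro x y y' h h'; simp only [map_add, h, h']; ring

theorem bilinQFun_apply (b : V →ₗ[ℚ] V →ₗ[ℚ] ℚ) (x y : Cx V) : bilinQFun b x y = bilinQ b x y := rfl

-- Products of two rational coordinate functions span the bilinear forms on `V_ℂ`; this is the input
-- for descent of forms.
open RationalHodgeStructure in
theorem mem_span_bilinQ [Module.Finite ℚ V] (B : Cx V →ₗ[ℂ] Cx V →ₗ[ℂ] ℂ) :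
    (fun x y => B x y) ∈
      Submodule.span ℂ ((LinearMap.range (bilinQFun (V := V)) : Submodule ℚ _) :
        Set (Cx V → Cx V → ℂ)) := by
  classical
  let e := Module.finBasis ℚ V
  let ε : Fin (Module.finrank ℚ V) → Fin (Module.finrank ℚ V) → V →ₗ[ℚ] V →ₗ[ℚ] ℚ := fun i j =>
    (LinearMap.mul ℚ ℚ).compl₁₂ (e.coord i) (e.coord j)
  have h1 : B = ∑ i, ∑ j, B (basisC V i) (basisC V j) • bilinQ (ε i j) := by
    refine (basisC V).ext fun k => (basisC V).ext fun l => ?_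
    have h2 : ∀ i j, bilinQ (ε i j) (basisC V k) (basisC V l) =
        (if k = i then 1 else 0) * (if l = j then 1 else 0) := by
      intro i j
      rw [basisC_apply, basisC_apply, bilinQ_tmul]
      simp only [ε, LinearMap.compl₁₂_apply, LinearMap.mul_apply', Module.Basis.coord_apply, e,
        Module.Basis.repr_self, Finsupp.single_apply, one_mul]
      split_ifs <;> simp
    simp only [LinearMap.sum_apply, LinearMap.smul_apply, h2, smul_eq_mul]
    simp
  have h3 : (fun x y => B x y) =
      ∑ i, ∑ j, B (basisC V i) (basisC V j) • bilinQFun (ε i j) := by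
    ext x y
    conv_lhs => rw [h1]
    simp only [Finset.sum_apply, Pi.smul_apply, LinearMap.sum_apply, LinearMap.smul_apply]
    rfl
  rw [h3]
  exact Submodule.sum_mem _ fun i _ => Submodule.sum_mem _ fun j _ =>
    Submodule.smul_mem _ _ (Submodule.subset_span ⟨_, rfl⟩)

/-- Positivity of a linear combination of quadratic functions on `ℝⁿ` persists for nearby
rational coefficients. -/
theorem exists_rat_combination_pos {ι n : Type*} [Fintype n] (s : Finset ι)
    (φ : ι → (n → ℝ) → ℝ) (hφ : ∀ i, Continuous (φ i))
    (hφ2 : ∀ i (a : ℝ) t, φ i (a • t) = a ^ 2 * φ i t) (r : ι → ℝ)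
    (hr : ∀ t, t ≠ 0 → 0 < ∑ i ∈ s, r i * φ i t) :
    ∃ q : ι → ℚ, ∀ t, t ≠ 0 → 0 < ∑ i ∈ s, (q i : ℝ) * φ i t := by
  let S : Set (n → ℝ) := Metric.sphere 0 1
  have hS : IsCompact S := isCompact_sphere _ _
  suffices h : ∃ q : ι → ℚ, ∀ t ∈ S, 0 < ∑ i ∈ s, (q i : ℝ) * φ i t by
    obtain ⟨q, hq⟩ := h
    refine ⟨q, fun t ht => ?_⟩
    have hn : 0 < ‖t‖ := norm_pos_iff.2 ht
    have h1 := hq (‖t‖⁻¹ • t) (by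
      rw [mem_sphere_zero_iff_norm, norm_smul, norm_inv, norm_norm, inv_mul_cancel₀ hn.ne'])
    simp only [hφ2] at h1
    have h2 : ∑ i ∈ s, (q i : ℝ) * (‖t‖⁻¹ ^ 2 * φ i t) =
        ‖t‖⁻¹ ^ 2 * ∑ i ∈ s, (q i : ℝ) * φ i t := by
      rw [Finset.mul_sum]
      exact Finset.sum_congr rfl fun i _ => by ring
    rw [h2] at h1
    exact pos_of_mul_pos_right h1 (by positivity)
  rcases S.eq_empty_or_nonempty with hE | hN
  · exact ⟨0, fun t ht => by rw [hE] at ht; exact ht.elim⟩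
  have hFc : Continuous fun t => ∑ i ∈ s, r i * φ i t :=
    continuous_finsetSum _ fun i _ => continuous_const.mul (hφ i)
  have hGc : Continuous fun t => ∑ i ∈ s, |φ i t| := continuous_finsetSum _ fun i _ => (hφ i).abs
  obtain ⟨t₀, ht₀, hmin⟩ := hS.exists_isMinOn hN hFc.continuousOn
  obtain ⟨t₁, ht₁, hmax⟩ := hS.exists_isMaxOn hN hGc.continuousOn
  have ht₀' : t₀ ≠ 0 := by
    rintro rfl
    rw [mem_sphere_zero_iff_norm] at ht₀
    simp at ht₀
  set δ := ∑ i ∈ s, r i * φ i t₀ with hδ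
  have hδ0 : 0 < δ := hr t₀ ht₀'
  set M := ∑ i ∈ s, |φ i t₁| with hM
  have hM0 : 0 ≤ M := Finset.sum_nonneg fun i _ => abs_nonneg _
  -- Coefficients perturbed by less than this change the sum on the sphere by less than its minimum
  -- `δ`; the `+ 1` covers `M = 0`.
  have hη : 0 < δ / (M + 1) := by positivity
  have hq : ∀ i, ∃ q : ℚ, |(q : ℝ) - r i| < δ / (M + 1) := by
    intro i
    obtain ⟨q, h1, h2⟩ := exists_rat_btwn (show r i < r i + δ / (M + 1) by linarith)
    exact ⟨q, by rw [abs_lt]; constructor <;> linarith⟩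
  choose q hq using hq
  refine ⟨q, fun t ht => ?_⟩
  have h1 : δ ≤ ∑ i ∈ s, r i * φ i t := hmin ht
  have h2 : ∑ i ∈ s, |φ i t| ≤ M := hmax ht
  have h3 : ∑ i ∈ s, (q i : ℝ) * φ i t =
      ∑ i ∈ s, r i * φ i t + ∑ i ∈ s, ((q i : ℝ) - r i) * φ i t := by
    rw [← Finset.sum_add_distrib]
    exact Finset.sum_congr rfl fun i _ => by ring
  have h4 : |∑ i ∈ s, ((q i : ℝ) - r i) * φ i t| ≤ δ / (M + 1) * M := by
    refine (Finset.abs_sum_le_sum_abs _ _).trans ?_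
    calc ∑ i ∈ s, |((q i : ℝ) - r i) * φ i t| ≤ ∑ i ∈ s, δ / (M + 1) * |φ i t| := by
          refine Finset.sum_le_sum fun i _ => ?_
          rw [abs_mul]
          exact mul_le_mul_of_nonneg_right (hq i).le (abs_nonneg _)
      _ = δ / (M + 1) * ∑ i ∈ s, |φ i t| := by rw [Finset.mul_sum]
      _ ≤ _ := mul_le_mul_of_nonneg_left h2 hη.le
  have h5 : δ / (M + 1) * M < δ := by
    rw [div_mul_eq_mul_div, div_lt_iff₀ (by positivity)]
    nlinarith
  rw [h3]
  have := (abs_le.1 h4).1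
  linarith

end RationalForms

/-! ### The complex form obtained from (SV2*). -/

namespace RationalHodgeStructure

open scoped Matrix ComplexOrder

variable {V : Type*} [AddCommGroup V] [Module ℚ V] (H : RationalHodgeStructure V)

theorem weightProj_conj (m : ℤ) (x : Cx V) :
    conj (H.weightProj m x) = H.weightProj m (conj x) := by
  rw [conj_eq_gam, conj_eq_gam, gam_weightProj]

theorem hodgeOp_conj_apply (γ : ℂ ≃+* ℂ) {pq : ℤ × ℤ} {x : Cx V} (hx : x ∈ H.piece pq) :
    gamEnd γ H.hodgeOp (gam γ x) = ((pq.2 : ℂ) - pq.1) • gam γ x := by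
  rw [gamEnd_apply, gam_symm_gam, hodgeOp, H.diag_apply _ hx, gam_smul]
  simp

variable [Module.Finite ℚ V]

theorem coord_conj (x : Cx V) : coord (conj x) = star (coord x) := by
  ext i
  rw [conj_eq_gam, coord, basisC_repr_gam]
  rfl

/-- The bilinear form on `V_ℂ` with a given matrix. -/
def matForm (P : Mat V) : Cx V →ₗ[ℂ] Cx V →ₗ[ℂ] ℂ :=
  LinearMap.mk₂ ℂ (fun x y => coord y ⬝ᵥ (P *ᵥ coord x))
    (fun x x' y => by
      have : coord (x + x') = coord x + coord x' := by ext i; simp [coord]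
      rw [this, Matrix.mulVec_add, dotProduct_add])
    (fun a x y => by
      have : coord (a • x) = a • coord x := by ext i; simp [coord]
      rw [this, Matrix.mulVec_smul, dotProduct_smul])
    (fun x y y' => by
      have : coord (y + y') = coord y + coord y' := by ext i; simp [coord]
      rw [this, add_dotProduct])
    (fun a x y => by
      have : coord (a • y) = a • coord y := by ext i; simp [coord]
      rw [this, smul_dotProduct])

theorem matForm_apply (P : Mat V) (x y : Cx V) : matForm P x y = coord y ⬝ᵥ (P *ᵥ coord x) := rfl

/-- The condition (SV2*) yields a positive definite form that is invariant under all the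
conjugates of `h`. -/
theorem exists_invariant_form (hH : H.SV2Star) : ∃ B : Cx V →ₗ[ℂ] Cx V →ₗ[ℂ] ℂ,
    (∀ (γ : ℂ ≃+* ℂ) (pq pq' : ℤ × ℤ) (x y : Cx V), x ∈ H.piece pq → y ∈ H.piece pq' →
      pq' ≠ pq.swap → B (gam γ x) (gam γ y) = 0) ∧
    ∀ x, conj x = x → x ≠ 0 → 0 < B x (H.weilOperator.1 x) := by
  obtain ⟨P, hP, hskew⟩ := H.exists_invariant_matrix hH
  let C := H.weilOperator.1
  let D := (H.weilOperator⁻¹).1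
  have hCD : ∀ x, C (D x) = x := fun x => by
    rw [← Module.End.mul_apply, ← Units.val_mul, mul_inv_cancel]; rfl
  have hDC : ∀ x, D (C x) = x := fun x => by
    rw [← Module.End.mul_apply, ← Units.val_mul, inv_mul_cancel]; rfl
  have hCm : ∀ m x, H.weightProj m (C x) = C (H.weightProj m x) := fun m x =>
    (LinearMap.congr_fun (H.commute_weightProj (H.h_mem_mumfordTate _) m
      (g := H.weilOperator)).eq x).symm
  -- The conjugate transpose in the invariance of `P` undoes the conjugation in `τ`, which leaves
  -- only conjugation by `C` in this bilinear version.
  have hinv : ∀ γ x z, matForm P (gamEnd γ H.hodgeOp x) z =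
      -matForm P x (C (gamEnd γ H.hodgeOp (D z))) := by
    intro γ x z
    set X := gamEnd γ H.hodgeOp
    have h1 : P * mat X = -((H.twistMat (mat X))ᴴ * P) := by
      rw [eq_neg_iff_add_eq_zero, add_comm]; exact hskew γ
    have h2 : ((H.twistMat (mat X))ᴴ)ᵀ = mat (H.weilOperator.1 * X * (H.weilOperator⁻¹).1) := by
      have hC : ∀ g : GLC V, conjGL g = g → (mat g.1).map (starRingEnd ℂ) = mat g.1 := by
        intro g hg
        rw [conjGL_eq_gamGL] at hg
        have := congrArg (fun g : GLC V => mat g.1) hg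
        simp only [gamGL_val, mat_gamEnd] at this
        exact this
      have e : ∀ M : Mat V, (Mᴴ)ᵀ = M.map (starRingEnd ℂ) := fun M => by ext i j; rfl
      rw [e, twistMat_apply, Matrix.map_mul, Matrix.map_mul, hC _ H.conjGL_weilOperator,
        hC _ (by rw [map_inv, conjGL_weilOperator]), map_mul, map_mul]
      congr 2
      ext i j
      simp
    rw [matForm_apply, matForm_apply, ← mat_mulVec_coord, Matrix.mulVec_mulVec, h1,
      Matrix.neg_mulVec, dotProduct_neg, ← Matrix.mulVec_mulVec, Matrix.dotProduct_mulVec,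
      ← Matrix.mulVec_transpose, h2, mat_mulVec_coord]
    rfl
  -- Inserting `C⁻¹` on the right makes the generators skew, since they commute with `C²`, and
  -- reduces `B(x, Cx)` to the positive form. Summing over weights makes distinct weights
  -- orthogonal.
  let B : Cx V →ₗ[ℂ] Cx V →ₗ[ℂ] ℂ :=
    ∑ m ∈ H.weights, (matForm P).compl₁₂ (H.weightProj m) (D * H.weightProj m)
  have hB : ∀ x y, B x y = ∑ m ∈ H.weights, matForm P (H.weightProj m x) (D (H.weightProj m y)) := by
    intro x y
    simp only [B, LinearMap.sum_apply, LinearMap.compl₁₂_apply, Module.End.mul_apply]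
  have hBX : ∀ γ x y, B (gamEnd γ H.hodgeOp x) y = -B x (gamEnd γ H.hodgeOp y) := by
    intro γ x y
    rw [hB, hB, ← Finset.sum_neg_distrib]
    refine Finset.sum_congr rfl fun m _ => ?_
    have hX : ∀ x, H.weightProj m (gamEnd γ H.hodgeOp x) =
        gamEnd γ H.hodgeOp (H.weightProj m x) := by
      intro x
      have := ((H.commute_diag_weightProj (fun pq => (pq.2 : ℂ) - pq.1) m).map (gamEnd γ)).eq
      rw [gamEnd_weightProj] at this
      exact (LinearMap.congr_fun this x).symm
    rw [hX, hX, hinv]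
    congr 2
    set w := H.weightProj m y
    have h1 := LinearMap.congr_fun (H.commute_gamEnd_hodgeOp_weilOperator_sq γ).eq (D (D w))
    simp only [Units.val_mul, Module.End.mul_apply] at h1
    change gamEnd γ H.hodgeOp (C (C (D (D w)))) = C (C (gamEnd γ H.hodgeOp (D (D w)))) at h1
    rw [hCD, hCD] at h1
    rw [h1, hDC]
  refine ⟨B, ?_, ?_⟩
  · intro γ pq pq' x y hx hy hne
    by_cases hw : pq.1 + pq.2 = pq'.1 + pq'.2
    · have h1 := hBX γ (gam γ x) (gam γ y)
      rw [H.hodgeOp_conj_apply γ hx, H.hodgeOp_conj_apply γ hy, map_smul, map_smul,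
        LinearMap.smul_apply, ← neg_smul, ← sub_eq_zero, ← sub_smul, smul_eq_zero] at h1
      refine h1.resolve_left fun h0 => hne ?_
      have h2 : (((pq.2 - pq.1) + (pq'.2 - pq'.1) : ℤ) : ℂ) = 0 := by
        push_cast
        linear_combination h0
      have h3 : (pq.2 - pq.1) + (pq'.2 - pq'.1) = 0 := by exact_mod_cast h2
      ext
      · simp only [Prod.fst_swap]; omega
      · simp only [Prod.snd_swap]; omega
    · rw [hB]
      refine Finset.sum_eq_zero fun m _ => ?_
      rw [H.weightProj_of_mem m (H.gam_mem_weightC γ (H.piece_le_weightC _ hx)),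
        H.weightProj_of_mem m (H.gam_mem_weightC γ (H.piece_le_weightC _ hy))]
      by_cases h : pq.1 + pq.2 = m
      · rw [if_neg (c := pq'.1 + pq'.2 = m) (by omega)]
        simp
      · rw [if_neg h]
        simp
  · intro x hx hx0
    rw [hB]
    have hnn : ∀ y : Cx V, conj y = y → y ≠ 0 → 0 < matForm P y y := by
      intro y hy hy0
      have := hP (coord y) fun h => hy0 (coord_injective (h.trans (by ext; simp [coord])))
      rw [← coord_conj, hy] at this
      exact this
    have hterm : ∀ m, H.weightProj m (C x) = C (H.weightProj m x) := fun m => hCm m x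
    have hreal : ∀ m, conj (H.weightProj m x) = H.weightProj m x := fun m => by
      rw [weightProj_conj, hx]
    have hex : ∃ m ∈ H.weights, H.weightProj m x ≠ 0 := by
      by_contra hcon
      push Not at hcon
      apply hx0
      rw [← H.sum_weightProj_apply x]
      exact Finset.sum_eq_zero hcon
    obtain ⟨m, hm, hm0⟩ := hex
    refine Finset.sum_pos' (fun m _ => ?_) ⟨m, hm, ?_⟩
    · change 0 ≤ matForm P (H.weightProj m x) (D (H.weightProj m (C x)))
      rw [hterm, hDC]
      by_cases h0 : H.weightProj m x = 0
      · simp [h0]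
      · exact (hnn _ (hreal m) h0).le
    · change 0 < matForm P (H.weightProj m x) (D (H.weightProj m (C x)))
      rw [hterm, hDC]
      exact hnn _ (hreal m) hm0

end RationalHodgeStructure

end HodgeMT

namespace HodgeMT

/-! ### Polarizations from a positive form. -/

namespace RationalHodgeStructure

open scoped ComplexOrder

variable {V : Type*} [AddCommGroup V] [Module ℚ V] (H : RationalHodgeStructure V)

theorem conj_weilOperator_apply (x : Cx V) :
    conj (H.weilOperator.1 x) = H.weilOperator.1 (conj x) := by
  have := congrArg (fun g : GLC V => g.1 (conj x)) H.conjGL_weilOperator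
  simp only [conjGL_apply, conj_conj] at this
  exact this

theorem weilOperator_weilOperator_apply {m : ℤ} {x : Cx V} (hx : x ∈ H.weightC m) :
    H.weilOperator.1 (H.weilOperator.1 x) = ((-1) ^ m : ℂ) • x := by
  have := congrArg (fun g : GLC V => g.1 x) H.weilOperator_mul_self
  simp only [Units.val_mul, Module.End.mul_apply, H.weightHom_apply _ hx] at this
  simpa using this

/-- A form pairing `V^{p,q}` only with `V^{q,p}` is equivariant on the part of weight `m`. -/
theorem form_h_apply {B : Cx V →ₗ[ℂ] Cx V →ₗ[ℂ] ℂ}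
    (hB : ∀ (pq pq' : ℤ × ℤ) (x y : Cx V), x ∈ H.piece pq → y ∈ H.piece pq' →
      pq' ≠ pq.swap → B x y = 0) {m : ℤ} (z : ℂˣ × ℂˣ) (x : Cx V) {y : Cx V}
    (hy : y ∈ H.weightC m) :
    B ((H.h z).1 x) ((H.h z).1 y) = (((z.1 * z.2) ^ (-m) : ℂˣ) : ℂ) * B x y := by
  refine Submodule.iSup_induction _ hy (motive := fun y => B ((H.h z).1 x) ((H.h z).1 y) =
    (((z.1 * z.2) ^ (-m) : ℂˣ) : ℂ) * B x y) ?_ (by simp)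
    (fun y y' h h' => by simp only [map_add, h, h', mul_add])
  intro p' y hy
  refine H.induction_pieces (P := fun x => B ((H.h z).1 x) ((H.h z).1 y) =
    (((z.1 * z.2) ^ (-m) : ℂˣ) : ℂ) * B x y) (by simp)
    (fun x x' h h' => by simp only [map_add, LinearMap.add_apply, h, h', mul_add]) ?_ x
  intro p q x hx
  rw [H.h_apply z hx, H.h_apply z hy, map_smul, map_smul, LinearMap.smul_apply, smul_eq_mul,
    smul_eq_mul, ← mul_assoc, ← Units.val_mul]
  by_cases hpq : (p', m - p') = ((p, q) : ℤ × ℤ).swap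
  · obtain ⟨rfl, h2⟩ := Prod.mk.inj hpq
    have h3 : m = p + p' := by omega
    subst h3
    congr 2
    rw [add_sub_cancel_right, mul_zpow, neg_add, zpow_add, zpow_add]
    exact mul_mul_mul_comm _ _ _ _ |>.trans (by rw [mul_comm (z.1 ^ (-p'))])
  · rw [hB _ _ x y hx hy hpq, mul_zero, mul_zero]

section WeightPart

theorem weightIncl_weightPart_h (m : ℤ) (z : ℂˣ × ℂˣ) (x : Cx (H.weight m)) :
    H.weightIncl m (((H.weightPart m).h z).1 x) = (H.h z).1 (H.weightIncl m x) := by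
  refine (H.weightPart m).induction_pieces
    (P := fun x => H.weightIncl m (((H.weightPart m).h z).1 x) = (H.h z).1 (H.weightIncl m x))
    (by simp) (fun x y hx hy => by simp only [map_add, hx, hy]) ?_ x
  intro p q x hx
  rw [(H.weightPart m).h_apply z hx, map_smul, H.h_apply z hx]

theorem weightIncl_weightPart_weilOperator (m : ℤ) (x : Cx (H.weight m)) :
    H.weightIncl m ((H.weightPart m).weilOperator.1 x) = H.weilOperator.1 (H.weightIncl m x) :=
  H.weightIncl_weightPart_h m _ x

theorem weightIncl_mem (m : ℤ) (x : Cx (H.weight m)) : H.weightIncl m x ∈ H.weightC m := by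
  rw [← range_weightIncl]
  exact ⟨x, rfl⟩

theorem bilinQ_weightIncl (b : V →ₗ[ℚ] V →ₗ[ℚ] ℚ) (m : ℤ) (x y : Cx (H.weight m)) :
    bilinQ (b.compl₁₂ (H.weight m).subtype (H.weight m).subtype) x y =
      bilinQ b (H.weightIncl m x) (H.weightIncl m y) := by
  refine tensor_induction₂ (P := fun x y =>
    bilinQ (b.compl₁₂ (H.weight m).subtype (H.weight m).subtype) x y =
      bilinQ b (H.weightIncl m x) (H.weightIncl m y)) ?_ ?_ ?_ ?_ ?_ x y
  · intro z x w y
    simp [weightIncl]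
  · intro y; simp
  · intro x; simp
  · intro x x' y h h'; simp only [map_add, LinearMap.add_apply, h, h']
  · intro x y y' h h'; simp only [map_add, h, h']

theorem weightPart_weight (m : ℤ) : (H.weightPart m).weight m = ⊤ := by
  rw [eq_top_iff]
  intro v _
  rw [mem_weight]
  have h1 : (H.weightPart m).weightC m = ⊤ := H.iSup_comap_weightIncl m
  rw [h1]
  trivial

end WeightPart

theorem bilinQ_flip (b : V →ₗ[ℚ] V →ₗ[ℚ] ℚ) (x y : Cx V) : bilinQ b.flip x y = bilinQ b y x := by
  refine tensor_induction₂ (P := fun x y => bilinQ b.flip x y = bilinQ b y x) ?_ ?_ ?_ ?_ ?_ x y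
  · intro z x w y; simp; ring
  · intro y; simp
  · intro x; simp
  · intro x x' y h h'; simp only [map_add, LinearMap.add_apply, h, h']
  · intro x y y' h h'; simp only [map_add, LinearMap.add_apply, h, h']

/-- The pairing with values in `ℚ(m)` that is `(2πi)^m` times a rational form. -/
def tatePairing (m : ℤ) (b : V →ₗ[ℚ] V →ₗ[ℚ] ℚ) : V →ₗ[ℚ] V →ₗ[ℚ] tate m :=
  b.compr₂ (LinearMap.toSpanSingleton ℚ (tate m)
    ⟨(2 * (Real.pi : ℂ) * Complex.I) ^ m, Submodule.mem_span_singleton_self _⟩)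

theorem pairingC_tatePairing (m : ℤ) (b : V →ₗ[ℚ] V →ₗ[ℚ] ℚ) (x y : Cx V) :
    pairingC (tatePairing m b) x y = (2 * (Real.pi : ℂ) * Complex.I) ^ m * bilinQ b x y := by
  refine tensor_induction₂ (P := fun x y => pairingC (tatePairing m b) x y =
    (2 * (Real.pi : ℂ) * Complex.I) ^ m * bilinQ b x y) ?_ ?_ ?_ ?_ ?_ x y
  · intro z x w y
    simp only [pairingC, tatePairing, bilinC_tmul, bilinQ_tmul, LinearMap.compr₂_apply,
      Submodule.coe_subtype, LinearMap.toSpanSingleton_apply, Submodule.coe_smul, Rat.smul_def]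
    ring
  · intro y; simp
  · intro x; simp
  · intro x x' y h h'; simp only [map_add, LinearMap.add_apply, h, h', mul_add]
  · intro x y y' h h'; simp only [map_add, h, h', mul_add]

theorem two_pi_I_zpow_ne_zero (m : ℤ) : (2 * (Real.pi : ℂ) * Complex.I) ^ m ≠ 0 :=
  zpow_ne_zero _ Complex.two_pi_I_ne_zero

/-- A rational form pairing `V^{p,q}` only with `V^{q,p}` whose twist by the Weil operator is
positive yields polarizations. -/
theorem isPolarizable_of_form {b : V →ₗ[ℚ] V →ₗ[ℚ] ℚ}
    (hb : ∀ (pq pq' : ℤ × ℤ) (x y : Cx V), x ∈ H.piece pq → y ∈ H.piece pq' →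
      pq' ≠ pq.swap → bilinQ b x y = 0)
    (hpos : ∀ x, conj x = x → x ≠ 0 → 0 < bilinQ b x (H.weilOperator.1 x)) :
    H.IsPolarizable := by
  intro m
  let c := b.compl₁₂ (H.weight m).subtype (H.weight m).subtype
  -- Because `C² = (-1) ^ m` on `V_m` and `C` preserves `b`, this sign makes `β(x, Cy)` symmetric,
  -- and `β(x, Cx) = 2 b(x, Cx)`.
  let β : H.weight m →ₗ[ℚ] H.weight m →ₗ[ℚ] ℚ := c + ((-1) ^ m : ℚ) • c.flip
  have hβ : ∀ x y, bilinQ β x y = bilinQ b (H.weightIncl m x) (H.weightIncl m y) +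
      (-1) ^ m * bilinQ b (H.weightIncl m y) (H.weightIncl m x) := by
    intro x y
    have h1 : bilinQFun β x y = bilinQFun c x y + ((-1) ^ m : ℚ) • bilinQFun c.flip x y := by
      simp only [β, map_add, map_smul]
      rfl
    simp only [bilinQFun_apply, bilinQ_flip, c, bilinQ_weightIncl, Rat.smul_def] at h1
    rw [h1]
    push_cast
    rfl
  have hC : ∀ x y, y ∈ H.weightC m → bilinQ b (H.weilOperator.1 x) (H.weilOperator.1 y) =
      bilinQ b x y := by
    intro x y hy
    have := H.form_h_apply hb (iUnit, Units.map (starRingEnd ℂ : ℂ →* ℂ) iUnit) x hy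
    have h1 : iUnit * Units.map (starRingEnd ℂ : ℂ →* ℂ) iUnit = 1 := by
      apply Units.ext
      simp [iUnit]
    rw [h1, one_zpow, Units.val_one, one_mul] at this
    exact this
  have hCm : ∀ x : Cx (H.weight m), H.weilOperator.1 (H.weightIncl m x) ∈ H.weightC m := fun x =>
    H.h_apply_mem_weightC _ (H.weightIncl_mem m x)
  have hsq : ((-1 : ℂ) ^ m) * (-1) ^ m = 1 := by
    rw [← mul_zpow]; norm_num
  have hflip : ∀ x y : Cx (H.weight m),
      (-1) ^ m * bilinQ b (H.weilOperator.1 (H.weightIncl m x)) (H.weightIncl m y) =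
        bilinQ b (H.weightIncl m x) (H.weilOperator.1 (H.weightIncl m y)) := by
    intro x y
    rw [← hC _ _ (H.weightIncl_mem m y),
      H.weilOperator_weilOperator_apply (H.weightIncl_mem m x), map_smul, LinearMap.smul_apply,
      smul_eq_mul, ← mul_assoc, hsq, one_mul]
  have hβC : ∀ x y : Cx (H.weight m), bilinQ β x ((H.weightPart m).weilOperator.1 y) =
      bilinQ b (H.weightIncl m x) (H.weilOperator.1 (H.weightIncl m y)) +
      bilinQ b (H.weightIncl m y) (H.weilOperator.1 (H.weightIncl m x)) := by
    intro x y
    rw [hβ, weightIncl_weightPart_weilOperator, hflip]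
  have htate : ∀ x y : Cx (H.weight m),
      (2 * (Real.pi : ℂ) * Complex.I) ^ m * pairingC (tatePairing (-m) β) x y = bilinQ β x y := by
    intro x y
    rw [pairingC_tatePairing, ← mul_assoc, zpow_neg,
      mul_inv_cancel₀ (two_pi_I_zpow_ne_zero m), one_mul]
  refine ⟨tatePairing (-m) β, H.weightPart_weight m, ?_, ?_, ?_⟩
  · intro z x y
    simp only [pairingC_tatePairing, hβ, weightIncl_weightPart_h,
      H.form_h_apply hb z _ (H.weightIncl_mem m _)]
    ring
  · intro x y _ _
    rw [htate, htate, hβC, hβC, add_comm]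
  · intro x hx hx0
    rw [htate, hβC]
    have hpos' := hpos (H.weightIncl m x) (by rw [← weightIncl_conj, hx])
      fun h => hx0 (H.weightIncl_injective m (h.trans (map_zero _).symm))
    exact add_pos hpos' hpos'

variable [Module.Finite ℚ V]

/-- A positive form invariant under the conjugates of `h` can be chosen rational. -/
theorem exists_rational_form {B : Cx V →ₗ[ℂ] Cx V →ₗ[ℂ] ℂ}
    (hB : ∀ (γ : ℂ ≃+* ℂ) (pq pq' : ℤ × ℤ) (x y : Cx V), x ∈ H.piece pq → y ∈ H.piece pq' →
      pq' ≠ pq.swap → B (gam γ x) (gam γ y) = 0)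
    (hpos : ∀ x, conj x = x → x ≠ 0 → 0 < B x (H.weilOperator.1 x)) :
    ∃ b : V →ₗ[ℚ] V →ₗ[ℚ] ℚ, (∀ (pq pq' : ℤ × ℤ) (x y : Cx V), x ∈ H.piece pq →
      y ∈ H.piece pq' → pq' ≠ pq.swap → bilinQ b x y = 0) ∧
    ∀ x, conj x = x → x ≠ 0 → 0 < bilinQ b x (H.weilOperator.1 x) := by
  classical
  -- Imposing the vanishing for all `γ` at once makes the subspace stable under the automorphisms of
  -- `ℂ`.
  let W : Submodule ℂ (Cx V → Cx V → ℂ) :=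
    { carrier := {f | ∀ (γ : ℂ ≃+* ℂ) (pq pq' : ℤ × ℤ) (x y : Cx V), x ∈ H.piece pq →
        y ∈ H.piece pq' → pq' ≠ pq.swap → f (gam γ x) (gam γ y) = 0}
      add_mem' := fun {f g} hf hg γ pq pq' x y hx hy hne => by
        simp [hf γ pq pq' x y hx hy hne, hg γ pq pq' x y hx hy hne]
      zero_mem' := fun γ pq pq' x y hx hy hne => rfl
      smul_mem' := fun a f hf γ pq pq' x y hx hy hne => by
        simp [hf γ pq pq' x y hx hy hne] }
  let ρ : (ℂ ≃+* ℂ) → (Cx V → Cx V → ℂ) →+ (Cx V → Cx V → ℂ) := fun γ =>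
    { toFun := fun f x y => γ (f (gam γ.symm x) (gam γ.symm y))
      map_zero' := by ext; simp
      map_add' := fun f g => by ext; simp }
  have hmem := mem_span_inter_of_stable (LinearMap.range (bilinQFun (V := V))) W ρ
    (by
      rintro γ a _ ⟨b, rfl⟩
      ext x y
      change γ (a * bilinQ b (gam γ.symm x) (gam γ.symm y)) = γ a * bilinQ b x y
      rw [map_mul, ← bilinQ_gam, gam_gam_symm, gam_gam_symm])
    (by
      intro γ f hf γ' pq pq' x y hx hy hne
      have hc : ∀ y : Cx V, gam γ.symm (gam γ' y) = gam (γ'.trans γ.symm) y := by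
        intro y
        induction y using TensorProduct.induction_on with
        | zero => simp
        | tmul z v => simp
        | add x y hx hy => simp only [map_add, hx, hy]
      change γ (f (gam γ.symm (gam γ' x)) (gam γ.symm (gam γ' y))) = 0
      rw [hc, hc, hf _ pq pq' x y hx hy hne, map_zero])
    (x := fun x y => B x y) hB (mem_span_bilinQ B)
  obtain ⟨c, hc, hsum⟩ := Submodule.mem_span_set.1 hmem
  have hs : ∀ f ∈ c.support, ∃ b, bilinQFun b = f ∧ f ∈ W := fun f hf =>
    ⟨(hc hf).1.choose, (hc hf).1.choose_spec, (hc hf).2⟩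
  choose! β hβ hβW using hs
  have hBsum : ∀ x y, B x y = ∑ f ∈ c.support, c f * bilinQ (β f) x y := by
    intro x y
    have h1 : B x y = (c.sum fun f r => r • f) x y := by rw [hsum]
    rw [h1, Finsupp.sum, Finset.sum_apply, Finset.sum_apply]
    refine Finset.sum_congr rfl fun f hf => ?_
    have h2 := congrFun (congrFun (hβ f hf) x) y
    rw [bilinQFun_apply] at h2
    rw [h2]
    rfl
  let xt : (Fin (Module.finrank ℚ V) → ℝ) → Cx V := fun t => ∑ i, (t i : ℂ) • basisC V i
  have hxt_conj : ∀ t, conj (xt t) = xt t := by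
    intro t
    simp only [xt, map_sum, LinearEquiv.map_smulₛₗ, Complex.conj_ofReal, basisC_apply, conj_tmul,
      map_one]
  have hxt0 : ∀ t, t ≠ 0 → xt t ≠ 0 := by
    intro t ht h0
    apply ht
    ext i
    have := congrArg (fun x => (basisC V).repr x i) h0
    simp only [xt, Module.Basis.repr_sum_self, map_zero, Finsupp.zero_apply] at this
    exact_mod_cast this
  have hxt_surj : ∀ x : Cx V, conj x = x → ∃ t, xt t = x := by
    intro x hx
    refine ⟨fun i => ((basisC V).repr x i).re, ?_⟩
    have h1 : ∀ i, ((((basisC V).repr x i).re : ℝ) : ℂ) = (basisC V).repr x i := by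
      intro i
      rw [← Complex.conj_eq_iff_re]
      have := basisC_repr_gam conjRing x i
      rw [← conj_eq_gam, hx] at this
      exact this.symm
    simp only [xt, h1]
    exact (basisC V).sum_repr x
  -- For rational `b` and real `x` the value `b(x, Cx)` is real, so only the real parts of the
  -- coefficients of `B` affect positivity, and these can be approximated by rationals.
  let φ : (Cx V → Cx V → ℂ) → (Fin (Module.finrank ℚ V) → ℝ) → ℝ := fun f t =>
    (bilinQ (β f) (xt t) (H.weilOperator.1 (xt t))).re
  have hφreal : ∀ b : V →ₗ[ℚ] V →ₗ[ℚ] ℚ, ∀ x, conj x = x →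
      (((bilinQ b x (H.weilOperator.1 x)).re : ℝ) : ℂ) = bilinQ b x (H.weilOperator.1 x) := by
    intro b x hx
    rw [← Complex.conj_eq_iff_re, ← bilinQ_conj, conj_weilOperator_apply, hx]
  obtain ⟨q, hq⟩ := exists_rat_combination_pos c.support φ
    (by
      intro f
      have h1 : φ f = fun t => (∑ i, (t i : ℂ) * ∑ j, (t j : ℂ) *
          bilinQ (β f) (basisC V j) (H.weilOperator.1 (basisC V i))).re := by
        ext t
        simp only [φ, xt, map_sum, map_smul, LinearMap.sum_apply, LinearMap.smul_apply, smul_eq_mul]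
      rw [h1]
      fun_prop)
    (by
      intro f a t
      have h1 : xt (a • t) = (a : ℂ) • xt t := by
        simp only [xt, Finset.smul_sum, smul_smul, Pi.smul_apply, smul_eq_mul, Complex.ofReal_mul]
      simp only [φ]
      rw [h1, map_smul, map_smul, map_smul, LinearMap.smul_apply, smul_smul, smul_eq_mul,
        ← Complex.ofReal_mul, Complex.re_ofReal_mul, sq])
    (fun f => (c f).re)
    (by
      intro t ht
      have h1 := hpos (xt t) (hxt_conj t) (hxt0 t ht)
      rw [hBsum] at h1
      have h2 := (Complex.lt_def.1 h1).1
      rw [Complex.zero_re, Complex.re_sum] at h2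
      refine h2.trans_eq (Finset.sum_congr rfl fun f _ => ?_)
      rw [← hφreal _ _ (hxt_conj t), Complex.re_mul_ofReal])
  have hbsum : ∀ x y, bilinQ (∑ f ∈ c.support, q f • β f) x y =
      ∑ f ∈ c.support, (q f : ℂ) * bilinQ (β f) x y := by
    intro x y
    rw [← bilinQFun_apply, map_sum, Finset.sum_apply, Finset.sum_apply]
    refine Finset.sum_congr rfl fun f _ => ?_
    rw [map_smul, Pi.smul_apply, Pi.smul_apply, Rat.smul_def]
    rfl
  refine ⟨∑ f ∈ c.support, q f • β f, ?_, ?_⟩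
  · intro pq pq' x y hx hy hne
    rw [hbsum]
    refine Finset.sum_eq_zero fun f hf => ?_
    have h1 := hβW f hf (RingEquiv.refl ℂ) pq pq' x y hx hy hne
    rw [gam_refl, gam_refl] at h1
    have h2 := congrFun (congrFun (hβ f hf) x) y
    rw [bilinQFun_apply] at h2
    rw [h2, h1, mul_zero]
  · intro x hx hx0
    obtain ⟨t, rfl⟩ := hxt_surj x hx
    have ht : t ≠ 0 := by
      rintro rfl
      apply hx0
      exact Finset.sum_eq_zero fun i _ => by rw [Pi.zero_apply, Complex.ofReal_zero, zero_smul]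
    have h1 := hq t ht
    rw [hbsum]
    have h2 : ∑ f ∈ c.support, (q f : ℂ) * bilinQ (β f) (xt t) (H.weilOperator.1 (xt t)) =
        ((∑ f ∈ c.support, (q f : ℝ) * φ f t : ℝ) : ℂ) := by
      push_cast
      refine Finset.sum_congr rfl fun f _ => ?_
      rw [hφreal _ _ hx]
    rw [h2]
    exact_mod_cast h1

theorem isPolarizable_of_sv2Star (hH : H.SV2Star) : H.IsPolarizable := by
  obtain ⟨B, hB, hpos⟩ := H.exists_invariant_form hH
  obtain ⟨b, hb, hbpos⟩ := H.exists_rational_form hB hpos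
  exact H.isPolarizable_of_form hb hbpos

end RationalHodgeStructure

end HodgeMT

namespace HodgeMT

namespace RationalHodgeStructure

open scoped ComplexOrder

variable {V : Type*} [AddCommGroup V] [Module ℚ V] [Module.Finite ℚ V]
  (H : RationalHodgeStructure V)

/-! ### Rational forms from polarizations -/

/-- The elements of `V_ℂ` fixed by all the automorphisms of `ℂ` are in `V`. -/
theorem exists_of_forall_gam {x : Cx V} (hx : ∀ γ : ℂ ≃+* ℂ, gam γ x = x) :
    ∃ v : V, (1 : ℂ) ⊗ₜ[ℚ] v = x := by
  have h : ∀ i, ∃ q : ℚ, (q : ℂ) = (basisC V).repr x i := fun i =>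
    exists_rat_of_forall_automorphism _ fun γ => by rw [← basisC_repr_gam, hx]
  choose q hq using h
  refine ⟨∑ i, q i • Module.finBasis ℚ V i, ?_⟩
  rw [TensorProduct.tmul_sum, ← (basisC V).sum_repr x]
  refine Finset.sum_congr rfl fun i _ => ?_
  rw [← hq, basisC_apply, TensorProduct.smul_tmul', TensorProduct.tmul_smul,
    TensorProduct.smul_tmul', Rat.smul_def, smul_eq_mul]

/-- The projection onto the part of weight `m` is defined over `ℚ`. -/
theorem exists_weightRetraction (m : ℤ) : ∃ p : V →ₗ[ℚ] H.weight m, ∀ x : Cx V,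
    H.weightIncl m (p.baseChange ℂ x) = H.weightProj m x := by
  have h : ∀ v : V, ∃ w : H.weight m, (1 : ℂ) ⊗ₜ[ℚ] (w : V) = H.weightProj m (1 ⊗ₜ[ℚ] v) := by
    intro v
    obtain ⟨w, hw⟩ := exists_of_forall_gam (x := H.weightProj m (1 ⊗ₜ[ℚ] v)) fun γ => by
      rw [gam_weightProj, gam_tmul, map_one]
    exact ⟨⟨w, by rw [mem_weight, hw]; exact H.weightProj_mem m _⟩, hw⟩
  choose w hw using h
  let e := Module.finBasis ℚ V
  refine ⟨e.constr ℚ fun i => w (e i), fun x => ?_⟩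
  have : H.weightIncl m ∘ₗ (e.constr ℚ fun i => w (e i)).baseChange ℂ = H.weightProj m := by
    refine (basisC V).ext fun i => ?_
    rw [LinearMap.comp_apply, basisC_apply, LinearMap.baseChange_tmul]
    change H.weightIncl m (1 ⊗ₜ[ℚ] (e.constr ℚ fun i => w (e i)) (e i)) = _
    rw [Module.Basis.constr_basis, ← hw]
    rfl
  exact LinearMap.congr_fun this x

omit [Module.Finite ℚ V] in
theorem bilinQ_compl₁₂ {V' : Type*} [AddCommGroup V'] [Module ℚ V']
    (b : V' →ₗ[ℚ] V' →ₗ[ℚ] ℚ) (p : V →ₗ[ℚ] V') (x y : Cx V) :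
    bilinQ (b.compl₁₂ p p) x y = bilinQ b (p.baseChange ℂ x) (p.baseChange ℂ y) := by
  refine tensor_induction₂ (P := fun x y => bilinQ (b.compl₁₂ p p) x y =
    bilinQ b (p.baseChange ℂ x) (p.baseChange ℂ y)) ?_ ?_ ?_ ?_ ?_ x y
  · intro z x w y; simp
  · intro y; simp
  · intro x; simp
  · intro x x' y h h'; simp only [map_add, LinearMap.add_apply, h, h']
  · intro x y y' h h'; simp only [map_add, h, h']

theorem exists_eq_tatePairing {V : Type*} [AddCommGroup V] [Module ℚ V] {m : ℤ}
    (ψ : V →ₗ[ℚ] V →ₗ[ℚ] tate m) : ∃ b, ψ = tatePairing m b := by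
  let e : ℚ ≃ₗ[ℚ] tate m :=
    LinearEquiv.toSpanNonzeroSingleton ℚ ℂ _ (two_pi_I_zpow_ne_zero m)
  refine ⟨ψ.compr₂ e.symm.toLinearMap, ?_⟩
  ext v w
  have h : ψ v w = e (e.symm (ψ v w)) := (e.apply_symm_apply _).symm
  conv_lhs => rw [h]
  rfl

theorem weightProj_h (m : ℤ) (z : ℂˣ × ℂˣ) (x : Cx V) :
    H.weightProj m ((H.h z).1 x) = (H.h z).1 (H.weightProj m x) :=
  (LinearMap.congr_fun (H.commute_weightProj (H.h_mem_mumfordTate z) m).eq x).symm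

/-- A family of rational forms `b m` that define polarizations of the parts `V_m`. -/
structure IsPolarizingFamily (b : ℤ → V →ₗ[ℚ] V →ₗ[ℚ] ℚ) : Prop where
  equivariant : ∀ m (z : ℂˣ × ℂˣ) (x y : Cx V), bilinQ (b m) ((H.h z).1 x) ((H.h z).1 y) =
    (((z.1 * z.2) ^ (-m) : ℂˣ) : ℂ) * bilinQ (b m) x y
  proj : ∀ m (x y : Cx V), bilinQ (b m) (H.weightProj m x) (H.weightProj m y) = bilinQ (b m) x y
  symm : ∀ m (x y : Cx V), bilinQ (b m) x (H.weilOperator.1 y) =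
    bilinQ (b m) y (H.weilOperator.1 x)
  pos : ∀ m (x : Cx V), conj x = x → H.weightProj m x ≠ 0 →
    0 < bilinQ (b m) x (H.weilOperator.1 x)

/-- Each polarization is pulled back to `V` along the rational retraction onto `V_m`, and so
vanishes on the other weights; the power of `2πi` is divided out. -/
theorem exists_polarizingFamily (hH : H.IsPolarizable) :
    ∃ b, H.IsPolarizingFamily b := by
  have key : ∀ m, ∃ b : V →ₗ[ℚ] V →ₗ[ℚ] ℚ,
      (∀ (z : ℂˣ × ℂˣ) (x y : Cx V), bilinQ b ((H.h z).1 x) ((H.h z).1 y) =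
        (((z.1 * z.2) ^ (-m) : ℂˣ) : ℂ) * bilinQ b x y) ∧
      (∀ (x y : Cx V), bilinQ b (H.weightProj m x) (H.weightProj m y) = bilinQ b x y) ∧
      (∀ (x y : Cx V), bilinQ b x (H.weilOperator.1 y) = bilinQ b y (H.weilOperator.1 x)) ∧
      ∀ (x : Cx V), conj x = x → H.weightProj m x ≠ 0 →
        0 < bilinQ b x (H.weilOperator.1 x) := by
    intro m
    obtain ⟨ψ, hψ⟩ := hH m
    obtain ⟨β, rfl⟩ := exists_eq_tatePairing ψ
    obtain ⟨p, hp⟩ := H.exists_weightRetraction m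
    set s := p.baseChange ℂ with hs
    have hsh : ∀ z x, s ((H.h z).1 x) = ((H.weightPart m).h z).1 (s x) := by
      intro z x
      apply H.weightIncl_injective m
      rw [hp, weightIncl_weightPart_h, hp, weightProj_h]
    have hsC : ∀ x, s (H.weilOperator.1 x) = (H.weightPart m).weilOperator.1 (s x) := hsh _
    have hsP : ∀ x, s (H.weightProj m x) = s x := by
      intro x
      apply H.weightIncl_injective m
      rw [hp, hp, H.weightProj_of_mem m (H.weightProj_mem m x), if_pos rfl]
    have hsconj : ∀ x, conj (s x) = s (conj x) := by
      intro x
      apply H.weightIncl_injective m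
      rw [weightIncl_conj, hp, hp, weightProj_conj]
    have htate : ∀ x y : Cx (H.weight m),
        (2 * (Real.pi : ℂ) * Complex.I) ^ m * pairingC (tatePairing (-m) β) x y =
          bilinQ β x y := by
      intro x y
      rw [pairingC_tatePairing, ← mul_assoc, zpow_neg,
        mul_inv_cancel₀ (two_pi_I_zpow_ne_zero m), one_mul]
    refine ⟨β.compl₁₂ p p, ?_, ?_, ?_, ?_⟩
    · intro z x y
      rw [bilinQ_compl₁₂, bilinQ_compl₁₂, ← hs, hsh, hsh, ← htate, hψ.morphism, ← htate]
      ring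
    · intro x y
      rw [bilinQ_compl₁₂, bilinQ_compl₁₂, ← hs, hsP, hsP]
    · intro x y
      simp only [bilinQ_compl₁₂, ← hs, hsC]
      -- Symmetry is assumed only on real vectors; rational vectors are real and span `V_ℂ`, so
      -- bilinearity extends it.
      have hreal : ∀ v w : V, bilinQ β (s (1 ⊗ₜ[ℚ] v)) ((H.weightPart m).weilOperator.1
          (s (1 ⊗ₜ[ℚ] w))) = bilinQ β (s (1 ⊗ₜ[ℚ] w)) ((H.weightPart m).weilOperator.1
          (s (1 ⊗ₜ[ℚ] v))) := by
        intro v w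
        have := hψ.symm (s (1 ⊗ₜ[ℚ] v)) (s (1 ⊗ₜ[ℚ] w)) (by rw [hsconj]; simp)
          (by rw [hsconj]; simp)
        rwa [htate, htate] at this
      have htm : ∀ (z : ℂ) (v : V), z ⊗ₜ[ℚ] v = z • ((1 : ℂ) ⊗ₜ[ℚ] v) := fun z v => by
        simp [TensorProduct.smul_tmul']
      refine tensor_induction₂ (P := fun x y =>
        bilinQ β (s x) ((H.weightPart m).weilOperator.1 (s y)) =
          bilinQ β (s y) ((H.weightPart m).weilOperator.1 (s x))) ?_ ?_ ?_ ?_ ?_ x y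
      · intro z x w y
        rw [htm z, htm w]
        simp only [map_smul, LinearMap.smul_apply, hreal x y, smul_eq_mul]
        ring
      · intro y; simp
      · intro x; simp
      · intro x x' y h h'; simp only [map_add, LinearMap.add_apply, h, h']
      · intro x y y' h h'; simp only [map_add, LinearMap.add_apply, h, h']
    · intro x hx hx0
      rw [bilinQ_compl₁₂, ← hs, hsC, ← htate]
      refine hψ.pos (s x) (by rw [hsconj, hx]) fun h => hx0 ?_
      rw [← hp, h, map_zero]
  choose b h1 h2 h3 h4 using key
  exact ⟨b, h1, h2, h3, h4⟩

omit [Module.Finite ℚ V] in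
theorem glc_apply_inv_apply (g : GLC V) (x : Cx V) : g.1 ((g⁻¹).1 x) = x := by
  rw [← Module.End.mul_apply, ← Units.val_mul, mul_inv_cancel]; rfl

/-- Two bilinear forms agree if they do so on the rational vectors. -/
theorem bilin_ext {B B' : Cx V →ₗ[ℂ] Cx V →ₗ[ℂ] ℂ}
    (h : ∀ v w : V, B (1 ⊗ₜ[ℚ] v) (1 ⊗ₜ[ℚ] w) = B' (1 ⊗ₜ[ℚ] v) (1 ⊗ₜ[ℚ] w)) : B = B' :=
  (basisC V).ext fun i => (basisC V).ext fun j => by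
    rw [basisC_apply, basisC_apply]; exact h _ _

/-- The coefficient `g ↦ b(g v, g w)`. -/
def formCoeff (b : V →ₗ[ℚ] V →ₗ[ℚ] ℚ) (v w : V) (g : GLC V) : ℂ :=
  bilinQ b (g.1 (1 ⊗ₜ[ℚ] v)) (g.1 (1 ⊗ₜ[ℚ] w))

theorem formCoeff_mem (b : V →ₗ[ℚ] V →ₗ[ℚ] ℚ) (v w : V) :
    formCoeff b v w ∈ polyFunctions V ℚ := by
  let e := Module.finBasis ℚ V
  have h1 : formCoeff b v w =
      ∑ i, ∑ j, (b (e i) (e j)) • (matrixCoeff (e.coord i) v * matrixCoeff (e.coord j) w) := by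
    ext g
    have hexp : ∀ x : Cx V, x = ∑ i, formC (e.coord i) x • ((1 : ℂ) ⊗ₜ[ℚ] e i) := by
      intro x
      conv_lhs => rw [← (basisC V).sum_repr x]
      refine Finset.sum_congr rfl fun i _ => ?_
      rw [basisC_repr, basisC_apply]
    simp only [Finset.sum_apply, Pi.smul_apply, Pi.mul_apply, matrixCoeff, formCoeff]
    generalize g.1 (1 ⊗ₜ[ℚ] v) = x
    generalize g.1 (1 ⊗ₜ[ℚ] w) = y
    conv_lhs => rw [hexp x, hexp y]
    simp only [map_sum, map_smul, LinearMap.sum_apply, LinearMap.smul_apply, bilinQ_tmul,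
      smul_eq_mul, one_mul, Rat.smul_def, Finset.mul_sum]
    rw [Finset.sum_comm]
    refine Finset.sum_congr rfl fun i _ => Finset.sum_congr rfl fun j _ => ?_
    ring
  rw [h1]
  have hmc : ∀ (f : Module.Dual ℚ V) (v : V), matrixCoeff f v ∈ polyFunctions V ℚ :=
    fun f v => Algebra.subset_adjoin ⟨f, v, rfl⟩
  exact sum_mem fun i _ => sum_mem fun j _ =>
    Subalgebra.smul_mem _ (mul_mem (hmc _ _) (hmc _ _)) _

/-- The group of similitudes of a form. -/
def similitudes (b : V →ₗ[ℚ] V →ₗ[ℚ] ℚ) : Subgroup (GLC V) where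
  carrier := {g | ∃ c : ℂ, c ≠ 0 ∧ ∀ x y, bilinQ b (g.1 x) (g.1 y) = c * bilinQ b x y}
  one_mem' := ⟨1, one_ne_zero, fun x y => by rw [one_mul]; rfl⟩
  mul_mem' := by
    rintro g g' ⟨c, hc, h⟩ ⟨c', hc', h'⟩
    refine ⟨c * c', mul_ne_zero hc hc', fun x y => ?_⟩
    rw [Units.val_mul, Module.End.mul_apply, Module.End.mul_apply, h, h', mul_assoc]
  inv_mem' := by
    rintro g ⟨c, hc, h⟩
    refine ⟨c⁻¹, inv_ne_zero hc, fun x y => ?_⟩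
    have := h ((g⁻¹).1 x) ((g⁻¹).1 y)
    rw [glc_apply_inv_apply, glc_apply_inv_apply] at this
    rw [this, inv_mul_cancel_left₀ hc]

omit [Module.Finite ℚ V] in
theorem mem_similitudes {b : V →ₗ[ℚ] V →ₗ[ℚ] ℚ} {g : GLC V} : g ∈ similitudes b ↔
    ∃ c : ℂ, c ≠ 0 ∧ ∀ x y, bilinQ b (g.1 x) (g.1 y) = c * bilinQ b x y := Iff.rfl

/-- One nonzero value of `b` determines the multiplier as a rational polynomial in `g`. The
existential condition thus becomes polynomial equations over `ℚ`. -/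
theorem mem_similitudes_iff {b : V →ₗ[ℚ] V →ₗ[ℚ] ℚ} {v₀ w₀ : V} (h0 : b v₀ w₀ ≠ 0) {g : GLC V} :
    g ∈ similitudes b ↔
      ∀ v w, formCoeff b v w g = ((b v w * (b v₀ w₀)⁻¹) • formCoeff b v₀ w₀) g := by
  have h0' : (b v₀ w₀ : ℂ) ≠ 0 := by exact_mod_cast h0
  simp only [Pi.smul_apply, Rat.smul_def]
  constructor
  · rintro ⟨c, hc, h⟩ v w
    rw [formCoeff, formCoeff, h, h, bilinQ_tmul, bilinQ_tmul]
    push_cast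
    field_simp
  · intro hg
    set c : ℂ := (b v₀ w₀ : ℂ)⁻¹ * formCoeff b v₀ w₀ g with hc
    have h1 : (bilinQ b).compl₁₂ g.1 g.1 = c • bilinQ b := by
      refine bilin_ext fun v w => ?_
      rw [LinearMap.compl₁₂_apply, LinearMap.smul_apply, LinearMap.smul_apply, bilinQ_tmul,
        hc, smul_eq_mul]
      have := hg v w
      rw [formCoeff] at this
      rw [this]
      push_cast
      ring
    have h2 : ∀ x y, bilinQ b (g.1 x) (g.1 y) = c * bilinQ b x y := fun x y =>
      LinearMap.congr_fun₂ h1 x y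
    refine ⟨c, fun hc0 => h0' ?_, h2⟩
    have := h2 ((g⁻¹).1 (1 ⊗ₜ[ℚ] v₀)) ((g⁻¹).1 (1 ⊗ₜ[ℚ] w₀))
    rw [glc_apply_inv_apply, glc_apply_inv_apply, hc0, zero_mul, bilinQ_tmul] at this
    simpa using this

theorem isZariskiClosed_similitudes {b : V →ₗ[ℚ] V →ₗ[ℚ] ℚ} {v₀ w₀ : V} (h0 : b v₀ w₀ ≠ 0) :
    IsZariskiClosed ℚ (similitudes b : Set (GLC V)) := by
  have : (similitudes b : Set (GLC V)) = ⋂ v : V, ⋂ w : V, {g : GLC V | formCoeff b v w g =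
      ((b v w * (b v₀ w₀)⁻¹) • formCoeff b v₀ w₀) g} := by
    ext g
    simp only [Set.mem_iInter]
    exact mem_similitudes_iff h0
  rw [this]
  exact IsZariskiClosed.iInter fun v => IsZariskiClosed.iInter fun w =>
    isZariskiClosed_eq (formCoeff_mem b v w) (Subalgebra.smul_mem _ (formCoeff_mem b v₀ w₀) _)

section Family

variable {H} {b : ℤ → V →ₗ[ℚ] V →ₗ[ℚ] ℚ} (hb : H.IsPolarizingFamily b)

/-- The hermitian form `(x, y) ↦ b m (x, C ȳ)`. -/
def weightForm (H : RationalHodgeStructure V) (b : ℤ → V →ₗ[ℚ] V →ₗ[ℚ] ℚ) (m : ℤ)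
    (x y : Cx V) : ℂ := bilinQ (b m) x (H.weilOperator.1 (conj y))

include hb

-- Write `x = u + i v` with `u` and `v` real. The cross terms cancel by symmetry of `b(x, Cy)`,
-- leaving `b(u, Cu) + b(v, Cv)`; a nonzero component of `x` in weight `m` forces one for `u` or
-- `v`.
omit [Module.Finite ℚ V] in
theorem weightForm_self_nonneg (m : ℤ) (x : Cx V) : 0 ≤ weightForm H b m x x ∧
    (H.weightProj m x ≠ 0 → 0 < weightForm H b m x x) := by
  set u : Cx V := (2⁻¹ : ℂ) • (x + conj x) with hu
  set v : Cx V := (-(2⁻¹ : ℂ) * Complex.I) • (x - conj x) with hv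
  have h2 : starRingEnd ℂ (2⁻¹ : ℂ) = 2⁻¹ := by rw [map_inv₀, Complex.conj_ofNat]
  have hcu : conj u = u := by
    rw [hu, LinearEquiv.map_smulₛₗ, map_add, conj_conj, add_comm, h2]
  have hcv : conj v = v := by
    rw [hv, LinearEquiv.map_smulₛₗ, map_sub, conj_conj, map_mul, map_neg, h2, Complex.conj_I,
      ← neg_sub x (conj x), smul_neg, ← neg_smul]
    congr 1
    ring
  have hx : x = u + Complex.I • v := by
    rw [hu, hv, smul_smul, show Complex.I * (-(2⁻¹ : ℂ) * Complex.I) = 2⁻¹ by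
      linear_combination (-(2⁻¹ : ℂ)) * Complex.I_mul_I, smul_add, smul_sub]
    rw [add_add_sub_cancel, ← add_smul]
    norm_num
  have hcx : conj x = u - Complex.I • v := by
    rw [hx, map_add, hcu, LinearEquiv.map_smulₛₗ, hcv, Complex.conj_I, neg_smul, sub_eq_add_neg]
  have hform : weightForm H b m x x = bilinQ (b m) u (H.weilOperator.1 u) +
      bilinQ (b m) v (H.weilOperator.1 v) := by
    rw [weightForm, hcx, hx]
    simp only [map_add, map_sub, map_smul, LinearMap.add_apply, LinearMap.smul_apply, smul_eq_mul]
    rw [hb.symm m v u]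
    linear_combination (-(bilinQ (b m) v (H.weilOperator.1 v))) * Complex.I_mul_I
  have hnn : ∀ u : Cx V, conj u = u → 0 ≤ bilinQ (b m) u (H.weilOperator.1 u) := by
    intro u hu
    by_cases h : H.weightProj m u = 0
    · rw [← hb.proj, h]; simp
    · exact (hb.pos m u hu h).le
  rw [hform]
  clear_value u v
  refine ⟨add_nonneg (hnn u hcu) (hnn v hcv), fun h0 => ?_⟩
  by_cases h : H.weightProj m u = 0
  · refine add_pos_of_nonneg_of_pos (hnn u hcu) (hb.pos m v hcv fun h' => h0 ?_)
    have h1 : H.weightProj m (u + Complex.I • v) = 0 := by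
      rw [map_add, map_smul, h, h', smul_zero, add_zero]
    rwa [← hx] at h1
  · exact add_pos_of_pos_of_nonneg (hb.pos m u hcu h) (hnn v hcv)

theorem weightForm_weightHom (m : ℤ) (a : ℂˣ) (x y : Cx V) :
    bilinQ (b m) x ((H.weightHom a).1 y) = ((a ^ m : ℂˣ) : ℂ) * bilinQ (b m) x y := by
  rw [← hb.proj m x y, ← hb.proj m x]
  have h1 : H.weightProj m ((H.weightHom a).1 y) = (H.weightHom a).1 (H.weightProj m y) :=
    H.weightProj_h m _ y
  rw [h1, H.weightHom_apply a (H.weightProj_mem m y), map_smul, smul_eq_mul]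

theorem exists_form_ne_zero {m : ℤ} (hm : m ∈ H.weights) : ∃ v w : V, b m v w ≠ 0 := by
  by_contra hcon
  push Not at hcon
  have h0 : b m = 0 := by ext v w; exact hcon v w
  have : ∃ x, H.weightProj m x ≠ 0 := by
    by_contra hc
    push Not at hc
    exact H.weightProj_ne_zero hm (LinearMap.ext hc)
  obtain ⟨x, hx⟩ := this
  have h1 := (weightForm_self_nonneg hb m x).2 hx
  have h2 : ∀ x y, bilinQ (b m) x y = 0 := fun x y => by
    rw [← bilinQFun_apply, h0, map_zero]; rfl
  rw [weightForm, h2] at h1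
  exact lt_irrefl _ h1

/-- The Mumford–Tate group acts on the forms through characters defined over `ℚ`. -/
theorem exists_character {m : ℤ} (hm : m ∈ H.weights) : ∃ χ ∈ polyFunctions V ℚ,
    ∀ g ∈ H.mumfordTate, χ g ≠ 0 ∧
      ∀ x y, bilinQ (b m) (g.1 x) (g.1 y) = χ g * bilinQ (b m) x y := by
  obtain ⟨v₀, w₀, h0⟩ := exists_form_ne_zero hb hm
  have h0' : (b m v₀ w₀ : ℂ) ≠ 0 := by exact_mod_cast h0
  have hle : H.mumfordTate ≤ similitudes (b m) :=
    H.mumfordTate_le (isZariskiClosed_similitudes h0) fun z =>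
      ⟨_, Units.ne_zero _, hb.equivariant m z⟩
  refine ⟨(b m v₀ w₀)⁻¹ • formCoeff (b m) v₀ w₀,
    Subalgebra.smul_mem _ (formCoeff_mem (b m) v₀ w₀) _, fun g hg => ?_⟩
  obtain ⟨c, hc, h⟩ := mem_similitudes.1 (hle hg)
  have hce : ((b m v₀ w₀)⁻¹ • formCoeff (b m) v₀ w₀) g = c := by
    rw [Pi.smul_apply, formCoeff, h, bilinQ_tmul, Rat.smul_def]
    push_cast
    field_simp
  rw [hce]
  exact ⟨hc, h⟩

end Family

end RationalHodgeStructure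

end HodgeMT

namespace HodgeMT

namespace RationalHodgeStructure

open scoped ComplexOrder Matrix
open Topology

variable {V : Type*} [AddCommGroup V] [Module ℚ V] [Module.Finite ℚ V]
  {H : RationalHodgeStructure V}

/-! ### The multipliers of the polarization forms -/

omit [Module.Finite ℚ V] in
/-- Two rational characters of the Mumford–Tate group that agree on `h(𝕊)` are equal. -/
theorem character_eq {c c' : GLC V → ℂ} (hc : c ∈ polyFunctions V ℚ) (hc' : c' ∈ polyFunctions V ℚ)
    (hmul : ∀ g ∈ H.mumfordTate, ∀ g' ∈ H.mumfordTate, c (g * g') = c g * c g')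
    (hmul' : ∀ g ∈ H.mumfordTate, ∀ g' ∈ H.mumfordTate, c' (g * g') = c' g * c' g')
    (hne : ∀ g ∈ H.mumfordTate, c g ≠ 0) (hh : ∀ z, c (H.h z) = c' (H.h z))
    {g : GLC V} (hg : g ∈ H.mumfordTate) : c g = c' g := by
  have h1 : c 1 = 1 := by
    have := hmul 1 (one_mem _) 1 (one_mem _)
    rw [one_mul] at this
    exact mul_left_cancel₀ (hne 1 (one_mem _)) (by rw [← this, mul_one])
  have h1' : c' 1 = 1 := by rw [← map_one H.h, ← hh, map_one, h1]
  -- The two characters agree on a subgroup closed over `ℚ` that contains `h(𝕊)`, hence on all of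
  -- `G`.
  let K : Subgroup (GLC V) :=
    { carrier := (H.mumfordTate : Set (GLC V)) ∩ {g | c g = c' g}
      one_mem' := ⟨one_mem _, h1.trans h1'.symm⟩
      mul_mem' := fun {a b} ha hb => ⟨mul_mem ha.1 hb.1, by
        rw [Set.mem_ofPred_eq, hmul _ ha.1 _ hb.1, hmul' _ ha.1 _ hb.1, ha.2, hb.2]⟩
      inv_mem' := fun {a} ha => ⟨inv_mem ha.1, by
        have e := hmul _ ha.1 _ (inv_mem ha.1)
        have e' := hmul' _ ha.1 _ (inv_mem ha.1)
        rw [mul_inv_cancel, h1] at e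
        rw [mul_inv_cancel, h1', ← ha.2] at e'
        exact mul_left_cancel₀ (hne a ha.1) (e.symm.trans e')⟩ }
  have hK : IsZariskiClosed ℚ (K : Set (GLC V)) :=
    H.mumfordTate_isZariskiClosed.inter (isZariskiClosed_eq hc hc')
  exact (H.mumfordTate_le hK (fun z => ⟨H.h_mem_mumfordTate z, hh z⟩) hg).2

variable {b : ℤ → V →ₗ[ℚ] V →ₗ[ℚ] ℚ}

/-- The multipliers of an element of the Mumford–Tate group on the polarization forms have
absolute values `exp (m ℓ)`. -/
theorem IsPolarizingFamily.exists_multipliers (hb : H.IsPolarizingFamily b) {g : GLC V}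
    (hg : g ∈ H.mumfordTate) : ∃ (c : ℤ → ℂ) (l : ℝ), ∀ m ∈ H.weights,
      (∀ x y, bilinQ (b m) (g.1 x) (g.1 y) = c m * bilinQ (b m) x y) ∧
      ‖c m‖ = Real.exp (m * l) := by
  have hex : ∀ m, ∃ χ ∈ polyFunctions V ℚ, m ∈ H.weights → ∀ g ∈ H.mumfordTate, χ g ≠ 0 ∧
      ∀ x y, bilinQ (b m) (g.1 x) (g.1 y) = χ g * bilinQ (b m) x y := by
    intro m
    by_cases hm : m ∈ H.weights
    · obtain ⟨χ, h1, h2⟩ := exists_character hb hm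
      exact ⟨χ, h1, fun _ => h2⟩
    · exact ⟨0, zero_mem _, fun h => absurd h hm⟩
  choose χ hχ hχg using hex
  have hval : ∀ m ∈ H.weights, ∀ g ∈ H.mumfordTate, ∀ c : ℂ,
      (∀ x y, bilinQ (b m) (g.1 x) (g.1 y) = c * bilinQ (b m) x y) → χ m g = c := by
    intro m hm g hg c hc
    obtain ⟨v, w, h0⟩ := exists_form_ne_zero hb hm
    have h0' : bilinQ (b m) (1 ⊗ₜ[ℚ] v) (1 ⊗ₜ[ℚ] w) ≠ 0 := by simpa using h0
    exact mul_right_cancel₀ h0' ((((hχg m hm g hg).2 _ _).symm).trans (hc _ _))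
  have hmul : ∀ m ∈ H.weights, ∀ g ∈ H.mumfordTate, ∀ g' ∈ H.mumfordTate,
      χ m (g * g') = χ m g * χ m g' := by
    intro m hm g hg g' hg'
    refine hval m hm _ (mul_mem hg hg') _ fun x y => ?_
    rw [Units.val_mul, Module.End.mul_apply, Module.End.mul_apply, (hχg m hm g hg).2,
      (hχg m hm g' hg').2, mul_assoc]
  have hh : ∀ m ∈ H.weights, ∀ z, χ m (H.h z) = (((z.1 * z.2) ^ (-m) : ℂˣ) : ℂ) :=
    fun m hm z => hval m hm _ (H.h_mem_mumfordTate z) _ (hb.equivariant m z)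
  have hzero : (0 : ℤ) ∈ H.weights → χ 0 g = 1 := by
    intro h0
    refine character_eq (hχ 0) (one_mem _) (hmul 0 h0) (fun _ _ _ _ => (one_mul 1).symm)
      (fun g hg => (hχg 0 h0 g hg).1) (fun z => ?_) hg
    rw [hh 0 h0, neg_zero, zpow_zero]
    rfl
  -- This is `χ_m ^ n = χ_n ^ m`, which holds on `h(𝕊)` as both sides are `(z₁ z₂) ^ (-mn)`.
  -- Exponents are split into positive and negative parts to keep both sides polynomial.
  have hrel : ∀ m ∈ H.weights, ∀ n ∈ H.weights,
      χ m g ^ n.toNat * χ n g ^ (-m).toNat = χ n g ^ m.toNat * χ m g ^ (-n).toNat := by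
    intro m hm n hn
    refine character_eq (c := χ m ^ n.toNat * χ n ^ (-m).toNat)
      (c' := χ n ^ m.toNat * χ m ^ (-n).toNat)
      (mul_mem (pow_mem (hχ m) _) (pow_mem (hχ n) _))
      (mul_mem (pow_mem (hχ n) _) (pow_mem (hχ m) _)) ?_ ?_ ?_ ?_ hg
    · intro g hg g' hg'
      simp only [Pi.mul_apply, Pi.pow_apply, hmul m hm g hg g' hg', hmul n hn g hg g' hg']
      ring
    · intro g hg g' hg'
      simp only [Pi.mul_apply, Pi.pow_apply, hmul m hm g hg g' hg', hmul n hn g hg g' hg']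
      ring
    · intro g hg
      exact mul_ne_zero (pow_ne_zero _ (hχg m hm g hg).1) (pow_ne_zero _ (hχg n hn g hg).1)
    · intro z
      simp only [Pi.mul_apply, Pi.pow_apply, hh m hm, hh n hn]
      rw [← Units.val_pow_eq_pow_val, ← Units.val_pow_eq_pow_val, ← Units.val_pow_eq_pow_val,
        ← Units.val_pow_eq_pow_val, ← Units.val_mul, ← Units.val_mul]
      simp only [← zpow_natCast, ← zpow_mul, ← zpow_add]
      congr 2
      have e1 : ((n.toNat : ℤ)) - (-n).toNat = n := by omega
      have e2 : ((m.toNat : ℤ)) - (-m).toNat = m := by omega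
      linear_combination (-m) * e1 + n * e2
  have hpos : ∀ m ∈ H.weights, 0 < ‖χ m g‖ := fun m hm => norm_pos_iff.2 (hχg m hm g hg).1
  have hlog : ∀ m ∈ H.weights, ∀ n ∈ H.weights,
      (n : ℝ) * Real.log ‖χ m g‖ = m * Real.log ‖χ n g‖ := by
    intro m hm n hn
    have h1 := congrArg (fun z => Real.log ‖z‖) (hrel m hm n hn)
    simp only [norm_mul, norm_pow] at h1
    have hm' := (hpos m hm).ne'
    have hn' := (hpos n hn).ne'
    rw [Real.log_mul (pow_ne_zero _ hm') (pow_ne_zero _ hn'),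
      Real.log_mul (pow_ne_zero _ hn') (pow_ne_zero _ hm'), Real.log_pow, Real.log_pow,
      Real.log_pow, Real.log_pow] at h1
    have e1 : ((n.toNat : ℝ)) - (-n).toNat = n := by
      have : ((n.toNat : ℤ)) - (-n).toNat = n := by omega
      exact_mod_cast congrArg (Int.cast : ℤ → ℝ) this
    have e2 : ((m.toNat : ℝ)) - (-m).toNat = m := by
      have : ((m.toNat : ℤ)) - (-m).toNat = m := by omega
      exact_mod_cast congrArg (Int.cast : ℤ → ℝ) this
    linear_combination h1 - Real.log ‖χ m g‖ * e1 + Real.log ‖χ n g‖ * e2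
  have hl : ∃ l : ℝ, ∀ m ∈ H.weights, ‖χ m g‖ = Real.exp (m * l) := by
    by_cases hn : ∃ n ∈ H.weights, n ≠ 0
    · obtain ⟨n, hn, hn0⟩ := hn
      have hn0' : (n : ℝ) ≠ 0 := by exact_mod_cast hn0
      -- Any nonzero weight determines `l`; if `0` is the only weight, the character is trivial and
      -- `l = 0` works.
      refine ⟨Real.log ‖χ n g‖ / n, fun m hm => ?_⟩
      rw [← mul_div_assoc, ← hlog m hm n hn, mul_div_cancel_left₀ _ hn0',
        Real.exp_log (hpos m hm)]
    · push Not at hn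
      refine ⟨0, fun m hm => ?_⟩
      obtain rfl := hn m hm
      rw [hzero hm, norm_one, mul_zero, Real.exp_zero]
  obtain ⟨l, hl⟩ := hl
  exact ⟨fun m => χ m g, l, fun m hm => ⟨(hχg m hm g hg).2, hl m hm⟩⟩

/-! ### The hermitian form -/

/-- The hermitian form on `V_ℂ` defined by polarizations of the `V_m`. -/
def hermForm (H : RationalHodgeStructure V) (b : ℤ → V →ₗ[ℚ] V →ₗ[ℚ] ℚ) (x y : Cx V) : ℂ :=
  ∑ m ∈ H.weights, weightForm H b m x y

theorem IsPolarizingFamily.hermForm_pos (hb : H.IsPolarizingFamily b) {x : Cx V} (hx : x ≠ 0) :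
    0 < hermForm H b x x := by
  refine Finset.sum_pos' (fun m _ => (weightForm_self_nonneg hb m x).1) ?_
  by_contra hcon
  push Not at hcon
  apply hx
  rw [← H.sum_weightProj_apply x]
  refine Finset.sum_eq_zero fun m hm => ?_
  by_contra h
  exact hcon m hm ((weightForm_self_nonneg hb m x).2 h)

theorem hermForm_eq_sum (x y : Cx V) : hermForm H b x y =
    ∑ i, ∑ j, coord x i * star (coord y j) * hermForm H b (basisC V i) (basisC V j) := by
  have hx : ∀ x : Cx V, x = ∑ i, coord x i • basisC V i := fun x => ((basisC V).sum_repr x).symm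
  have hm : ∀ m, weightForm H b m x y =
      ∑ i, ∑ j, coord x i * star (coord y j) * weightForm H b m (basisC V i) (basisC V j) := by
    intro m
    simp only [weightForm]
    conv_lhs => rw [hx x, hx y]
    simp only [map_sum, LinearEquiv.map_smulₛₗ, map_smul, LinearMap.sum_apply,
      LinearMap.smul_apply, smul_eq_mul, Finset.mul_sum]
    rw [Finset.sum_comm]
    refine Finset.sum_congr rfl fun i _ => Finset.sum_congr rfl fun j _ => ?_
    rw [← starRingEnd_apply]
    ring
  simp only [hermForm, hm, Finset.mul_sum]
  rw [Finset.sum_comm]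
  refine Finset.sum_congr rfl fun i _ => ?_
  rw [Finset.sum_comm]

theorem continuous_coord_apply (x : Cx V) : Continuous fun g : GLC V => coord (g.1 x) := by
  simp only [← mat_mulVec_coord]
  exact continuous_mat.matrix_mulVec continuous_const

/-- A positive definite form attains a positive minimum on the compact unit sphere, and quadratic
scaling extends the bound. The sphere is empty when `V = 0`. -/
theorem IsPolarizingFamily.exists_lower_bound (hb : H.IsPolarizingFamily b) :
    ∃ δ > 0, ∀ x, δ * ‖coord x‖ ^ 2 ≤ (hermForm H b x x).re := by
  let n := Module.finrank ℚ V
  let F : (Fin n → ℂ) → ℝ := fun v =>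
    (∑ i, ∑ j, v i * star (v j) * hermForm H b (basisC V i) (basisC V j)).re
  have hF : Continuous F := by
    refine Complex.continuous_re.comp ?_
    fun_prop
  have hFx : ∀ x, F (coord x) = (hermForm H b x x).re := fun x => by rw [hermForm_eq_sum]
  have hsurj : ∀ v, ∃ x : Cx V, coord x = v := fun v =>
    ⟨(basisC V).equivFun.symm v, (basisC V).equivFun.apply_symm_apply v⟩
  have hc0 : coord (0 : Cx V) = 0 := by
    change ⇑((basisC V).repr 0) = 0
    rw [map_zero]; rfl
  have hpos : ∀ v, v ≠ 0 → 0 < F v := by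
    intro v hv
    obtain ⟨x, rfl⟩ := hsurj v
    rw [hFx]
    refine (Complex.pos_iff.1 (hb.hermForm_pos fun h => hv ?_)).1
    rw [h, hc0]
  have hhom : ∀ (r : ℝ) v, F ((r : ℂ) • v) = r ^ 2 * F v := by
    intro r v
    have : (∑ i, ∑ j, ((r : ℂ) • v) i * star (((r : ℂ) • v) j) *
        hermForm H b (basisC V i) (basisC V j)) = ((r ^ 2 : ℝ) : ℂ) *
        ∑ i, ∑ j, v i * star (v j) * hermForm H b (basisC V i) (basisC V j) := by
      simp only [Finset.mul_sum, Pi.smul_apply, smul_eq_mul, ← starRingEnd_apply, map_mul,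
        Complex.conj_ofReal]
      refine Finset.sum_congr rfl fun i _ => Finset.sum_congr rfl fun j _ => ?_
      push_cast
      ring
    simp only [F]
    rw [this, Complex.re_ofReal_mul]
  by_cases hne : (Metric.sphere (0 : Fin n → ℂ) 1).Nonempty
  · obtain ⟨v₀, hv₀, hmin⟩ := (isCompact_sphere (0 : Fin n → ℂ) 1).exists_isMinOn hne hF.continuousOn
    have hv₀0 : v₀ ≠ 0 := by
      rintro rfl
      simp at hv₀
    refine ⟨F v₀, hpos v₀ hv₀0, fun x => ?_⟩
    by_cases hx : coord x = 0
    · rw [hx, norm_zero, zero_pow two_ne_zero, mul_zero, ← hFx, hx]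
      have := hhom 0 0
      simp at this
      rw [this]
    · have hn : ‖coord x‖ ≠ 0 := norm_ne_zero_iff.2 hx
      have hu : ((‖coord x‖⁻¹ : ℝ) : ℂ) • coord x ∈ Metric.sphere (0 : Fin n → ℂ) 1 := by
        rw [mem_sphere_zero_iff_norm, norm_smul, Complex.norm_real, norm_inv, norm_norm,
          inv_mul_cancel₀ hn]
      have h1 := hmin hu
      rw [Set.mem_ofPred_eq, hhom, hFx, inv_pow] at h1
      rw [mul_comm]
      have h2 : 0 < ‖coord x‖ ^ 2 := by positivity
      rwa [← div_eq_inv_mul, le_div_iff₀' h2] at h1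
  · refine ⟨1, one_pos, fun x => ?_⟩
    have hx : coord x = 0 := by
      by_contra hx
      have hn : ‖coord x‖ ≠ 0 := norm_ne_zero_iff.2 hx
      refine hne ⟨((‖coord x‖⁻¹ : ℝ) : ℂ) • coord x, ?_⟩
      rw [mem_sphere_zero_iff_norm, norm_smul, Complex.norm_real, norm_inv, norm_norm,
        inv_mul_cancel₀ hn]
    have := hhom 0 0
    simp at this
    rw [← hFx, hx, norm_zero, this]
    norm_num

/-- The elements of the Mumford–Tate group that are unitary for the hermitian form. -/
def unitaryMT (H : RationalHodgeStructure V) (b : ℤ → V →ₗ[ℚ] V →ₗ[ℚ] ℚ) : Subgroup (GLC V) where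
  carrier := {g | g ∈ H.mumfordTate ∧ ∀ x y, hermForm H b (g.1 x) (g.1 y) = hermForm H b x y}
  one_mem' := ⟨one_mem _, fun _ _ => rfl⟩
  mul_mem' := fun {g g'} hg hg' => ⟨mul_mem hg.1 hg'.1, fun x y => by
    rw [Units.val_mul, Module.End.mul_apply, Module.End.mul_apply, hg.2, hg'.2]⟩
  inv_mem' := fun {g} hg => ⟨inv_mem hg.1, fun x y => by
    rw [← hg.2, glc_apply_inv_apply, glc_apply_inv_apply]⟩

theorem isClosed_unitaryMT : IsClosed (unitaryMT H b : Set (GLC V)) := by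
  have h : (unitaryMT H b : Set (GLC V)) = (H.mumfordTate : Set (GLC V)) ∩ ⋂ x : Cx V, ⋂ y : Cx V,
      {g : GLC V | hermForm H b (g.1 x) (g.1 y) = hermForm H b x y} := by
    ext g
    simp only [Set.mem_inter_iff, Set.mem_iInter]
    rfl
  rw [h]
  refine H.mumfordTate_isZariskiClosed.complex.isClosed.inter
    (isClosed_iInter fun x => isClosed_iInter fun y => isClosed_eq ?_ continuous_const)
  have h : (fun g : GLC V => hermForm H b (g.1 x) (g.1 y)) = fun g => ∑ i, ∑ j,
      coord (g.1 x) i * star (coord (g.1 y) j) * hermForm H b (basisC V i) (basisC V j) :=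
    funext fun g => hermForm_eq_sum _ _
  rw [h]
  have h1 := continuous_coord_apply x
  have h2 := continuous_coord_apply y
  fun_prop

/-- A column of `g` has the same hermitian length as the corresponding basis vector, so definiteness
bounds the entries; inverses lie in the same group. -/
theorem IsPolarizingFamily.isCompact_unitaryMT (hb : H.IsPolarizingFamily b) :
    IsCompact (unitaryMT H b : Set (GLC V)) := by
  obtain ⟨δ, hδ, hlow⟩ := hb.exists_lower_bound
  set R := ∑ j, (hermForm H b (basisC V j) (basisC V j)).re with hR
  have hbd : ∀ g ∈ unitaryMT H b, ∀ i j, ‖mat g.1 i j‖ ≤ Real.sqrt (R / δ) := by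
    intro g hg i j
    rw [mat_entry]
    refine (norm_le_pi_norm _ i).trans (Real.le_sqrt_of_sq_le ?_)
    rw [le_div_iff₀' hδ]
    refine (hlow _).trans ?_
    rw [hg.2, hR]
    refine Finset.single_le_sum (f := fun j => (hermForm H b (basisC V j) (basisC V j)).re)
      (fun j _ => ?_) (Finset.mem_univ j)
    exact le_trans (by positivity) (hlow (basisC V j))
  exact isCompact_of_bounded isClosed_unitaryMT _ hbd fun g hg => hbd _ (inv_mem hg)

end RationalHodgeStructure

end HodgeMT

namespace HodgeMT

namespace RationalHodgeStructure

open scoped ComplexOrder Matrix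
open Topology

variable {V : Type*} [AddCommGroup V] [Module ℚ V] [Module.Finite ℚ V]
  {H : RationalHodgeStructure V}

/-! ### Cartan involutions from polarizations -/

-- This links the twisted conjugation to the hermitian forms: moving `g` across `x ↦ C x̄` replaces
-- it by `τ(g)`.
omit [Module.Finite ℚ V] in
theorem weilOperator_conj_apply (H : RationalHodgeStructure V) (g : GLC V) (x : Cx V) :
    H.weilOperator.1 (conj (g.1 x)) = (H.twist g).1 (H.weilOperator.1 (conj x)) := by
  have h1 : (conjGL g).1 (conj x) = conj (g.1 x) := by rw [conjGL_apply, conj_conj]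
  have h2 : H.twist g * H.weilOperator = H.weilOperator * conjGL g := by
    rw [twist_apply, inv_mul_cancel_right]
  have h3 := congrArg (fun u : GLC V => u.1 (conj x)) h2
  simp only [Units.val_mul, Module.End.mul_apply, h1] at h3
  exact h3.symm

theorem weightHom_eq_of_pow_eq (H : RationalHodgeStructure V) {a a' : ℂˣ}
    (h : ∀ m ∈ H.weights, ((a ^ m : ℂˣ) : ℂ) = ((a' ^ m : ℂˣ) : ℂ)) :
    H.weightHom a = H.weightHom a' := by
  apply Units.ext
  rw [← mul_one (H.weightHom a).1, ← mul_one (H.weightHom a').1, ← H.sum_weightProj,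
    Finset.mul_sum, Finset.mul_sum]
  refine Finset.sum_congr rfl fun m hm => ?_
  rw [weightHom_mul_weightProj, weightHom_mul_weightProj, h m hm]

theorem pow_eq_one_of_weightHom_eq_one (H : RationalHodgeStructure V) {a : ℂˣ}
    (h : H.weightHom a = 1) {m : ℤ} (hm : m ∈ H.weights) : ((a ^ m : ℂˣ) : ℂ) = 1 := by
  have h1 := H.weightHom_mul_weightProj a m
  rw [h, Units.val_one, one_mul] at h1
  have h2 : (1 : ℂ) • H.weightProj m = ((a ^ m : ℂˣ) : ℂ) • H.weightProj m := by rwa [one_smul]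
  exact (smul_left_injective ℂ (H.weightProj_ne_zero hm) h2).symm

omit [Module.Finite ℚ V] in
theorem weightHom_expUnit (H : RationalHodgeStructure V) (s : ℂ) :
    H.weightHom (expUnit s) = H.conjExp (RingEquiv.refl ℂ) (-s, -s) := by
  have h : ∀ g : GLC V, gamGL (RingEquiv.refl ℂ) g = g := fun g => by
    apply Units.ext
    apply LinearMap.ext
    intro x
    rw [gamGL_apply]
    change gam (RingEquiv.refl ℂ) (g.1 (gam (RingEquiv.refl ℂ) x)) = _
    rw [gam_refl, gam_refl]
  rw [conjExp, h, expUnit_neg]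
  rfl

/-- If `g = τ(g) w(a)` for the twisted conjugation `τ`, then `a` can be chosen of absolute value
one. -/
theorem weightHom_eq_exp_arg (H : RationalHodgeStructure V) {g : GLC V} (hg : g ∈ H.mumfordTate)
    {a : ℂˣ} (ha : g = H.twist g * H.weightHom a) :
    H.weightHom a = H.weightHom (expUnit ((Complex.arg a : ℂ) * Complex.I)) := by
  -- Applying `τ` to the relation and substituting back gives `w_h(ā a) = 1`; so `|a| ^ m = 1` for
  -- each weight `m`, and only the argument of `a` matters.
  have h1 : H.weightHom (Units.map (starRingEnd ℂ : ℂ →* ℂ) a * a) = 1 := by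
    have h2 : H.twist g = g * H.weightHom (Units.map (starRingEnd ℂ : ℂ →* ℂ) a) := by
      conv_lhs => rw [ha, map_mul, H.twist_twist hg, twist_weightHom]
    rw [h2, mul_assoc, ← map_mul] at ha
    exact mul_eq_left.1 ha.symm
  refine H.weightHom_eq_of_pow_eq fun m hm => ?_
  have h3 := H.pow_eq_one_of_weightHom_eq_one h1 hm
  have h4 : ‖(a : ℂ)‖ ^ m = 1 := by
    have h5 := congrArg (fun z : ℂ => ‖z‖) h3
    simp only [Units.val_zpow_eq_zpow_val, Units.val_mul, norm_zpow, norm_mul, norm_one] at h5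
    have h6 : ‖((Units.map (starRingEnd ℂ : ℂ →* ℂ) a : ℂˣ) : ℂ)‖ = ‖(a : ℂ)‖ :=
      Complex.norm_conj _
    rw [h6, mul_zpow] at h5
    have h7 : 0 ≤ ‖(a : ℂ)‖ ^ m := by positivity
    nlinarith
  rw [Units.val_zpow_eq_zpow_val, Units.val_zpow_eq_zpow_val]
  conv_lhs => rw [← Complex.norm_mul_exp_arg_mul_I (a : ℂ)]
  rw [mul_zpow, ← Complex.ofReal_zpow, h4, Complex.ofReal_one, one_mul]
  rfl

variable {b : ℤ → V →ₗ[ℚ] V →ₗ[ℚ] ℚ}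

/-- If `g = τ(g) w(a)` for the twisted conjugation `τ`, then some multiple `g w(t)` with `t > 0`
is unitary. -/
theorem IsPolarizingFamily.exists_unitary (hb : H.IsPolarizingFamily b) {g : GLC V}
    (hg : g ∈ H.mumfordTate) {a : ℂˣ} (ha : g = H.twist g * H.weightHom a) :
    ∃ s : ℝ, g * H.weightHom (expUnit s) ∈ unitaryMT H b := by
  obtain ⟨c, l, hc⟩ := hb.exists_multipliers hg
  have htw : H.twist g = g * H.weightHom a⁻¹ := by
    rw [map_inv, eq_mul_inv_iff_mul_eq]; exact ha.symm
  have hform : ∀ m ∈ H.weights, ∀ x y, weightForm H b m (g.1 x) (g.1 y) =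
      c m * ((a⁻¹ ^ m : ℂˣ) : ℂ) * weightForm H b m x y := by
    intro m hm x y
    rw [weightForm, weilOperator_conj_apply, htw, Units.val_mul, Module.End.mul_apply,
      (hc m hm).1, weightForm_weightHom hb, mul_assoc]
    rfl
  -- The scaling factor on weight `m` is a ratio of two positive values of the form, so it is
  -- positive and equals its absolute value `exp (m k)`.
  set k : ℝ := l - Real.log ‖(a : ℂ)‖ with hk
  have hr : ∀ m ∈ H.weights, c m * ((a⁻¹ ^ m : ℂˣ) : ℂ) = Complex.exp (m * k) := by
    intro m hm
    have hna : 0 < ‖(a : ℂ)‖ := norm_pos_iff.2 a.ne_zero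
    have hn : ‖c m * ((a⁻¹ ^ m : ℂˣ) : ℂ)‖ = Real.exp (m * k) := by
      rw [norm_mul, (hc m hm).2, Units.val_zpow_eq_zpow_val, Units.val_inv_eq_inv_val,
        norm_zpow, norm_inv, ← Real.exp_log hna, ← Real.exp_neg, ← Real.rpow_intCast,
        ← Real.exp_mul, ← Real.exp_add, hk]
      congr 1
      ring
    obtain ⟨x, hx⟩ : ∃ x, H.weightProj m x ≠ 0 := by
      by_contra hcon
      push Not at hcon
      exact H.weightProj_ne_zero hm (LinearMap.ext hcon)
    have hgx : H.weightProj m (g.1 x) ≠ 0 := by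
      have := LinearMap.congr_fun (H.commute_weightProj hg m).eq x
      rw [Module.End.mul_apply, Module.End.mul_apply] at this
      rw [← this]
      intro h0
      exact hx ((LinearMap.GeneralLinearGroup.toLinearEquiv g).injective
        (h0.trans (map_zero g.1).symm))
    have hA := (weightForm_self_nonneg hb m _).2 hgx
    have hB := (weightForm_self_nonneg hb m _).2 hx
    have hAB := hform m hm x x
    have heq : c m * ((a⁻¹ ^ m : ℂˣ) : ℂ) =
        ((‖weightForm H b m (g.1 x) (g.1 x)‖ / ‖weightForm H b m x x‖ : ℝ) : ℂ) := by
      rw [Complex.ofReal_div, ← Complex.eq_coe_norm_of_nonneg hA.le,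
        ← Complex.eq_coe_norm_of_nonneg hB.le, hAB, mul_div_cancel_right₀ _ hB.ne']
    have h0 : 0 ≤ c m * ((a⁻¹ ^ m : ℂˣ) : ℂ) := by
      rw [heq]
      exact Complex.zero_le_real.2 (by positivity)
    rw [Complex.eq_coe_norm_of_nonneg h0, hn]
    push_cast
    rfl
  -- The element `w_h(e ^ (-k/2))` acts on both arguments of the form, so it contributes exactly
  -- `exp (-m k)`.
  refine ⟨-k / 2, mul_mem hg (H.h_mem_mumfordTate _), fun x y => ?_⟩
  set β := expUnit ((-k / 2 : ℝ) : ℂ) with hβ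
  refine Finset.sum_congr rfl fun m hm => ?_
  have hβc : Units.map (starRingEnd ℂ : ℂ →* ℂ) β = β := by
    apply Units.ext
    change starRingEnd ℂ (Complex.exp _) = Complex.exp _
    rw [← Complex.exp_conj, Complex.conj_ofReal]
  rw [Units.val_mul, Module.End.mul_apply, Module.End.mul_apply, hform m hm, hr m hm, weightForm,
    weilOperator_conj_apply, twist_weightHom, hβc]
  have h1 := hb.equivariant m (β⁻¹, β⁻¹) x (H.weilOperator.1 (conj y))
  change bilinQ (b m) ((H.weightHom β).1 x) ((H.weightHom β).1 (H.weilOperator.1 (conj y))) = _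
    at h1
  rw [h1, ← mul_assoc, weightForm]
  have h2 : Complex.exp (m * k) * (((β⁻¹ * β⁻¹) ^ (-m) : ℂˣ) : ℂ) = 1 := by
    rw [← mul_inv, inv_zpow', neg_neg, mul_zpow, Units.val_mul, hβ, expUnit_zpow,
      ← Complex.exp_add, ← Complex.exp_add]
    convert Complex.exp_zero using 2
    push_cast
    ring
  rw [h2, one_mul]

/-- Keeping the argument of `a` as a coordinate in a compact interval makes the relation a closed
condition on a compact product. -/
theorem IsPolarizingFamily.isCompact_twistFixed (hb : H.IsPolarizingFamily b) :
    IsCompact {p : GLC V × ℝ | p.1 ∈ unitaryMT H b ∧ p.2 ∈ Set.Icc (-Real.pi) Real.pi ∧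
      p.1 = H.twist p.1 * H.weightHom (expUnit ((p.2 : ℂ) * Complex.I))} := by
  have h : {p : GLC V × ℝ | p.1 ∈ unitaryMT H b ∧ p.2 ∈ Set.Icc (-Real.pi) Real.pi ∧
      p.1 = H.twist p.1 * H.weightHom (expUnit ((p.2 : ℂ) * Complex.I))} =
      ((unitaryMT H b : Set (GLC V)) ×ˢ Set.Icc (-Real.pi) Real.pi) ∩
        {p | p.1 = H.twist p.1 * H.weightHom (expUnit ((p.2 : ℂ) * Complex.I))} := by
    ext p
    exact and_assoc.symm
  rw [h]
  refine (hb.isCompact_unitaryMT.prod isCompact_Icc).inter_right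
    (isClosed_eq continuous_fst ((H.continuous_twist.comp continuous_fst).mul ?_))
  simp only [weightHom_expUnit]
  exact (H.continuous_conjExp _).comp (by fun_prop)

/-- The algebraic conditions hold because `C` is real and `C²` is a weight. A class fixed by the
twist is represented by `g = τ(g) w_h(a)`, which can be made unitary with `a` on the unit circle; so
the fixed set is a continuous image of a compact set. -/
theorem sv2Star_of_isPolarizable (hH : H.IsPolarizable) : H.SV2Star := by
  obtain ⟨b, hb⟩ := H.exists_polarizingFamily hH
  let C : H.mumfordTate := ⟨H.weilOperator, H.h_mem_mumfordTate _⟩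
  have hC2 : (QuotientGroup.mk C * QuotientGroup.mk C : H.MTModWeight) = 1 := by
    rw [← QuotientGroup.mk_mul, QuotientGroup.eq_one_iff, weightSubgroup, Subgroup.mem_subgroupOf]
    exact ⟨-1, H.weilOperator_mul_self.symm⟩
  have hCconj : H.quotConj (QuotientGroup.mk C) = QuotientGroup.mk C := by
    change QuotientGroup.mk (H.mtConj C) = _
    congr 1
    exact Subtype.ext H.conjGL_weilOperator
  refine ⟨fun q => ?_, fun q => ?_, ?_⟩
  · rw [← MulAut.mul_apply, ← map_mul]
    rw [show (QuotientGroup.mk _ * QuotientGroup.mk _ : H.MTModWeight) = 1 from hC2, map_one]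
    rfl
  · simp only [MulAut.conj_apply, map_mul, map_inv]
    rw [show H.quotConj (QuotientGroup.mk _) = _ from hCconj]
  · set T := {p : GLC V × ℝ | p.1 ∈ unitaryMT H b ∧ p.2 ∈ Set.Icc (-Real.pi) Real.pi ∧
      p.1 = H.twist p.1 * H.weightHom (expUnit ((p.2 : ℂ) * Complex.I))} with hT
    have hcomp : CompactSpace T := isCompact_iff_compactSpace.1 hb.isCompact_twistFixed
    let f : T → H.MTModWeight := fun p => QuotientGroup.mk (⟨p.1.1, p.2.1.1⟩ : H.mumfordTate)
    have hf : Continuous f := by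
      refine continuous_quotient_mk'.comp (Continuous.subtype_mk ?_ _)
      exact continuous_fst.comp continuous_subtype_val
    have hfix : ∀ g : H.mumfordTate, (QuotientGroup.mk g : H.MTModWeight) =
        MulAut.conj (QuotientGroup.mk C : H.MTModWeight) (H.quotConj (QuotientGroup.mk g)) ↔
        ∃ a, g.1 = H.twist g.1 * H.weightHom a := by
      intro g
      have h1 : MulAut.conj (QuotientGroup.mk C : H.MTModWeight) (H.quotConj (QuotientGroup.mk g))
          = QuotientGroup.mk (⟨H.twist g.1, H.twist_mem g.2⟩ : H.mumfordTate) := rfl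
      rw [h1, eq_comm, QuotientGroup.eq, weightSubgroup, Subgroup.mem_subgroupOf]
      refine exists_congr fun a => ?_
      rw [eq_comm, Subgroup.coe_mul, Subgroup.coe_inv, inv_mul_eq_iff_eq_mul]
    convert isCompact_range hf using 1
    ext q
    constructor
    · intro hq
      obtain ⟨g, rfl⟩ := QuotientGroup.mk_surjective q
      obtain ⟨a, ha⟩ := (hfix g).1 hq
      obtain ⟨s, hs⟩ := hb.exists_unitary g.2 ha
      have hs' : Units.map (starRingEnd ℂ : ℂ →* ℂ) (expUnit (s : ℂ)) = expUnit s := by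
        apply Units.ext
        change starRingEnd ℂ (Complex.exp _) = Complex.exp _
        rw [← Complex.exp_conj, Complex.conj_ofReal]
      refine ⟨⟨(g.1 * H.weightHom (expUnit s), Complex.arg a), hs,
        ⟨(Complex.neg_pi_lt_arg _).le, Complex.arg_le_pi _⟩, ?_⟩, ?_⟩
      · change g.1 * H.weightHom (expUnit s) = H.twist (g.1 * H.weightHom (expUnit s)) * _
        rw [← H.weightHom_eq_exp_arg g.2 ha, map_mul, twist_weightHom, hs', mul_assoc, ← map_mul,
          mul_comm (expUnit _), map_mul, ← mul_assoc, ← ha]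
      · change (QuotientGroup.mk _ : H.MTModWeight) = _
        rw [eq_comm, QuotientGroup.eq, weightSubgroup, Subgroup.mem_subgroupOf]
        refine ⟨expUnit s, ?_⟩
        rw [Subgroup.coe_mul, Subgroup.coe_inv, inv_mul_cancel_left]
    · rintro ⟨p, rfl⟩
      exact (hfix ⟨p.1.1, p.2.1.1⟩).2 ⟨_, p.2.2.2⟩

end RationalHodgeStructure

end HodgeMT

namespace HodgeMT

/-! ### Unipotent groups have fixed vectors -/

section Kolchin

open Polynomial

variable {K E : Type*} [Field K] [CharZero K] [AddCommGroup E] [Module K E] [Module.Finite K E]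

/-- Splitting the minimal polynomial as `X ^ k r` with `r` prime to `X` yields an idempotent `e`, a
multiple of `x` by a polynomial in `x`. Its trace vanishes, so in characteristic zero `e = 0`, and
then `x ^ k = 0`. -/
theorem isNilpotent_of_trace_aeval_eq_zero {x : Module.End K E}
    (h : ∀ p : K[X], LinearMap.trace K E (aeval x (p * X)) = 0) : IsNilpotent x := by
  have hm : minpoly K x ≠ 0 := minpoly.ne_zero (Algebra.IsIntegral.isIntegral x)
  obtain ⟨r, hr, hnd⟩ := exists_eq_pow_rootMultiplicity_mul_and_not_dvd (minpoly K x) hm 0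
  set k := rootMultiplicity 0 (minpoly K x)
  rw [C_0, sub_zero] at hr hnd
  -- The exponent `k + 1` makes `e` divisible by `x` even when `k = 0`.
  have hcop : IsCoprime (X ^ (k + 1) : K[X]) r :=
    ((irreducible_X.coprime_iff_not_dvd).2 hnd).pow_left
  obtain ⟨u, v, huv⟩ := hcop
  have h0 : aeval x (X ^ k * r) = 0 := by rw [← hr, minpoly.aeval]
  set e := aeval x (u * X ^ (k + 1)) with he
  have he1 : e + aeval x (v * r) = 1 := by rw [he, ← map_add, huv, map_one]
  have he2 : e * aeval x (v * r) = 0 := by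
    rw [he, ← map_mul, show u * X ^ (k + 1) * (v * r) = u * X * v * (X ^ k * r) by ring, map_mul,
      h0, mul_zero]
  have hid : IsIdempotentElem e := by
    rw [← eq_sub_iff_add_eq'] at he1
    rw [he1, mul_sub, mul_one, sub_eq_zero] at he2
    exact he2.symm
  have hez : e = 0 := by
    refine LinearMap.IsIdempotentElem.eq_zero_of_trace_eq_zero hid ?_
    rw [he, pow_succ, ← mul_assoc]
    exact h _
  rw [hez, zero_add] at he1
  refine ⟨k, ?_⟩
  rw [map_mul, map_pow, aeval_X] at h0
  rw [mul_comm v, map_mul] at he1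
  rw [← mul_one (x ^ k), ← he1, ← mul_assoc, h0, zero_mul]

attribute [local instance] LieRing.ofAssociativeRing

/-- Kolchin's theorem. -/
theorem exists_fixed_vector_of_unipotent [Nontrivial E] (S : Submonoid (Module.End K E))
    (hS : ∀ s ∈ S, IsNilpotent (s - 1)) : ∃ x : E, x ≠ 0 ∧ ∀ s ∈ S, s x = x := by
  -- This span is closed under products and consists of elements of trace zero. Hence all
  -- polynomials without constant term in its elements have trace zero, and its elements are
  -- nilpotent.
  let I : Submodule K (Module.End K E) := Submodule.span K ((fun s => s - 1) '' (S : Set _))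
  have hmem : ∀ s ∈ S, s - 1 ∈ I := fun s hs => Submodule.subset_span ⟨s, hs, rfl⟩
  have hmul : ∀ x ∈ I, ∀ y ∈ I, x * y ∈ I := by
    intro x hx y hy
    refine Submodule.span_induction₂ (p := fun x y _ _ => x * y ∈ I) ?_ ?_ ?_ ?_ ?_ ?_ ?_ hx hy
    · rintro _ _ ⟨s, hs, rfl⟩ ⟨t, ht, rfl⟩
      have : (s - 1) * (t - 1) = (s * t - 1) - (s - 1) - (t - 1) := by noncomm_ring
      rw [this]
      exact sub_mem (sub_mem (hmem _ (mul_mem hs ht)) (hmem _ hs)) (hmem _ ht)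
    · intro y _; rw [zero_mul]; exact zero_mem _
    · intro x _; rw [mul_zero]; exact zero_mem _
    · intro x y z _ _ _ h h'; rw [add_mul]; exact add_mem h h'
    · intro x y z _ _ _ h h'; rw [mul_add]; exact add_mem h h'
    · intro a x y _ _ h; rw [smul_mul_assoc]; exact Submodule.smul_mem _ _ h
    · intro a x y _ _ h; rw [mul_smul_comm]; exact Submodule.smul_mem _ _ h
  have htr : ∀ x ∈ I, LinearMap.trace K E x = 0 := by
    have : I ≤ LinearMap.ker (LinearMap.trace K E) := by
      rw [Submodule.span_le]
      rintro _ ⟨s, hs, rfl⟩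
      exact (LinearMap.isNilpotent_trace_of_isNilpotent (hS s hs)).eq_zero
    exact fun x hx => this hx
  have hnil : ∀ x ∈ I, IsNilpotent x := by
    intro x hx
    refine isNilpotent_of_trace_aeval_eq_zero fun p => htr _ ?_
    induction p using Polynomial.induction_on' with
    | add p q hp hq => rw [add_mul, map_add]; exact add_mem hp hq
    | monomial n a =>
      rw [← C_mul_X_pow_eq_monomial, mul_assoc, ← pow_succ, ← smul_eq_C_mul, map_smul, map_pow,
        aeval_X]
      refine Submodule.smul_mem _ _ ?_
      induction n with
      | zero => simpa using hx
      | succ n ih => rw [pow_succ]; exact hmul _ ih _ hx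
  let L : LieSubalgebra K (Module.End K E) :=
    { I with
      lie_mem' := fun {x y} hx hy => by
        rw [Ring.lie_def]
        exact sub_mem (hmul _ hx _ hy) (hmul _ hy _ hx) }
  -- Engel's theorem: a Lie algebra of nilpotent operators kills a nonzero vector, here a common
  -- fixed vector.
  have hL : LieModule.IsNilpotent L E := by
    rw [LieModule.isNilpotent_iff_forall' (R := K)]
    exact fun x => hnil x.1 x.2
  have := LieModule.nontrivial_max_triv_of_isNilpotent K L E
  obtain ⟨⟨x, hx⟩, hx0⟩ := exists_ne (0 : LieModule.maxTrivSubmodule K L E)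
  refine ⟨x, fun h => hx0 (Subtype.ext h), fun s hs => ?_⟩
  rw [LieModule.mem_maxTrivSubmodule] at hx
  have h1 : (s - 1) x = 0 := hx ⟨s - 1, hmem s hs⟩
  rw [LinearMap.sub_apply, Module.End.one_apply, sub_eq_zero] at h1
  exact h1

end Kolchin

namespace RationalHodgeStructure

open scoped ComplexOrder

variable {V : Type*} [AddCommGroup V] [Module ℚ V]

/-! ### Reductivity -/

/-- The vectors of `V_ℂ` fixed by a group. -/
def fixedVectors (N : Subgroup (GLC V)) : Submodule ℂ (Cx V) where
  carrier := {x | ∀ n ∈ N, n.1 x = x}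
  add_mem' := fun {x y} hx hy n hn => by rw [map_add, hx n hn, hy n hn]
  zero_mem' := fun n _ => map_zero n.1
  smul_mem' := fun a x hx n hn => by rw [map_smul, hx n hn]

theorem apply_mem_fixedVectors {N : Subgroup (GLC V)} {g : GLC V}
    (hN : ∀ n ∈ N, g⁻¹ * n * g ∈ N) {x : Cx V} (hx : x ∈ fixedVectors N) :
    g.1 x ∈ fixedVectors N := by
  intro n hn
  have h1 := hx _ (hN n hn)
  have h2 : g * (g⁻¹ * n * g) = n * g := by group
  have h3 := congrArg (fun u : GLC V => u.1 x) h2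
  simp only [Units.val_mul, Module.End.mul_apply] at h1 h3
  rw [← h3, h1]

variable {H : RationalHodgeStructure V} {b : ℤ → V →ₗ[ℚ] V →ₗ[ℚ] ℚ}

section Form

variable [Module.Finite ℚ V]

/-- The orthogonal complement with respect to the hermitian form. -/
def orthCompl (H : RationalHodgeStructure V) (b : ℤ → V →ₗ[ℚ] V →ₗ[ℚ] ℚ)
    (W : Submodule ℂ (Cx V)) : Submodule ℂ (Cx V) where
  carrier := {x | ∀ y ∈ W, hermForm H b x y = 0}
  add_mem' := fun {x x'} hx hx' y hy => by
    have h := congrArg₂ (· + ·) (hx y hy) (hx' y hy)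
    simpa only [hermForm, weightForm, map_add, LinearMap.add_apply, Finset.sum_add_distrib,
      add_zero] using h
  zero_mem' := fun y _ => by simp [hermForm, weightForm]
  smul_mem' := fun a x hx y hy => by
    have h := congrArg (a * ·) (hx y hy)
    simpa only [hermForm, weightForm, map_smul, LinearMap.smul_apply, smul_eq_mul, Finset.mul_sum,
      mul_zero] using h

/-- The weight spaces are mutually orthogonal, so projecting one argument selects one summand. -/
theorem IsPolarizingFamily.hermForm_weightProj (hb : H.IsPolarizingFamily b) {m : ℤ}
    (hm : m ∈ H.weights) (x y : Cx V) :
    hermForm H b x (H.weightProj m y) = weightForm H b m x y := by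
  have hC : ∀ k z, H.weightProj k (H.weilOperator.1 z) = H.weilOperator.1 (H.weightProj k z) :=
    fun k z => H.weightProj_h k _ z
  have h : ∀ k ∈ H.weights, weightForm H b k x (H.weightProj m y) =
      if k = m then weightForm H b m x y else 0 := by
    intro k _
    rw [weightForm, ← hb.proj, hC, ← weightProj_conj,
      H.weightProj_of_mem k (H.weightProj_mem m y)]
    split_ifs with hk hk' hk'
    · subst hk
      rw [weightForm, ← hb.proj _ x (H.weilOperator.1 (conj y)), hC, weightProj_conj]
    · exact absurd hk.symm hk'
    · exact absurd hk'.symm hk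
    · rw [map_zero, map_zero, map_zero]
  rw [hermForm, Finset.sum_congr rfl h, Finset.sum_ite_eq' H.weights m, if_pos hm]

/-- Up to multipliers the adjoint of `g` is `τ(g)⁻¹`, which lies in `G` and preserves `W`. The
multipliers depend on the weight, so orthogonality is tested weight by weight; this is why `W` is
required to be graded. -/
theorem IsPolarizingFamily.apply_mem_orthCompl (hb : H.IsPolarizingFamily b)
    {W : Submodule ℂ (Cx V)} (hW : ∀ g ∈ H.mumfordTate, ∀ y ∈ W, g.1 y ∈ W)
    (hproj : ∀ m, ∀ y ∈ W, H.weightProj m y ∈ W) {g : GLC V} (hg : g ∈ H.mumfordTate) {x : Cx V}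
    (hx : x ∈ orthCompl H b W) : g.1 x ∈ orthCompl H b W := by
  intro y hy
  obtain ⟨c, l, hc⟩ := hb.exists_multipliers hg
  set y' := (H.twist g⁻¹).1 y with hy'
  have hy'W : y' ∈ W := hW _ (H.twist_mem (inv_mem hg)) y hy
  have h1 : H.weilOperator.1 (conj y) = g.1 (H.weilOperator.1 (conj y')) := by
    rw [hy', weilOperator_conj_apply, H.twist_twist (inv_mem hg), glc_apply_inv_apply]
  refine Finset.sum_eq_zero fun m hm => ?_
  have h2 := hx _ (hproj m y' hy'W)
  rw [hb.hermForm_weightProj hm, weightForm] at h2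
  rw [weightForm, h1, (hc m hm).1, h2, mul_zero]

/-- Orthogonality to `W` amounts to `dim W` linear conditions, fewer than the dimension of `V_ℂ`. -/
theorem exists_mem_orthCompl_ne_zero {W : Submodule ℂ (Cx V)} (hW : W ≠ ⊤) :
    ∃ x ∈ orthCompl H b W, x ≠ 0 := by
  let e := Module.finBasis ℂ W
  let Φ : Cx V →ₗ[ℂ] (Fin (Module.finrank ℂ W) → ℂ) := LinearMap.pi fun i =>
    ∑ m ∈ H.weights, (bilinQ (b m)).flip (H.weilOperator.1 (conj (e i : Cx V)))
  have hΦ : ∀ x i, Φ x i = hermForm H b x (e i) := fun x i => by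
    simp only [Φ, LinearMap.pi_apply, LinearMap.sum_apply, LinearMap.flip_apply]
    rfl
  have hlt : Module.finrank ℂ (Fin (Module.finrank ℂ W) → ℂ) < Module.finrank ℂ (Cx V) := by
    rw [Module.finrank_fin_fun]
    exact Submodule.finrank_lt hW
  obtain ⟨x, hx, hx0⟩ := (Submodule.ne_bot_iff _).1 (LinearMap.ker_ne_bot_of_finrank_lt (f := Φ) hlt)
  refine ⟨x, fun y hy => ?_, hx0⟩
  have hs : y = ∑ i, e.repr ⟨y, hy⟩ i • (e i : Cx V) := by
    have := congrArg (W.subtype) (e.sum_repr ⟨y, hy⟩)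
    rw [map_sum] at this
    exact this.symm
  have hx' : ∀ i, hermForm H b x (e i) = 0 := fun i => by
    rw [← hΦ, LinearMap.mem_ker.1 hx]; rfl
  have hexp : hermForm H b x y = ∑ i, starRingEnd ℂ (e.repr ⟨y, hy⟩ i) * hermForm H b x (e i) := by
    conv_lhs => rw [hs]
    simp only [hermForm, weightForm, map_sum, LinearEquiv.map_smulₛₗ, map_smul, smul_eq_mul,
      Finset.mul_sum]
    rw [Finset.sum_comm]
  rw [hexp]
  exact Finset.sum_eq_zero fun i _ => by rw [hx', mul_zero]

/-- By normality the fixed space `W` of `N` is stable under `G`, so its orthogonal complement is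
too. If that complement were nonzero, Kolchin's theorem would give in it a nonzero vector fixed by
`N`, hence in `W` and orthogonal to itself, against definiteness. So `N` fixes everything. -/
theorem isReductive_mumfordTate (hH : H.IsPolarizable) : IsReductive H.mumfordTate := by
  obtain ⟨b, hb⟩ := H.exists_polarizingFamily hH
  refine ⟨H.isConnectedAlg_mumfordTate, fun N hN hnorm _ _ huni => ?_⟩
  set W := fixedVectors N with hWdef
  have hW : ∀ g ∈ H.mumfordTate, ∀ y ∈ W, g.1 y ∈ W := fun g hg y hy =>
    apply_mem_fixedVectors (fun n hn => by
      have := hnorm g⁻¹ (inv_mem hg) n hn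
      rwa [inv_inv] at this) hy
  have hproj : ∀ m, ∀ y ∈ W, H.weightProj m y ∈ W := by
    intro m y hy n hn
    have := LinearMap.congr_fun (H.commute_weightProj (hN hn) m).eq y
    rw [Module.End.mul_apply, Module.End.mul_apply, hy n hn] at this
    exact this
  have hWtop : W = ⊤ := by
    by_contra hne
    set P := orthCompl H b W with hP
    obtain ⟨x₀, hx₀, hx₀0⟩ := exists_mem_orthCompl_ne_zero (H := H) (b := b) hne
    have : Nontrivial P := ⟨⟨⟨x₀, hx₀⟩, 0, fun h => hx₀0 (congrArg Subtype.val h)⟩⟩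
    let S : Submonoid (Module.End ℂ P) :=
      { carrier := {f | ∃ n ∈ N, ∀ x : P, (f x : Cx V) = n.1 x}
        one_mem' := ⟨1, one_mem _, fun _ => rfl⟩
        mul_mem' := by
          rintro f f' ⟨n, hn, h⟩ ⟨n', hn', h'⟩
          refine ⟨n * n', mul_mem hn hn', fun x => ?_⟩
          rw [Module.End.mul_apply, h, h', Units.val_mul, Module.End.mul_apply] }
    have hS : ∀ f ∈ S, IsNilpotent (f - 1) := by
      rintro f ⟨n, hn, h⟩
      obtain ⟨k, hk⟩ := huni n hn
      refine ⟨k, ?_⟩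
      have hpow : ∀ (j : ℕ) (x : P), (((f - 1) ^ j) x : Cx V) = ((n.1 - 1) ^ j) (x : Cx V) := by
        intro j
        induction j with
        | zero => intro x; rfl
        | succ j ih =>
          intro x
          rw [pow_succ, pow_succ, Module.End.mul_apply, Module.End.mul_apply, ih]
          congr 1
          rw [LinearMap.sub_apply, LinearMap.sub_apply, Submodule.coe_sub, h]
          rfl
      apply LinearMap.ext
      intro x
      apply Subtype.ext
      rw [hpow, hk]
      rfl
    obtain ⟨x, hx0, hx⟩ := exists_fixed_vector_of_unipotent S hS
    have hxW : (x : Cx V) ∈ W := by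
      intro n hn
      let f : Module.End ℂ P := n.1.restrict fun y hy => hb.apply_mem_orthCompl hW hproj (hN hn) hy
      have := hx f ⟨n, hn, fun _ => rfl⟩
      exact congrArg Subtype.val this
    have hne0 : (x : Cx V) ≠ 0 := fun h => hx0 (Subtype.ext h)
    exact (hb.hermForm_pos hne0).ne' (x.2 _ hxW)
  rw [eq_bot_iff]
  intro n hn
  rw [Subgroup.mem_bot]
  apply Units.ext
  apply LinearMap.ext
  intro x
  have hx : x ∈ W := by rw [hWtop]; trivial
  exact hx n hn

end Form

end RationalHodgeStructure

end HodgeMT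
end

theorem propositionh52 {V : Type*} [AddCommGroup V] [Module ℚ V] [Module.Finite ℚ V]
    (H : HodgeMT.RationalHodgeStructure V) :
    (H.SV2Star ↔ H.IsPolarizable) ∧
      (H.IsPolarizable → HodgeMT.IsReductive H.mumfordTate) :=
  ⟨⟨H.isPolarizable_of_sv2Star,
    HodgeMT.RationalHodgeStructure.sv2Star_of_isPolarizable⟩,
    HodgeMT.RationalHodgeStructure.isReductive_mumfordTate⟩
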